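/- **Setting.** Random processes $X(t)$, $t\in[0,1]$, take values in $L^2(\Omega,\mathscr F,P)$, with $\|Z\|=(\mathbb E Z^2)^{1/2}$; continuity, derivatives and integrals of processes are in quadratic mean. For $S\subseteq[0,1]$ put $\|X\|_p=\big(\int_S\|X(t)\|^p\,dt\big)^{1/p}$ for $1\le p<\infty$ and $\|X\|_\infty=\sup_{S}\|X(t)\|$, with $1/p=0$ for $p=\infty$; the same notation, with $|\cdot|$ in place of $\|\cdot\|$, is used for real functions. Write $C^m$ for processes (or functions) with continuous derivatives up to order $m$. * $X\in\mathcal C^{m,\beta}([a,b],V)$: $0<\beta\le1$, $X\in C^m([a,b])$, $V$ is positive and continuous, and for all $t,t+s\in[a,b]$ there is $\bar t$ between $t$ and $t+s$ with $\|X^{(m)}(t+s)-X^{(m)}(t)\|\le V(\bar t)^{1/2}|s|^\beta$. A constant in place of $V$ means the constant function. * $X\in\mathcal B^{m,\beta}([a,b],c)$: $0<\beta\le1$, $X\in C^m([a,b])$, $c$ is positive and continuous, and $\|X^{(m)}(t+s)-X^{(m)}(t)\|/|s|^\beta\to c(t)^{1/2}$ as $s\to0$, uniformly in $t\in[a,b]$.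 * $X\in\mathcal{CB}^{m,\beta}((0,1],c,V)$: $X\in\mathcal C^{m,\beta}([a,b],V)\cap\mathcal B^{m,\beta}([a,b],c)$ for all $0<a<b\le1$. *Splines.* For odd $k=2r+1$ and knots $T_n$: $0=t_0<\dots<t_n=1$, $H_k(X,T_n)$ is the piecewise polynomial of degree at most $k$ with $H_k^{(j)}(t_i)=X^{(j)}(t_i)$ for $j=0,\dots,r$ at both end points of each interval $[t_{i-1},t_i]$. For odd $q\le k$, the composite spline $H_{q,k}(X,T_n)$ equals $H_q(X,T_n)$ on $[0,t_1]$ and $H_k(X,T_n)$ on $[t_1,1]$. *Designs.* Let $h$ be a positive continuous probability density on $(0,1]$ such that, as $t\to0+$, $h(t)$ tends to $+\infty$ or to a finite positive limit. Put $H(t)=\int_0^th(u)\,du$, $G=H^{-1}$, $g(s)=1/h(G(s))$. The sequence $(T_n)$ is qRS$(h)$ if $H(t_i)=i/n$ for $0\le i\le n$. *Regular variation.* Write $r\in\mathcal R_\rho(0+)$ if $r$ is positive and measurable near $0+$ and $r(\lambda x)/r(x)\to\lambda^\rho$ as $x\to0+$ for every $\lambda>0$. Write $f\in\mathcal R^+(r,0+)$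 if $r\in\mathcal R_\rho(0+)$ for some $\rho\in\mathbb R$ and $f\le r$ on $(0,a]$ for some $a>0$. *Condition (C)* (for given $l,m,\alpha,\beta,p,h,V$): there is $r$ with $g\in\mathcal R^+(r,0+)$ and $r(s)=o\big(s^{(m+\beta)/(l+\alpha+1/p)-1}\big)$ as $s\to0+$, such that: if $p=\infty$, then $V(t)^{1/2}r(H(t))^{m+\beta}\to0$ as $t\to0+$; if $p<\infty$, then for some $R$ with $V(G(\cdot))^{1/2}\in\mathcal R^+(R,0+)$ and some $b>0$, the function $R(H(t))\,r(H(t))^{m+\beta}$ belongs to $L_p[0,b]$. *Constant.* Let $B$ be fractional Brownian motion with Hurst parameter $\beta\in(0,1)$, that is, the zero mean Gaussian process with covariance $\frac12(|t|^{2\beta}+|s|^{2\beta}-|t-s|^{2\beta})$. Put $B_0=B$ and $B_m(t)=\frac1{(m-1)!}\int_0^t(t-s)^{m-1}B(s)\,ds$ for $m\ge1$. Let $b^{m,\beta}_{k,p}$ be the norm $\|\cdot\|_p$ over $[0,1]$ of the difference of $B_m$ and its two-point Hermite interpolation polynomial of degree $k$ on $[0,1]$ (knots $0$ and $1$). **Theorem.**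 Let $1\le p\le\infty$, let $l,m\ge0$ be integers, and let $X\in\mathcal C^{l,\alpha}([0,1],M)\cap\mathcal{CB}^{m,\beta}((0,1],c,V)$ with $l+\alpha\le m+\beta$. Let the mean $f(t)=\mathbb E X(t)$ be in $\mathcal C^{m,\theta}([0,1],C)$ for some constant $C>0$ and some $\beta<\theta\le1$. Let $q\le k$ be odd with $l\le q\le 2l+1$ and $m\le k\le 2m+1$, let $(T_n)$ be qRS$(h)$, and let condition (C) hold. Then $$\lim_{n\to\infty}n^{m+\beta}\,\|X-H_{q,k}(X,T_n)\|_p=b^{m,\beta}_{k,p}\,\|c^{1/2}h^{-(m+\beta)}\|_p ,$$ where the norm on the left is over $[0,1]$ and the norm of $c^{1/2}h^{-(m+\beta)}$ is over $(0,1]$, and the limit is positive and finite. -/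

import Mathlib

open MeasureTheory ProbabilityTheory Set Filter Topology Polynomial Asymptotics
open scoped ENNReal NNReal

noncomputable section

namespace HermiteSpline

/-! ## Norms -/

section Norms

variable {E : Type*} [NormedAddCommGroup E]

/-- `‖X‖_p = (∫_S ‖X(t)‖^p dt)^{1/p}` for `p < ∞`, and `‖X‖_∞ = sup_S ‖X(t)‖`. For a random process
`X : ℝ → Lp ℝ 2 P` the inner norm is the quadratic mean norm `(E X(t)²)^{1/2}`. -/
def pNorm (p : ℝ≥0∞) (S : Set ℝ) (X : ℝ → E) : ℝ≥0∞ :=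
  if p = ∞ then ⨆ t ∈ S, ‖X t‖ₑ else (∫⁻ t in S, ‖X t‖ₑ ^ p.toReal) ^ (1 / p.toReal)

end Norms

/-! ## Smoothness classes

They are stated for functions with values in a normed space, and are used for random processes
`X : ℝ → Lp ℝ 2 P` (continuity and derivatives in quadratic mean) and for real functions. -/

section Classes

variable {E : Type*} [NormedAddCommGroup E] [NormedSpace ℝ E]

/-- `X ∈ C^{m,β}([a,b], V(·))`: `X` has continuous derivatives up to order `m` on `[a,b]`, and
`‖X^{(m)}(u) - X^{(m)}(t)‖ ≤ V(w)^{1/2} |u - t|^β` for some `w` between `t` and `u`. -/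
structure LocallyHolder (m : ℕ) (β : ℝ) (V : ℝ → ℝ) (a b : ℝ) (X : ℝ → E) : Prop where
  exponent_pos : 0 < β
  exponent_le_one : β ≤ 1
  contDiffOn : ContDiffOn ℝ m X (Icc a b)
  continuousOn : ContinuousOn V (Icc a b)
  pos : ∀ t ∈ Icc a b, 0 < V t
  bound : ∀ t ∈ Icc a b, ∀ u ∈ Icc a b, ∃ w ∈ uIcc t u,
    ‖iteratedDerivWithin m X (Icc a b) u - iteratedDerivWithin m X (Icc a b) t‖
      ≤ √(V w) * |u - t| ^ β

/-- `X ∈ B^{m,β}([a,b], c(·))`: `X` has continuous derivatives up to order `m` on `[a,b]`, and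
`‖X^{(m)}(t+s) - X^{(m)}(t)‖ / |s|^β → c(t)^{1/2}` as `s → 0`, uniformly in `t ∈ [a,b]`. -/
structure LocallyStationary (m : ℕ) (β : ℝ) (c : ℝ → ℝ) (a b : ℝ) (X : ℝ → E) : Prop where
  exponent_pos : 0 < β
  exponent_le_one : β ≤ 1
  contDiffOn : ContDiffOn ℝ m X (Icc a b)
  continuousOn : ContinuousOn c (Icc a b)
  pos : ∀ t ∈ Icc a b, 0 < c t
  limit : ∀ ε > 0, ∃ δ > 0, ∀ t ∈ Icc a b, ∀ s : ℝ, t + s ∈ Icc a b → s ≠ 0 → |s| < δ →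
    |‖iteratedDerivWithin m X (Icc a b) (t + s) - iteratedDerivWithin m X (Icc a b) t‖ / |s| ^ β
      - √(c t)| < ε

/-- `X ∈ CB^{m,β}((0,1], c(·), V(·))`. -/
def LocallyHolderStationary (m : ℕ) (β : ℝ) (c V : ℝ → ℝ) (X : ℝ → E) : Prop :=
  ∀ a b : ℝ, 0 < a → a < b → b ≤ 1 → LocallyHolder m β V a b X ∧ LocallyStationary m β c a b X

end Classes

/-! ## Hermite interpolation -/

section Hermite


theorem eq_zero_of_hermite (r : ℕ) (p : ℝ[X]) (hd : p.degree < (2 * r + 2 : ℕ))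
    (h0 : ∀ i ≤ r, (derivative^[i] p).eval 0 = 0) (h1 : ∀ i ≤ r, (derivative^[i] p).eval 1 = 0) :
    p = 0 := by
  by_contra hp
  have hm (a : ℝ) (h : ∀ i ≤ r, (derivative^[i] p).eval a = 0) : (X - C a) ^ (r + 1) ∣ p := by
    rw [← le_rootMultiplicity_iff hp]
    exact lt_rootMultiplicity_of_isRoot_iterate_derivative hp fun i hi => h i hi
  have hc : IsCoprime ((X - C (0 : ℝ)) ^ (r + 1)) ((X - C (1 : ℝ)) ^ (r + 1)) :=
    (isCoprime_X_sub_C_of_isUnit_sub (by simp)).pow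
  have := degree_le_of_dvd (hc.mul_dvd (hm 0 h0) (hm 1 h1)) hp
  rw [degree_mul, degree_pow, degree_pow, degree_X_sub_C, degree_X_sub_C] at this
  have h2 := this.trans_lt hd
  rw [nsmul_one] at h2
  have h3 : r + 1 + (r + 1) < 2 * r + 2 := by exact_mod_cast h2
  omega

theorem exists_hermite (r : ℕ) (y₀ y₁ : ℕ → ℝ) :
    ∃ p : ℝ[X], p.degree < (2 * r + 2 : ℕ) ∧ ∀ i ≤ r,
      (derivative^[i] p).eval 0 = y₀ i ∧ (derivative^[i] p).eval 1 = y₁ i := by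
  let T : degreeLT ℝ (2 * r + 2) →ₗ[ℝ] (Fin (r + 1) → ℝ) × (Fin (r + 1) → ℝ) :=
    (LinearMap.prod
      (LinearMap.pi fun i : Fin (r + 1) => (leval 0).comp ((derivative ^ (i : ℕ) : ℝ[X] →ₗ[ℝ] ℝ[X])))
      (LinearMap.pi fun i : Fin (r + 1) => (leval 1).comp ((derivative ^ (i : ℕ) : ℝ[X] →ₗ[ℝ] ℝ[X])))).comp
      (degreeLT ℝ (2 * r + 2)).subtype
  have hT : Function.Injective T := by
    rw [← LinearMap.ker_eq_bot, LinearMap.ker_eq_bot']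
    intro p hp
    ext1
    have h := Prod.ext_iff.1 hp
    refine eq_zero_of_hermite r p (mem_degreeLT.1 p.2) (fun i hi => ?_) (fun i hi => ?_)
    · have := congrFun h.1 ⟨i, by omega⟩
      simpa [T, Module.End.pow_apply] using this
    · have := congrFun h.2 ⟨i, by omega⟩
      simpa [T, Module.End.pow_apply] using this
  have e := degreeLTEquiv ℝ (2 * r + 2)
  have : FiniteDimensional ℝ (degreeLT ℝ (2 * r + 2)) := Module.Finite.equiv e.symm
  have hfr : Module.finrank ℝ (degreeLT ℝ (2 * r + 2)) =
      Module.finrank ℝ ((Fin (r + 1) → ℝ) × (Fin (r + 1) → ℝ)) := by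
    rw [e.finrank_eq]; simp; ring
  obtain ⟨p, hp⟩ := (LinearMap.injective_iff_surjective_of_finrank_eq_finrank hfr).1 hT
    (fun i => y₀ i, fun i => y₁ i)
  refine ⟨p, mem_degreeLT.1 p.2, fun i hi => ?_⟩
  have h := Prod.ext_iff.1 hp
  constructor
  · have := congrFun h.1 ⟨i, by omega⟩
    simpa [T, Module.End.pow_apply] using this
  · have := congrFun h.2 ⟨i, by omega⟩
    simpa [T, Module.End.pow_apply] using this

/-- The polynomial `p` of degree at most `2r+1` with `p^{(i)}(0) = y₀ i`, `p^{(i)}(1) = y₁ i`,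
`i ≤ r`. -/
def hermitePoly (r : ℕ) (y₀ y₁ : ℕ → ℝ) : ℝ[X] := (exists_hermite r y₀ y₁).choose

theorem hermitePoly_spec (r : ℕ) (y₀ y₁ : ℕ → ℝ) :
    (hermitePoly r y₀ y₁).degree < (2 * r + 2 : ℕ) ∧ ∀ i ≤ r,
      (derivative^[i] (hermitePoly r y₀ y₁)).eval 0 = y₀ i ∧
      (derivative^[i] (hermitePoly r y₀ y₁)).eval 1 = y₁ i :=
  (exists_hermite r y₀ y₁).choose_spec

variable {E : Type*} [NormedAddCommGroup E] [NormedSpace ℝ E]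

/-- The `j`-th derivative of a function on `[0,1]` (one-sided at the ends). -/
def deriv01 (j : ℕ) (X : ℝ → E) (t : ℝ) : E := iteratedDerivWithin j X (Icc 0 1) t

/-- The two-point Hermite interpolation of `X` at `a`, `b`: the polynomial of degree at most `2r+1`
with coefficients in `E` whose derivatives of order `0, …, r` at `a` and `b` are those of `X`. It is
written in the fundamental polynomials of `[0,1]`; see `hermitePiece_spec`. -/
def hermitePiece (r : ℕ) (X : ℝ → E) (a b t : ℝ) : E :=
  ∑ j ∈ Finset.range (r + 1), (b - a) ^ j •
    ((hermitePoly r (Pi.single j 1) 0).eval ((t - a) / (b - a)) • deriv01 j X a +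
      (hermitePoly r 0 (Pi.single j 1)).eval ((t - a) / (b - a)) • deriv01 j X b)

theorem hasIteratedDeriv_eval (p : ℝ[X]) (a h : ℝ) (v : E) (i : ℕ) :
    iteratedDeriv i (fun t => p.eval ((t - a) / h) • v) =
      fun t => ((h ^ i)⁻¹ * (derivative^[i] p).eval ((t - a) / h)) • v := by
  induction i with
  | zero => ext t; simp
  | succ i ih =>
    rw [iteratedDeriv_succ, ih]
    ext t
    have h1 : HasDerivAt (fun t : ℝ => (t - a) / h) (1 / h) t :=
      ((hasDerivAt_id t).sub_const a).div_const h
    have h2 := ((derivative^[i] p).hasDerivAt ((t - a) / h)).comp t h1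
    have h3 := ((h2.const_mul ((h ^ i)⁻¹)).smul_const v).deriv
    rw [Function.iterate_succ_apply']
    simp only [Function.comp_def] at h3
    rw [h3, pow_succ, mul_inv]
    congr 1
    ring

theorem hermitePiece_spec (r : ℕ) (X : ℝ → E) {a b : ℝ} (hab : a < b) {i : ℕ} (hi : i ≤ r) :
    iteratedDeriv i (hermitePiece r X a b) a = deriv01 i X a ∧
      iteratedDeriv i (hermitePiece r X a b) b = deriv01 i X b := by
  have hne : b - a ≠ 0 := (sub_pos.2 hab).ne'
  have key (t : ℝ) : iteratedDeriv i (hermitePiece r X a b) t =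
      ∑ j ∈ Finset.range (r + 1), (b - a) ^ j •
        ((((b - a) ^ i)⁻¹ * (derivative^[i] (hermitePoly r (Pi.single j 1) 0)).eval
            ((t - a) / (b - a))) • deriv01 j X a +
          (((b - a) ^ i)⁻¹ * (derivative^[i] (hermitePoly r 0 (Pi.single j 1))).eval
            ((t - a) / (b - a))) • deriv01 j X b) := by
    have hsm (p : ℝ[X]) (v : E) :
        ContDiff ℝ i (fun t : ℝ => p.eval ((t - a) / (b - a)) • v) :=
      have hp : ContDiff ℝ i (fun x : ℝ => p.eval x) := by
        simpa [coe_aeval_eq_eval] using p.contDiff_aeval (R := ℝ) (𝕜 := ℝ) i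
      (hp.comp ((contDiff_id.sub contDiff_const).div_const _)).smul contDiff_const
    unfold hermitePiece
    rw [iteratedDeriv_fun_sum fun j _ => (((hsm _ _).add (hsm _ _)).const_smul _).contDiffAt]
    refine Finset.sum_congr rfl fun j _ => ?_
    rw [iteratedDeriv_fun_const_smul_field, iteratedDeriv_fun_add (hsm _ _).contDiffAt
      (hsm _ _).contDiffAt, hasIteratedDeriv_eval, hasIteratedDeriv_eval]
  have hmem : i ∈ Finset.range (r + 1) := Finset.mem_range.2 (by omega)
  have hpow : (b - a) ^ i * ((b - a) ^ i)⁻¹ = 1 := mul_inv_cancel₀ (pow_ne_zero _ hne)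
  rw [key, key]
  simp only [sub_self, zero_div, div_self hne, ((hermitePoly_spec _ _ _).2 i hi).1,
    ((hermitePoly_spec _ _ _).2 i hi).2, Pi.zero_apply, mul_zero, zero_smul, zero_add, add_zero]
  constructor
  all_goals
    rw [Finset.sum_eq_single_of_mem i hmem]
    · rw [Pi.single_eq_same, mul_one, smul_smul, hpow, one_smul]
    · intro j _ hj
      rw [Pi.single_eq_of_ne hj.symm, mul_zero, zero_smul, smul_zero]

open Classical in
/-- The Hermite spline `H_k(X, T)(t)` of odd degree `k = 2r+1` with knots `T 0 < ⋯ < T n`. -/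
def hermiteSpline (k n : ℕ) (T : ℕ → ℝ) (X : ℝ → E) (t : ℝ) : E :=
  let i := Nat.findGreatest (fun i => T i ≤ t) (n - 1)
  hermitePiece ((k - 1) / 2) X (T i) (T (i + 1)) t

open Classical in
/-- The composite Hermite spline `H_{q,k}(X, T)`: `H_q` on `[0, T 1]` and `H_k` on `[T 1, 1]`. -/
def compositeSpline (q k n : ℕ) (T : ℕ → ℝ) (X : ℝ → E) (t : ℝ) : E :=
  if t ≤ T 1 then hermiteSpline q n T X t else hermiteSpline k n T X t

end Hermite

/-! ## Sampling designs -/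

section Designs

/-- The distribution function `H(t) = ∫₀ᵗ h`. -/
def distrib (h : ℝ → ℝ) (t : ℝ) : ℝ := ∫ u in (0 : ℝ)..t, h u

/-- The quantile function `G = H⁻¹`. -/
def quantile (h : ℝ → ℝ) (s : ℝ) : ℝ := sInf {t | t ∈ Icc (0 : ℝ) 1 ∧ s ≤ distrib h t}

/-- The quantile density `g(s) = 1 / h(G(s))`. -/
def quantileDensity (h : ℝ → ℝ) (s : ℝ) : ℝ := 1 / h (quantile h s)

/-- A positive probability density on `(0,1]`, continuous there, which at `0+` either tends to `+∞`
or has a finite positive limit (so that the quantile density is continuous on `[0,1]`).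
Integrability follows from `total`. -/
structure IsDesignDensity (h : ℝ → ℝ) : Prop where
  pos : ∀ t ∈ Ioc (0 : ℝ) 1, 0 < h t
  continuousOn : ContinuousOn h (Ioc 0 1)
  at_zero : Tendsto h (𝓝[>] 0) atTop ∨ ∃ y > 0, Tendsto h (𝓝[>] 0) (𝓝 y)
  total : ∫ u in (0 : ℝ)..1, h u = 1

/-- `T` is a quasi regular sequence of designs generated by `h`: `T n` has the knots
`0 = t₀ < t₁ < ⋯ < tₙ = 1` with `∫₀^{t_i} h = i / n`. -/
structure IsQRS (h : ℝ → ℝ) (T : ℕ → ℕ → ℝ) : Prop where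
  density : IsDesignDensity h
  knot_zero : ∀ n ≥ 1, T n 0 = 0
  knot_mem : ∀ n ≥ 1, ∀ i ≤ n, T n i ∈ Icc (0 : ℝ) 1
  knot : ∀ n ≥ 1, ∀ i ≤ n, distrib h (T n i) = i / n

/-- `f ∈ R_ρ(0+)`: `f` is positive and measurable near `0+` and regularly varying there with
index `ρ`. -/
structure RegularlyVarying (ρ : ℝ) (f : ℝ → ℝ) : Prop where
  pos_measurable : ∃ a > 0, (∀ x ∈ Ioc (0 : ℝ) a, 0 < f x) ∧ Measurable ((Ioc (0 : ℝ) a).domRestrict f)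
  limit : ∀ lam > 0, Tendsto (fun x => f (lam * x) / f x) (𝓝[>] 0) (𝓝 (lam ^ ρ))

/-- `f ∈ R⁺(r(·), 0+)`: `r` is regularly varying at `0+` with some index, and dominates `f` near
`0+`. -/
def RegularlyDominated (f r : ℝ → ℝ) : Prop :=
  (∃ ρ, RegularlyVarying ρ r) ∧ ∃ a > 0, ∀ s ∈ Ioc (0 : ℝ) a, f s ≤ r s

/-- Condition (C) on the density `h` and the local Hölder function `V`. Here `p⁻¹ = 0` for
`p = ∞`. -/
def ConditionC (l m : ℕ) (α β : ℝ) (p : ℝ≥0∞) (h V : ℝ → ℝ) : Prop :=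
  ∃ r : ℝ → ℝ, RegularlyDominated (quantileDensity h) r ∧
    (r =o[𝓝[>] 0] fun s : ℝ => s ^ ((m + β) / (l + α + (p⁻¹).toReal) - 1)) ∧
    (p = ∞ → Tendsto (fun t => √(V t) * r (distrib h t) ^ (m + β)) (𝓝[>] 0) (𝓝 0)) ∧
    (p ≠ ∞ → ∃ R : ℝ → ℝ, RegularlyDominated (fun s => √(V (quantile h s))) R ∧
      ∃ b > 0, MemLp (fun t => R (distrib h t) * r (distrib h t) ^ (m + β)) p
        (volume.restrict (Icc 0 b)))

end Designs

/-! ## Fractional Brownian motion -/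

section FBM

/-- `B` is a fractional Brownian motion with Hurst parameter `β`: a centred Gaussian process with
covariance `(|t|^{2β} + |s|^{2β} - |t - s|^{2β}) / 2`. -/
structure IsFractionalBrownianMotion {Ω : Type*} [MeasurableSpace Ω] (P : Measure Ω) (β : ℝ)
    (B : ℝ → Lp ℝ 2 P) : Prop where
  gaussian : IsGaussianProcess (fun t => (B t : Ω → ℝ)) P
  mean_zero : ∀ t, ∫ ω, B t ω ∂P = 0
  cov_eq : ∀ t s, cov[B t, B s; P] =
    (|t| ^ (2 * β) + |s| ^ (2 * β) - |t - s| ^ (2 * β)) / 2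

/-! An `L²(ℝ)` curve with the covariance of fractional Brownian motion. -/

/-- The spectral weight `|x|^{-(2β+1)}` of fractional Brownian motion. -/
def specWeight (β x : ℝ) : ℝ := |x| ^ (-(2 * β + 1))

theorem specWeight_nonneg (β x : ℝ) : 0 ≤ specWeight β x := Real.rpow_nonneg (abs_nonneg x) _

theorem specWeight_integrable {β : ℝ} (h0 : 0 < β) (h1 : β < 1) (t : ℝ) :
    Integrable (fun x => (1 - Real.cos (t * x)) * specWeight β x) := by
  have hm : Measurable (fun x => (1 - Real.cos (t * x)) * specWeight β x) := by
    unfold specWeight; fun_prop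
  have hpos : IntegrableOn (fun x => (1 - Real.cos (t * x)) * specWeight β x) (Ioi 0) := by
    rw [← Ioc_union_Ioi_eq_Ioi zero_le_one]
    refine IntegrableOn.union ?_ ?_
    · have h : IntegrableOn (fun x : ℝ => t ^ 2 / 2 * x ^ (1 - 2 * β)) (Ioc 0 1) := by
        refine Integrable.const_mul ?_ _
        exact (intervalIntegrable_iff_integrableOn_Ioc_of_le zero_le_one).1
          (intervalIntegral.intervalIntegrable_rpow' (by linarith))
      refine Integrable.mono' h hm.aestronglyMeasurable ?_
      filter_upwards [ae_restrict_mem measurableSet_Ioc] with x hx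
      have hc := Real.one_sub_sq_div_two_le_cos (x := t * x)
      have hc' := Real.cos_le_one (t * x)
      rw [Real.norm_of_nonneg (mul_nonneg (by linarith) (specWeight_nonneg _ _)), specWeight,
        abs_of_pos hx.1]
      have : x ^ (1 - 2 * β) = x ^ 2 * x ^ (-(2 * β + 1)) := by
        rw [← Real.rpow_natCast, ← Real.rpow_add hx.1]; congr 1; push_cast; ring
      rw [this, ← mul_assoc]
      refine mul_le_mul_of_nonneg_right ?_ (Real.rpow_nonneg hx.1.le _)
      nlinarith
    · have h : IntegrableOn (fun x : ℝ => 2 * x ^ (-(2 * β + 1))) (Ioi 1) :=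
        (integrableOn_Ioi_rpow_of_lt (by linarith) one_pos).const_mul 2
      refine Integrable.mono' h hm.aestronglyMeasurable ?_
      filter_upwards [ae_restrict_mem measurableSet_Ioi] with x hx
      have hx' : (0 : ℝ) < x := one_pos.trans hx
      have hc' := Real.cos_le_one (t * x)
      have hc := Real.neg_one_le_cos (t * x)
      rw [Real.norm_of_nonneg (mul_nonneg (by linarith) (specWeight_nonneg _ _)), specWeight,
        abs_of_pos hx']
      exact mul_le_mul_of_nonneg_right (by linarith) (Real.rpow_nonneg hx'.le _)
  have hneg : IntegrableOn (fun x => (1 - Real.cos (t * x)) * specWeight β x) (Iio 0) := by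
    have := hpos.comp_neg
    simpa [specWeight] using this
  have h0 : IntegrableOn (fun x => (1 - Real.cos (t * x)) * specWeight β x) (Iic 0) :=
    (integrableOn_Iic_iff_integrableOn_Iio).2 hneg
  rw [← integrableOn_univ, ← Iic_union_Ioi (a := (0 : ℝ))]
  exact h0.union hpos

/-- The normalizing constant `∫ (1 - cos x) |x|^{-(2β+1)} dx`. -/
def specConst (β : ℝ) : ℝ := ∫ x, (1 - Real.cos x) * specWeight β x

theorem specConst_pos {β : ℝ} (h0 : 0 < β) (h1 : β < 1) : 0 < specConst β := by
  have hn : ∀ x, 0 ≤ (1 - Real.cos x) * specWeight β x := fun x =>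
    mul_nonneg (by linarith [Real.cos_le_one x]) (specWeight_nonneg _ _)
  have hi : Integrable (fun x => (1 - Real.cos x) * specWeight β x) := by
    simpa using specWeight_integrable h0 h1 1
  rw [specConst, integral_pos_iff_support_of_nonneg hn hi]
  refine lt_of_lt_of_le ?_ (measure_mono (s := Ioo 0 1) fun x hx => ?_)
  · simp
  · have hx' : 0 < specWeight β x := Real.rpow_pos_of_pos (abs_pos.2 hx.1.ne') _
    have : Real.cos x < 1 := by
      have := Real.cos_lt_cos_of_nonneg_of_le_pi le_rfl (by linarith [hx.2, Real.pi_gt_three]) hx.1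
      simpa using this
    exact (mul_pos (by linarith) hx').ne'

theorem specWeight_integral {β : ℝ} (h0 : 0 < β) (t : ℝ) :
    ∫ x, (1 - Real.cos (t * x)) * specWeight β x = |t| ^ (2 * β) * specConst β := by
  rcases eq_or_ne t 0 with rfl | ht
  · simp [Real.zero_rpow (by linarith : 2 * β ≠ 0)]
  have ht' := abs_pos.2 ht
  have h : ∀ x, (1 - Real.cos (t * x)) * specWeight β x
      = |t| ^ (2 * β + 1) * ((1 - Real.cos (t * x)) * specWeight β (t * x)) := by
    intro x
    rw [specWeight, specWeight, abs_mul, Real.mul_rpow ht'.le (abs_nonneg x), Real.rpow_neg ht'.le]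
    have := (Real.rpow_pos_of_pos ht' (2 * β + 1)).ne'
    field_simp
  simp_rw [h]
  rw [integral_const_mul,
    Measure.integral_comp_mul_left (fun y => (1 - Real.cos y) * specWeight β y), smul_eq_mul,
    ← specConst, abs_inv, Real.rpow_add ht', Real.rpow_one]
  field_simp

/-- A real form of the harmonizable kernel of fractional Brownian motion. -/
def specKernel (β t x : ℝ) : ℝ :=
  (1 - Real.cos (t * x) + Real.sin (t * x)) * |x| ^ (-(β + 1 / 2))

theorem specKernel_mul (β t s x : ℝ) (hx : x ≠ 0) : specKernel β t x * specKernel β s x =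
    ((1 - Real.cos (t * x) + Real.sin (t * x)) * (1 - Real.cos (s * x) + Real.sin (s * x)))
      * specWeight β x := by
  have : specWeight β x = |x| ^ (-(β + 1 / 2)) * |x| ^ (-(β + 1 / 2)) := by
    rw [specWeight, ← Real.rpow_add (abs_pos.2 hx)]; congr 1; ring
  rw [this, specKernel, specKernel]; ring

theorem specKernel_memLp {β : ℝ} (h0 : 0 < β) (h1 : β < 1) (t : ℝ) :
    MemLp (specKernel β t) 2 := by
  have hm : Measurable (specKernel β t) := by unfold specKernel; fun_prop
  rw [memLp_two_iff_integrable_sq hm.aestronglyMeasurable]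
  refine Integrable.mono' ((specWeight_integrable h0 h1 t).const_mul 4)
    (hm.pow_const 2).aestronglyMeasurable ?_
  filter_upwards [compl_mem_ae_iff.2 (measure_singleton (0 : ℝ))] with x hx
  rw [Real.norm_of_nonneg (sq_nonneg _), pow_two, specKernel_mul _ _ _ _ hx, ← mul_assoc]
  refine mul_le_mul_of_nonneg_right ?_ (specWeight_nonneg _ _)
  nlinarith [Real.sin_sq_add_cos_sq (t * x), sq_nonneg (1 - Real.cos (t * x) - Real.sin (t * x))]

theorem specKernel_inner {β : ℝ} (h0 : 0 < β) (h1 : β < 1) (t s : ℝ) :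
    ∫ x, specKernel β t x * specKernel β s x =
      (|t| ^ (2 * β) + |s| ^ (2 * β) - |t - s| ^ (2 * β)) * specConst β := by
  set E : ℝ → ℝ := fun x => (1 - Real.cos (t * x)) * specWeight β x
    + (1 - Real.cos (s * x)) * specWeight β x - (1 - Real.cos ((t - s) * x)) * specWeight β x
  set O : ℝ → ℝ := fun x => ((1 - Real.cos (t * x)) * Real.sin (s * x)
    + Real.sin (t * x) * (1 - Real.cos (s * x))) * specWeight β x
  have hE : Integrable E := ((specWeight_integrable h0 h1 t).add (specWeight_integrable h0 h1 s)).sub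
    (specWeight_integrable h0 h1 (t - s))
  have hae : (fun x => specKernel β t x * specKernel β s x) =ᵐ[volume] fun x => E x + O x := by
    filter_upwards [compl_mem_ae_iff.2 (measure_singleton (0 : ℝ))] with x hx
    rw [specKernel_mul _ _ _ _ hx]
    simp only [E, O]
    rw [sub_mul t s x, Real.cos_sub]; ring
  have hK : Integrable (fun x => specKernel β t x * specKernel β s x) :=
    (specKernel_memLp h0 h1 t).integrable_mul (specKernel_memLp h0 h1 s)
  have hO : Integrable O := by
    have := (hK.congr hae).sub hE
    refine this.congr (Eventually.of_forall fun x => ?_)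
    simp
  have hO0 : ∫ x, O x = 0 := by
    have h2 := integral_neg_eq_self O volume
    have h3 : ∀ x, O (-x) = -O x := fun x => by
      simp only [O, specWeight, mul_neg, Real.cos_neg, Real.sin_neg, abs_neg]; ring
    simp_rw [h3, integral_neg] at h2
    linarith
  rw [integral_congr_ae hae, integral_add hE hO, hO0, integral_sub, integral_add,
    specWeight_integral h0, specWeight_integral h0, specWeight_integral h0]
  · ring
  all_goals first
    | exact specWeight_integrable h0 h1 _
    | exact (specWeight_integrable h0 h1 _).add (specWeight_integrable h0 h1 _)

theorem exists_specCurve {β : ℝ} (h0 : 0 < β) (h1 : β < 1) :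
    ∃ f : ℝ → Lp ℝ 2 (volume : Measure ℝ), ∀ t s, inner ℝ (f t) (f s) =
      (|t| ^ (2 * β) + |s| ^ (2 * β) - |t - s| ^ (2 * β)) / 2 := by
  have hC := specConst_pos h0 h1
  refine ⟨fun t => (Real.sqrt (2 * specConst β))⁻¹ • (specKernel_memLp h0 h1 t).toLp _,
    fun t s => ?_⟩
  have : inner ℝ ((specKernel_memLp h0 h1 t).toLp _) ((specKernel_memLp h0 h1 s).toLp _)
      = ∫ x, specKernel β t x * specKernel β s x := by
    rw [L2.inner_def]
    refine integral_congr_ae ?_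
    filter_upwards [(specKernel_memLp h0 h1 t).coeFn_toLp, (specKernel_memLp h0 h1 s).coeFn_toLp]
      with x h2 h3
    simp [h2, h3, mul_comm]
  rw [real_inner_smul_left, real_inner_smul_right, this, specKernel_inner h0 h1, ← mul_assoc,
    ← mul_inv, Real.mul_self_sqrt (by positivity)]
  field_simp

/-! The isonormal Gaussian process on a space of Gaussian sequences. -/

/-- The law of a sequence of independent standard Gaussian random variables. -/
def gaussianSeq : Measure (ℕ → ℝ) := Measure.infinitePi fun _ => gaussianReal 0 1

instance : IsProbabilityMeasure gaussianSeq := by unfold gaussianSeq; infer_instance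

theorem gaussianSeq_memLp (n : ℕ) : MemLp (fun ω : ℕ → ℝ => ω n) 2 gaussianSeq := by
  have h := measurePreserving_eval_infinitePi (fun _ : ℕ => gaussianReal 0 1) n
  exact (memLp_id_gaussianReal (μ := 0) (v := 1) 2).comp_measurePreserving h

theorem gaussianSeq_indep : iIndepFun (fun n (ω : ℕ → ℝ) => ω n) gaussianSeq :=
  iIndepFun_infinitePi (P := fun _ : ℕ => gaussianReal 0 1) (X := fun _ x => x)
    (fun _ => measurable_id)

theorem gaussianSeq_law (n : ℕ) : gaussianSeq.map (fun ω => ω n) = gaussianReal 0 1 :=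
  (measurePreserving_eval_infinitePi (fun _ : ℕ => gaussianReal 0 1) n).map_eq

/-- The coordinates of `gaussianSeq` as elements of `L²`. -/
def gaussianCoord (n : ℕ) : Lp ℝ 2 gaussianSeq := (gaussianSeq_memLp n).toLp _

theorem gaussianCoord_orthonormal : Orthonormal ℝ gaussianCoord := by
  have hm (n : ℕ) : ∫ ω : ℕ → ℝ, ω n ∂gaussianSeq = 0 := by
    have := integral_id_gaussianReal (μ := 0) (v := 1)
    rw [← gaussianSeq_law n, integral_map (measurable_pi_apply n).aemeasurable (by fun_prop)] at this
    exact this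
  have hi (i j : ℕ) : inner ℝ (gaussianCoord i) (gaussianCoord j)
      = ∫ ω : ℕ → ℝ, ω j * ω i ∂gaussianSeq := by
    rw [L2.inner_def]
    refine integral_congr_ae ?_
    filter_upwards [(gaussianSeq_memLp i).coeFn_toLp, (gaussianSeq_memLp j).coeFn_toLp] with ω h1 h2
    simp [gaussianCoord, h1, h2]
  rw [orthonormal_iff_ite]
  intro i j
  rw [hi]
  split_ifs with h
  · subst h
    have := variance_id_gaussianReal (μ := 0) (v := 1)
    rw [← gaussianSeq_law i, variance_map aemeasurable_id (measurable_pi_apply i).aemeasurable,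
      Function.id_comp, variance_of_integral_eq_zero (measurable_pi_apply i).aemeasurable (hm i)]
      at this
    simpa [pow_two] using this
  · have := (gaussianSeq_indep.indepFun (Ne.symm h)).integral_fun_mul_eq_mul_integral
      (measurable_pi_apply j).aestronglyMeasurable (measurable_pi_apply i).aestronglyMeasurable
    rw [this, hm, hm, zero_mul]

theorem gaussianSeq_isGaussianProcess :
    IsGaussianProcess (fun (n : ℕ) (ω : ℕ → ℝ) => ω n) gaussianSeq where
  hasGaussianLaw I := by
    refine iIndepFun.hasGaussianLaw (X := fun (i : I) (ω : ℕ → ℝ) => ω i) (fun i => ⟨?_⟩)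
      (gaussianSeq_indep.precomp Subtype.val_injective)
    rw [gaussianSeq_law]; infer_instance

/-- The centred Gaussian elements of `L²`. -/
def IsCentredGaussian (Z : Lp ℝ 2 gaussianSeq) : Prop :=
  gaussianSeq.map Z = gaussianReal 0 (‖Z‖ ^ 2).toNNReal

theorem norm_sq_L2 {Ω : Type*} [MeasurableSpace Ω] {P : Measure Ω} (Z : Lp ℝ 2 P) :
    ‖Z‖ ^ 2 = ∫ ω, Z ω ^ 2 ∂P := by
  rw [← real_inner_self_eq_norm_sq, L2.inner_def]
  simp [pow_two]

theorem isCentredGaussian_sum {ι : Type*} (e : ι → ℕ) (s : Finset ι) (a : ι → ℝ) :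
    IsCentredGaussian (∑ i ∈ s, a i • gaussianCoord (e i)) := by
  set Z := (∑ i ∈ s, a i • gaussianCoord (e i)) with hZ
  have hcoe : Z =ᵐ[gaussianSeq] fun ω => ∑ i ∈ s, a i * ω (e i) := by
    rw [hZ]
    have h1 : ∀ᵐ ω ∂gaussianSeq, ∀ n, gaussianCoord n ω = ω n :=
      ae_all_iff.2 fun n => (gaussianSeq_memLp n).coeFn_toLp
    clear_value Z
    clear hZ
    induction s using Finset.cons_induction with
    | empty =>
      exact Eventually.of_forall fun ω => by simp
    | cons i s hi ih =>
      rw [Finset.sum_cons]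
      filter_upwards [Lp.coeFn_add (a i • gaussianCoord (e i)) (∑ i ∈ s, a i • gaussianCoord (e i)),
        Lp.coeFn_smul (a i) (gaussianCoord (e i)), ih, h1] with ω h2 h3 h4 h5
      rw [h2, Pi.add_apply, h3, h4, Finset.sum_cons, Pi.smul_apply, h5, smul_eq_mul]
  have hG : HasGaussianLaw (fun ω : ℕ → ℝ => ∑ i ∈ s, a i * ω (e i)) gaussianSeq :=
    ((gaussianSeq_isGaussianProcess.comp_right e).smul a).hasGaussianLaw_fun_sum
  have hG' : HasGaussianLaw Z gaussianSeq := hG.congr hcoe.symm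
  have hm : ∫ ω, Z ω ∂gaussianSeq = 0 := by
    rw [integral_congr_ae hcoe, integral_finsetSum]
    · refine Finset.sum_eq_zero fun i _ => ?_
      have := integral_id_gaussianReal (μ := 0) (v := 1)
      rw [← gaussianSeq_law (e i),
        integral_map (measurable_pi_apply (e i)).aemeasurable (by fun_prop)] at this
      rw [integral_const_mul, this, mul_zero]
    · intro i _
      exact ((gaussianSeq_memLp (e i)).integrable one_le_two).const_mul _
  rw [IsCentredGaussian, hG'.map_eq_gaussianReal, hm,
    variance_of_integral_eq_zero hG'.aemeasurable hm, norm_sq_L2]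

theorem isClosed_isCentredGaussian : IsClosed {Z | IsCentredGaussian Z} := by
  have key : ∀ Z : Lp ℝ 2 gaussianSeq, IsCentredGaussian Z ↔ ∀ θ : ℝ,
      ∫ ω, Complex.exp (θ * (Z ω : ℂ) * Complex.I) ∂gaussianSeq
        = Complex.exp (-((‖Z‖ ^ 2 : ℝ) : ℂ) * θ ^ 2 / 2) := by
    intro Z
    have hZ : AEMeasurable Z gaussianSeq := (Lp.aestronglyMeasurable Z).aemeasurable
    have : IsProbabilityMeasure (gaussianSeq.map Z) := Measure.isProbabilityMeasure_map hZ
    rw [IsCentredGaussian]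
    have h1 (θ : ℝ) : charFun (gaussianSeq.map Z) θ
        = ∫ ω, Complex.exp (θ * (Z ω : ℂ) * Complex.I) ∂gaussianSeq := by
      rw [charFun_apply_real, integral_map hZ (by fun_prop)]
    have h2 (θ : ℝ) : charFun (gaussianReal 0 (‖Z‖ ^ 2).toNNReal) θ
        = Complex.exp (-((‖Z‖ ^ 2 : ℝ) : ℂ) * θ ^ 2 / 2) := by
      rw [charFun_gaussianReal, Real.coe_toNNReal _ (sq_nonneg _)]
      congr 1; simp; ring
    constructor
    · intro h θ
      rw [← h1, h, h2]
    · intro h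
      refine Measure.ext_of_charFun ?_
      ext θ
      rw [h1, h2, h]
  have : {Z : Lp ℝ 2 gaussianSeq | IsCentredGaussian Z} = ⋂ θ : ℝ, {Z |
      ∫ ω, Complex.exp (θ * (Z ω : ℂ) * Complex.I) ∂gaussianSeq
        = Complex.exp (-((‖Z‖ ^ 2 : ℝ) : ℂ) * θ ^ 2 / 2)} := by
    ext Z; simp only [mem_ofPred_eq, mem_iInter]; exact key Z
  rw [this]
  refine isClosed_iInter fun θ => isClosed_eq ?_ (by fun_prop)
  have hint (Z : Lp ℝ 2 gaussianSeq) :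
      Integrable (fun ω => Complex.exp (θ * (Z ω : ℂ) * Complex.I)) gaussianSeq := by
    refine Integrable.of_bound (C := 1) ?_ ?_
    · have := (Lp.aestronglyMeasurable Z).aemeasurable
      exact (by fun_prop : AEMeasurable _ _).aestronglyMeasurable
    · refine Eventually.of_forall fun ω => ?_
      rw [← Complex.ofReal_mul, Complex.norm_exp_ofReal_mul_I]
  refine (LipschitzWith.of_dist_le_mul (K := ‖θ‖₊) fun Z Y => ?_).continuous
  rw [dist_eq_norm, ← integral_sub (hint Z) (hint Y)]
  have hb : ∀ ω, ‖Complex.exp (θ * (Z ω : ℂ) * Complex.I) - Complex.exp (θ * (Y ω : ℂ) * Complex.I)‖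
      ≤ ‖θ‖ * ‖Z ω - Y ω‖ := by
    intro ω
    have h3 : Complex.exp (θ * (Z ω : ℂ) * Complex.I)
        = Complex.exp (Complex.I * ((θ * Z ω - θ * Y ω : ℝ) : ℂ)) *
          Complex.exp (θ * (Y ω : ℂ) * Complex.I) := by
      rw [← Complex.exp_add]; congr 1; push_cast; ring
    rw [h3, ← sub_one_mul, norm_mul, ← Complex.ofReal_mul θ (Y ω), Complex.norm_exp_ofReal_mul_I,
      mul_one]
    refine (Real.norm_exp_I_mul_ofReal_sub_one_le).trans (le_of_eq ?_)
    rw [← mul_sub, norm_mul]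
  have hi : Integrable (fun ω => ‖θ‖ * ‖Z ω - Y ω‖) gaussianSeq :=
    ((((Lp.memLp Z).sub (Lp.memLp Y)).integrable one_le_two).norm).const_mul _
  calc _ ≤ ∫ ω, ‖θ‖ * ‖Z ω - Y ω‖ ∂gaussianSeq :=
        norm_integral_le_of_norm_le hi (Eventually.of_forall hb)
    _ = ‖θ‖ * ∫ ω, ‖(Z - Y) ω‖ ∂gaussianSeq := by
        rw [integral_const_mul]
        congr 1
        refine integral_congr_ae ?_
        filter_upwards [Lp.coeFn_sub Z Y] with ω h
        rw [h, Pi.sub_apply]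
    _ ≤ ‖θ‖ * ‖Z - Y‖ := by
        gcongr
        have hae := Lp.aestronglyMeasurable (Z - Y)
        rw [Lp.norm_def, integral_norm_eq_lintegral_enorm hae, ← eLpNorm_one_eq_lintegral_enorm]
        exact ENNReal.toReal_mono (Lp.memLp (Z - Y)).eLpNorm_ne_top
          (eLpNorm_le_eLpNorm_of_exponent_le one_le_two hae)
    _ = _ := by rw [dist_eq_norm]; rfl

theorem countable_of_orthonormal {H : Type*} [NormedAddCommGroup H] [InnerProductSpace ℝ H]
    [SecondCountableTopology H] {ι : Type*} {v : ι → H} (hv : Orthonormal ℝ v) : Countable ι := by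
  have hd : ∀ i j, i ≠ j → ‖v i - v j‖ ^ 2 = 2 := by
    intro i j hij
    rw [norm_sub_sq_real, hv.1, hv.1, hv.2 hij]; norm_num
  have : (univ : Set ι).PairwiseDisjoint (fun i => Metric.ball (v i) (1/2)) := by
    intro i _ j _ hij
    refine Metric.ball_disjoint_ball ?_
    rw [dist_eq_norm]
    nlinarith [hd i j hij, norm_nonneg (v i - v j)]
  have h2 := this.countable_of_isOpen (fun i _ => Metric.isOpen_ball)
    (fun i _ => ⟨v i, by simp⟩)
  exact countable_univ_iff.mp h2

theorem exists_isonormal (H : Type) [NormedAddCommGroup H] [InnerProductSpace ℝ H]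
    [CompleteSpace H] [SecondCountableTopology H] :
    ∃ W : H →ₗᵢ[ℝ] Lp ℝ 2 gaussianSeq, ∀ v, IsCentredGaussian (W v) := by
  obtain ⟨w, b, -⟩ := exists_hilbertBasis ℝ H
  have := countable_of_orthonormal b.orthonormal
  obtain ⟨e, he⟩ := exists_injective_nat w
  have hO : OrthogonalFamily ℝ (fun _ : w => ℝ)
      fun i => LinearIsometry.toSpanSingleton ℝ (Lp ℝ 2 gaussianSeq)
        ((gaussianCoord_orthonormal.comp e he).1 i) :=
    (gaussianCoord_orthonormal.comp e he).orthogonalFamily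
  refine ⟨hO.linearIsometry.comp b.repr.toLinearIsometry, fun v => ?_⟩
  have hs := hO.hasSum_linearIsometry (b.repr v)
  refine isClosed_isCentredGaussian.mem_of_tendsto hs (Eventually.of_forall fun s => ?_)
  exact isCentredGaussian_sum e s (fun i => b.repr v i)

theorem isGaussianProcess_isonormal {H : Type} [NormedAddCommGroup H] [InnerProductSpace ℝ H]
    {W : H →ₗᵢ[ℝ] Lp ℝ 2 gaussianSeq} (hW : ∀ v, IsCentredGaussian (W v)) (f : ℝ → H) :
    IsGaussianProcess (fun t => (W (f t) : (ℕ → ℝ) → ℝ)) gaussianSeq where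
  hasGaussianLaw I := by
    have hm : AEMeasurable (fun ω => I.restrict fun t => W (f t) ω) gaussianSeq :=
      aemeasurable_pi_lambda _ fun t => (Lp.aestronglyMeasurable (W (f t))).aemeasurable
    refine ⟨isGaussian_of_isGaussian_map fun L => ?_⟩
    rw [AEMeasurable.map_map_of_aemeasurable (by fun_prop) hm]
    have : (L ∘ fun ω => I.restrict fun t => W (f t) ω) =ᵐ[gaussianSeq]
        W (∑ t : I, L (Pi.single t 1) • f t) := by
      have h1 (s : Finset I) : (W (∑ t ∈ s, L (Pi.single t 1) • f t) : (ℕ → ℝ) → ℝ)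
          =ᵐ[gaussianSeq] fun ω => ∑ t ∈ s, L (Pi.single t 1) * W (f t) ω := by
        induction s using Finset.cons_induction with
        | empty =>
          exact Eventually.of_forall fun ω => by simp
        | cons i s hi ih =>
          rw [Finset.sum_cons, map_add, map_smul]
          filter_upwards [Lp.coeFn_add (L (Pi.single i 1) • W (f i))
            (W (∑ t ∈ s, L (Pi.single t 1) • f t)),
            Lp.coeFn_smul (L (Pi.single i 1)) (W (f i)), ih] with ω h2 h3 h4
          rw [h2, Pi.add_apply, h3, h4, Finset.sum_cons, Pi.smul_apply, smul_eq_mul]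
      filter_upwards [h1 Finset.univ] with ω h
      rw [h, Function.comp_apply, ← ContinuousLinearMap.coe_coe, L.toLinearMap.pi_apply_eq_sum_univ]
      refine Finset.sum_congr rfl fun t _ => ?_
      rw [smul_eq_mul, mul_comm]
      congr 2
      ext j
      simp [Pi.single_apply, eq_comm]
    rw [Measure.map_congr this, hW]
    infer_instance

theorem exists_fbm_of_kernel {β : ℝ} {f : ℝ → Lp ℝ 2 (volume : Measure ℝ)}
    (hf : ∀ t s, inner ℝ (f t) (f s) =
      (|t| ^ (2 * β) + |s| ^ (2 * β) - |t - s| ^ (2 * β)) / 2) :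
    ∃ B : ℝ → Lp ℝ 2 gaussianSeq, IsFractionalBrownianMotion gaussianSeq β B := by
  have : Fact ((2 : ℝ≥0∞) ≠ ∞) := ⟨by simp⟩
  have := Lp.SecondCountableTopology (p := 2) (μ := (volume : Measure ℝ)) (E := ℝ)
  obtain ⟨W, hW⟩ := exists_isonormal (Lp ℝ 2 (volume : Measure ℝ))
  have hm (t : ℝ) : ∫ ω, W (f t) ω ∂gaussianSeq = 0 := by
    have := integral_id_gaussianReal (μ := 0) (v := (‖W (f t)‖ ^ 2).toNNReal)
    rw [← hW (f t), integral_map (Lp.aestronglyMeasurable _).aemeasurable (by fun_prop)] at this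
    exact this
  refine ⟨fun t => W (f t), isGaussianProcess_isonormal hW f, hm, fun t s => ?_⟩
  rw [covariance_eq_sub (Lp.memLp _) (Lp.memLp _), hm, hm, ← hf, ← W.inner_map_map, L2.inner_def]
  simp [mul_comm]

theorem exists_fbm {β : ℝ} (hβ : 0 < β ∧ β < 1) :
    ∃ B : ℝ → Lp ℝ 2 gaussianSeq, IsFractionalBrownianMotion gaussianSeq β B := by
  obtain ⟨f, hf⟩ := exists_specCurve hβ.1 hβ.2
  exact exists_fbm_of_kernel hf

open Classical in
/-- A fractional Brownian motion with Hurst parameter `β ∈ (0,1)`. -/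
def fbm (β : ℝ) : ℝ → Lp ℝ 2 gaussianSeq :=
  if hβ : 0 < β ∧ β < 1 then (exists_fbm hβ).choose else 0

theorem isFractionalBrownianMotion_fbm {β : ℝ} (h0 : 0 < β) (h1 : β < 1) :
    IsFractionalBrownianMotion gaussianSeq β (fbm β) := by
  rw [fbm, dif_pos ⟨h0, h1⟩]
  exact (exists_fbm ⟨h0, h1⟩).choose_spec

/-- The `m`-fold integrated fractional Brownian motion on `[0,1]`: `B_0 = B` and
`B_m(t) = ∫₀ᵗ (t-s)^{m-1} B(s) ds / (m-1)!` (integral in quadratic mean) for `m ≥ 1`. -/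
def integratedFBM (m : ℕ) (β : ℝ) (t : ℝ) : Lp ℝ 2 gaussianSeq :=
  if m = 0 then fbm β t
  else ((m - 1).factorial : ℝ)⁻¹ • ∫ s in (0 : ℝ)..t, (t - s) ^ (m - 1) • fbm β s

/-- `b^{m,β}_{k,p}`: the norm over `[0,1]` of the remainder of the two-point Hermite interpolation
of degree `k` of the `m`-fold integrated fractional Brownian motion at `0` and `1`. -/
def hermiteConst (m k : ℕ) (β : ℝ) (p : ℝ≥0∞) : ℝ≥0∞ :=
  pNorm p (Icc 0 1) fun t =>
    integratedFBM m β t - hermitePiece ((k - 1) / 2) (integratedFBM m β) 0 1 t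

end FBM

end HermiteSpline

end

open HermiteSpline

/-! On a cell `[a,b]` the Hermite error depends linearly on the increments of the `m`-th derivative.
Put `W(v) = X^{(m)}(a+(b-a)v) - X^{(m)}(a)` and let `u` be the relative position of `t`. With `k =
2r+1`, `r ≤ m ≤ 2r+1`, the Taylor polynomial of degree `m` at `a` is reproduced by interpolation and
cancels. What is left is `(b-a)^m R_u(W)`, where `R_u` is `remainderFunctional`, built from iterated
primitives of `W` (`sub_hermitePiece`).

The square `‖R_u(W)‖²` is obtained by applying `R_u` twice to the Gram kernel `⟨W(s), W(t)⟩`, so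
only second moments matter. By polarization, local stationarity makes this kernel uniformly close to
`c(a)(b-a)^{2β}` times the covariance of fractional Brownian motion. Hence the error is close to
`√c(a) (b-a)^{m+β} ψ(u)`, where `ψ(u) = ‖R_u(B)‖` is the error function of `B_m`. The mean value
theorem gives `n(b-a) = 1/h(ξ)` with `ξ` in the cell. So away from `0` the scaled error is uniformly
close to `φ(left knot) ψ(u)`, with `φ = c^{1/2}h^{-(m+β)}` (`eventually_scaledError_approx`).

The factor `ψ` oscillates from cell to cell and has no pointwise limit. Its average over every cell
is the same, however, so the integral of the approximation factors exactly (`integral_cells`). For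
`p = ∞` every pair (position, coordinate) is approached by points of the cells, so the suprema
multiply.

Near `0` uniformity fails and condition (C) takes over. Beyond the first cell, `H` varies by a
factor of at most `2` within a cell. A regularly varying function of `H` then varies there by a
bounded factor (`RegularlyVarying.exists_comparable`), so (C) supplies an integrable majorant, or
smallness when `p = ∞`. In the first cell the global Hölder class bounds the error by a multiple of
`t_1^{l+α}`, and the growth condition on `r` is exactly what makes this negligible after scaling
(`tendsto_first_knot`).

The constant is positive: if `ψ` vanished on `[0,1]`, then `B` would be a polynomial there with
coefficients in `L²`, hence differentiable at `0`, against `‖B(u)‖ = u^β` with `β < 1`. -/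

noncomputable section

namespace HermiteSpline

/-! ## Iterated primitives and the remainder functional of Hermite interpolation -/

section Remainder

variable {E : Type*} [NormedAddCommGroup E] [NormedSpace ℝ E]
variable {F : Type*} [NormedAddCommGroup F] [NormedSpace ℝ F]

/-- The primitive of `W` that vanishes at `0`. -/
def primitive (W : ℝ → E) (x : ℝ) : E := ∫ s in (0 : ℝ)..x, W s

theorem primitive_zero (W : ℝ → E) : primitive W 0 = 0 := intervalIntegral.integral_same

theorem continuous_primitive {W : ℝ → E} (hW : Continuous W) : Continuous (primitive W) :=
  intervalIntegral.continuous_primitive (fun a b => hW.intervalIntegrable a b) 0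

theorem continuous_iterate_primitive {W : ℝ → E} (hW : Continuous W) (i : ℕ) :
    Continuous (primitive^[i] W) := by
  induction i with
  | zero => exact hW
  | succ i ih => rw [Function.iterate_succ_apply']; exact continuous_primitive ih

theorem hasDerivAt_primitive [CompleteSpace E] {W : ℝ → E} (hW : Continuous W) (x : ℝ) :
    HasDerivAt (primitive W) (W x) x :=
  intervalIntegral.integral_hasDerivAt_right (hW.intervalIntegrable _ _)
    hW.stronglyMeasurable.stronglyMeasurableAtFilter hW.continuousAt

theorem iterate_primitive_zero {W : ℝ → E} (hW : W 0 = 0) (i : ℕ) : primitive^[i] W 0 = 0 := by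
  cases i with
  | zero => exact hW
  | succ i => rw [Function.iterate_succ_apply']; exact primitive_zero _

theorem iterate_primitive_clm [CompleteSpace E] [CompleteSpace F] (L : E →L[ℝ] F) {W : ℝ → E}
    (hW : Continuous W) (i : ℕ) :
    primitive^[i] (fun x => L (W x)) = fun x => L (primitive^[i] W x) := by
  induction i with
  | zero => rfl
  | succ i ih =>
    ext x
    rw [Function.iterate_succ_apply', Function.iterate_succ_apply', ih]
    exact L.intervalIntegral_comp_comm ((continuous_iterate_primitive hW i).intervalIntegrable _ _)

theorem iterate_primitive_sub_smul {W Y : ℝ → E} (hW : Continuous W) (hY : Continuous Y) (σ : ℝ)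
    (i : ℕ) : primitive^[i] (fun x => W x - σ • Y x) =
      fun x => primitive^[i] W x - σ • primitive^[i] Y x := by
  induction i with
  | zero => rfl
  | succ i ih =>
    ext x
    simp only [Function.iterate_succ_apply', ih]
    have h1 := continuous_iterate_primitive hW i
    have h2 : Continuous fun x => σ • primitive^[i] Y x :=
      (continuous_iterate_primitive hY i).const_smul σ
    rw [primitive, intervalIntegral.integral_sub (h1.intervalIntegrable _ _)
      (h2.intervalIntegrable _ _), intervalIntegral.integral_smul]
    rfl

theorem norm_iterate_primitive_le {W : ℝ → E} {K : ℝ} (hK : ∀ x ∈ Icc (0 : ℝ) 1, ‖W x‖ ≤ K)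
    (i : ℕ) : ∀ x ∈ Icc (0 : ℝ) 1, ‖primitive^[i] W x‖ ≤ K := by
  have hK0 : 0 ≤ K := (norm_nonneg _).trans (hK 0 (by simp))
  induction i with
  | zero => exact hK
  | succ i ih =>
    intro x hx
    rw [Function.iterate_succ_apply']
    refine (intervalIntegral.norm_integral_le_of_norm_le_const (C := K) fun s hs => ?_).trans ?_
    · rw [uIoc_of_le hx.1] at hs
      exact ih s ⟨hs.1.le, hs.2.trans hx.2⟩
    · rw [sub_zero, abs_of_nonneg hx.1]
      exact mul_le_of_le_one_right hK0 hx.2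

/-- Cauchy's formula for repeated integration. -/
theorem integral_pow_smul_eq_iterate_primitive [CompleteSpace E] {W : ℝ → E} (hW : Continuous W)
    (n : ℕ) (t : ℝ) :
    ((n.factorial : ℝ))⁻¹ • ∫ s in (0 : ℝ)..t, (t - s) ^ n • W s = primitive^[n + 1] W t := by
  induction n generalizing W with
  | zero => simp [primitive]
  | succ n ih =>
    -- The innermost primitive is peeled off, so the induction hypothesis is needed for a different
    -- `W`. Integration by parts then moves it onto the kernel; both boundary terms vanish.
    rw [Function.iterate_succ_apply, ← ih (continuous_primitive hW)]
    have hu (x : ℝ) : HasDerivAt (fun s : ℝ => (t - s) ^ (n + 1))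
        (-((n + 1 : ℝ) * (t - x) ^ n)) x := by
      simpa using ((hasDerivAt_id' x).const_sub t).fun_pow (n + 1)
    rw [intervalIntegral.integral_smul_deriv_eq_deriv_smul (fun x _ => hu x)
      (fun x _ => hasDerivAt_primitive hW x)
      (by apply Continuous.intervalIntegrable; fun_prop) (hW.intervalIntegrable _ _)]
    simp only [primitive_zero, sub_self, smul_zero, neg_smul, mul_smul]
    rw [intervalIntegral.integral_neg, intervalIntegral.integral_smul, zero_pow (by omega),
      zero_smul, sub_zero, zero_sub, neg_neg, smul_smul]
    congr 1
    rw [Nat.factorial_succ]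
    push_cast
    field_simp

/-- `F 0, …, F m` are successive derivatives on `[a,b]` of a function with continuous `m`-th
derivative `F m`. -/
structure DerivChain (m : ℕ) (a b : ℝ) (F : ℕ → ℝ → E) : Prop where
  hasDerivWithinAt : ∀ j < m, ∀ t ∈ Icc a b, HasDerivWithinAt (F j) (F (j + 1) t) (Icc a b) t
  continuousOn : ContinuousOn (F m) (Icc a b)

/-- The polynomial `x^k / k!`. -/
def taylorMonomial (k : ℕ) : ℝ[X] := monomial k ((k.factorial : ℝ)⁻¹)

theorem iterate_derivative_taylorMonomial (j k : ℕ) :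
    derivative^[j] (taylorMonomial k) = if j ≤ k then taylorMonomial (k - j) else 0 := by
  have hz (j : ℕ) : derivative^[j] (0 : ℝ[X]) = 0 := iterate_derivative_zero
  induction j generalizing k with
  | zero => simp
  | succ j ih =>
    rw [Function.iterate_succ_apply]
    cases k with
    | zero => simp [taylorMonomial]
    | succ k =>
      have : derivative (taylorMonomial (k + 1)) = taylorMonomial k := by
        rw [taylorMonomial, derivative_monomial_succ, taylorMonomial, Nat.factorial_succ]
        congr 1
        push_cast
        field_simp
      rw [this, ih]
      simp

theorem eval_zero_taylorMonomial (k : ℕ) :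
    (taylorMonomial k).eval 0 = if k = 0 then 1 else 0 := by
  cases k <;> simp [taylorMonomial]

theorem eval_zero_iterate_derivative_taylorMonomial (j k : ℕ) :
    (derivative^[j] (taylorMonomial k)).eval 0 = if k = j then 1 else 0 := by
  rw [iterate_derivative_taylorMonomial]
  split_ifs with h1 h2 h2
  · rw [eval_zero_taylorMonomial, if_pos (by omega)]
  · rw [eval_zero_taylorMonomial, if_neg (by omega)]
  · omega
  · simp

/-- Taylor's formula at `0` for every derivative at once, with the remainder kept as an iterated
primitive instead of being estimated. The induction descends from the top derivative: the two sides
agree at `0`, and their derivatives agree by the previous case. -/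
theorem DerivChain.taylor [CompleteSpace E] {m : ℕ} {G : ℕ → ℝ → E} (hG : DerivChain m 0 1 G)
    {W : ℝ → E} (hW : Continuous W) (hGW : ∀ x ∈ Icc (0 : ℝ) 1, W x = G m x - G m 0)
    (i : ℕ) (hi : i ≤ m) : ∀ x ∈ Icc (0 : ℝ) 1,
      G (m - i) x = ∑ k ∈ Finset.range (m + 1),
        (derivative^[m - i] (taylorMonomial k)).eval x • G k 0 + primitive^[i] W x := by
  induction i with
  | zero =>
    intro x hx
    rw [Finset.sum_eq_single_of_mem m (by simp)]
    · have : (taylorMonomial 0).eval x = 1 := by simp [taylorMonomial]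
      simp [iterate_derivative_taylorMonomial, this, hGW x hx]
    · intro k hk hkm
      rw [iterate_derivative_taylorMonomial, if_neg (by simp at hk; omega)]
      simp
  | succ i ih =>
    set j := m - (i + 1) with hj
    have hj1 : m - i = j + 1 := by omega
    have ih := ih (by omega)
    rw [hj1] at ih
    set S : ℝ → E := fun x => ∑ k ∈ Finset.range (m + 1),
        (derivative^[j] (taylorMonomial k)).eval x • G k 0 + primitive^[i + 1] W x with hS
    have hd : ∀ x ∈ Icc (0 : ℝ) 1, HasDerivWithinAt (fun x => G j x - S x) 0 (Icc 0 1) x := by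
      intro x hx
      have h1 := hG.hasDerivWithinAt j (by omega) x hx
      have h2 : HasDerivAt (fun x => ∑ k ∈ Finset.range (m + 1),
          (derivative^[j] (taylorMonomial k)).eval x • G k 0)
          (∑ k ∈ Finset.range (m + 1),
          (derivative^[j + 1] (taylorMonomial k)).eval x • G k 0) x := by
        refine HasDerivAt.fun_sum fun k _ => ?_
        rw [Function.iterate_succ_apply']
        exact ((derivative^[j] (taylorMonomial k)).hasDerivAt x).smul_const _
      have h3 : HasDerivAt (primitive^[i + 1] W) (primitive^[i] W x) x := by
        rw [Function.iterate_succ_apply']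
        exact hasDerivAt_primitive (continuous_iterate_primitive hW i) x
      have h4 := h1.sub (h2.add h3).hasDerivWithinAt
      rw [ih x hx, sub_self] at h4
      exact h4
    intro x hx
    -- At `0` only the monomial with `k = j` survives, and the iterated primitive vanishes.
    have h0 : S 0 = G j 0 := by
      have : W 0 = 0 := by rw [hGW 0 (by simp), sub_self]
      simp only [hS, eval_zero_iterate_derivative_taylorMonomial, iterate_primitive_zero this,
        add_zero, ite_smul, one_smul, zero_smul]
      rw [Finset.sum_ite_eq' (Finset.range (m + 1)) j, if_pos (by simp; omega)]
    have := constant_of_derivWithin_zero (fun x hx => (hd x hx).differentiableWithinAt)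
      (fun x hx => (hd x (Ico_subset_Icc_self hx)).derivWithin
        (uniqueDiffOn_Icc one_pos x (Ico_subset_Icc_self hx))) x hx
    simp only [h0, sub_self] at this
    exact sub_eq_zero.1 this

/-- The fundamental Hermite polynomials reproduce polynomials of degree at most `2r+1`. -/
theorem eval_eq_sum_hermitePoly (r : ℕ) (p : ℝ[X]) (hp : p.degree < (2 * r + 2 : ℕ)) (x : ℝ) :
    p.eval x = ∑ j ∈ Finset.range (r + 1),
      ((hermitePoly r (Pi.single j 1) 0).eval x * (derivative^[j] p).eval 0 +
        (hermitePoly r 0 (Pi.single j 1)).eval x * (derivative^[j] p).eval 1) := by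
  set S : ℝ[X] := ∑ j ∈ Finset.range (r + 1),
      (((derivative^[j] p).eval 0) • hermitePoly r (Pi.single j 1) 0 +
        ((derivative^[j] p).eval 1) • hermitePoly r 0 (Pi.single j 1)) with hS
  have hdS : S.degree < (2 * r + 2 : ℕ) := by
    rw [← mem_degreeLT]
    refine Submodule.sum_mem _ fun j _ => Submodule.add_mem _ ?_ ?_
    · exact Submodule.smul_mem _ _ (mem_degreeLT.2 (hermitePoly_spec _ _ _).1)
    · exact Submodule.smul_mem _ _ (mem_degreeLT.2 (hermitePoly_spec _ _ _).1)
  have hder (i : ℕ) (y : ℝ) : (derivative^[i] S).eval y = ∑ j ∈ Finset.range (r + 1),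
      (((derivative^[j] p).eval 0) * (derivative^[i] (hermitePoly r (Pi.single j 1) 0)).eval y +
        ((derivative^[j] p).eval 1) *
          (derivative^[i] (hermitePoly r 0 (Pi.single j 1))).eval y) := by
    rw [hS, iterate_derivative_sum, eval_finsetSum]
    refine Finset.sum_congr rfl fun j _ => ?_
    rw [iterate_map_add, iterate_derivative_smul, iterate_derivative_smul, eval_add, eval_smul,
      eval_smul, smul_eq_mul, smul_eq_mul]
  -- The difference has degree at most `2r+1` and zeros of order `r+1` at both ends.
  have h0 : p - S = 0 := by
    refine eq_zero_of_hermite r _ ((degree_sub_le _ _).trans_lt (max_lt hp hdS)) ?_ ?_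
    all_goals
      intro i hi
      rw [iterate_derivative_sub, eval_sub, hder,
        Finset.sum_eq_single_of_mem i (Finset.mem_range.2 (by omega))]
      · simp [((hermitePoly_spec r _ _).2 i hi).1, ((hermitePoly_spec r _ _).2 i hi).2]
      · intro j _ hj
        simp [((hermitePoly_spec r _ _).2 i hi).1, ((hermitePoly_spec r _ _).2 i hi).2,
          Pi.single_eq_of_ne hj.symm]
  rw [sub_eq_zero] at h0
  have := hder 0 x
  simp only [Function.iterate_zero, id] at this
  conv_lhs => rw [h0, this]
  refine Finset.sum_congr rfl fun j _ => ?_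
  ring

/-- The remainder at `u` of the Hermite interpolation on `[0,1]`, as a functional of the `m`-th
derivative `W`. -/
def remainderFunctional (m r : ℕ) (u : ℝ) (W : ℝ → E) : E :=
  primitive^[m] W u - ∑ j ∈ Finset.range (r + 1),
    (hermitePoly r 0 (Pi.single j 1)).eval u • primitive^[m - j] W 1

/-- Since `m ≤ 2r+1`, interpolation reproduces the Taylor polynomial of degree `m` at `0`, which
drops out. The rest, the `m`-fold primitive of `W`, has zero data at `0`, so only its derivatives at
`1` enter. The condition `r ≤ m` ensures that these are primitives of order `m - j ≥ 0`. -/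
theorem DerivChain.sub_hermite [CompleteSpace E] {m r : ℕ} (hrm : r ≤ m) (hmr : m ≤ 2 * r + 1)
    {G : ℕ → ℝ → E} (hG : DerivChain m 0 1 G)
    {W : ℝ → E} (hW : Continuous W) (hGW : ∀ x ∈ Icc (0 : ℝ) 1, W x = G m x - G m 0)
    {u : ℝ} (hu : u ∈ Icc (0 : ℝ) 1) :
    G 0 u - ∑ j ∈ Finset.range (r + 1), ((hermitePoly r (Pi.single j 1) 0).eval u • G j 0 +
      (hermitePoly r 0 (Pi.single j 1)).eval u • G j 1) = remainderFunctional m r u W := by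
  have hT (j : ℕ) (hj : j ≤ m) : ∀ x ∈ Icc (0 : ℝ) 1,
      G j x = ∑ k ∈ Finset.range (m + 1),
        (derivative^[j] (taylorMonomial k)).eval x • G k 0 + primitive^[m - j] W x := by
    have := hG.taylor hW hGW (m - j) (by omega)
    rwa [Nat.sub_sub_self hj] at this
  have hW0 : W 0 = 0 := by rw [hGW 0 (by simp), sub_self]
  have h0 := hT 0 (by omega) u hu
  simp only [Function.iterate_zero, id, Nat.sub_zero] at h0
  have h1 : ∑ j ∈ Finset.range (r + 1), ((hermitePoly r (Pi.single j 1) 0).eval u • G j 0 +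
      (hermitePoly r 0 (Pi.single j 1)).eval u • G j 1) =
      ∑ k ∈ Finset.range (m + 1), (taylorMonomial k).eval u • G k 0 +
      ∑ j ∈ Finset.range (r + 1),
        (hermitePoly r 0 (Pi.single j 1)).eval u • primitive^[m - j] W 1 := by
    have : ∀ k ∈ Finset.range (m + 1), (taylorMonomial k).eval u • G k 0 =
        ∑ j ∈ Finset.range (r + 1),
          (((hermitePoly r (Pi.single j 1) 0).eval u *
              (derivative^[j] (taylorMonomial k)).eval 0) • G k 0 +
           ((hermitePoly r 0 (Pi.single j 1)).eval u *
              (derivative^[j] (taylorMonomial k)).eval 1) • G k 0) := by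
      intro k hk
      rw [eval_eq_sum_hermitePoly r (taylorMonomial k) ?_ u, Finset.sum_smul]
      · simp only [add_smul]
      · refine (degree_monomial_le _ _).trans_lt ?_
        have := Finset.mem_range.1 hk
        exact_mod_cast (by omega : k < 2 * r + 2)
    rw [Finset.sum_congr rfl this, Finset.sum_comm, ← Finset.sum_add_distrib]
    refine Finset.sum_congr rfl fun j hj => ?_
    have hjm : j ≤ m := by have := Finset.mem_range.1 hj; omega
    rw [hT j hjm 0 (by simp), hT j hjm 1 (by simp), iterate_primitive_zero hW0, add_zero, smul_add,
      Finset.smul_sum, Finset.smul_sum, Finset.sum_add_distrib, add_assoc]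
    simp only [mul_smul]
  rw [h1, h0, remainderFunctional]
  abel

theorem deriv01_eq_of_derivChain {m : ℕ} {G : ℕ → ℝ → E} (hG : DerivChain m 0 1 G) {X : ℝ → E}
    (hX : ∀ x ∈ Icc (0 : ℝ) 1, X x = G 0 x) (j : ℕ) (hj : j ≤ m) :
    ∀ x ∈ Icc (0 : ℝ) 1, deriv01 j X x = G j x := by
  induction j with
  | zero => intro x hx; simpa [deriv01] using hX x hx
  | succ j ih =>
    intro x hx
    rw [deriv01, iteratedDerivWithin_succ]
    refine (derivWithin_congr (f := G j) (ih (by omega)) (ih (by omega) x hx)).trans ?_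
    exact (hG.hasDerivWithinAt j (by omega) x hx).derivWithin (uniqueDiffOn_Icc one_pos x hx)

/-- The remainder of two-point Hermite interpolation on `[a,b]`. -/
theorem sub_hermitePiece [CompleteSpace E] {m r : ℕ} (hrm : r ≤ m) (hmr : m ≤ 2 * r + 1)
    {a b : ℝ} (hab : a < b) {X : ℝ → E} (hF : DerivChain m a b (fun j => deriv01 j X))
    (hX : ∀ t ∈ Icc a b, deriv01 0 X t = X t)
    {W : ℝ → E} (hW : Continuous W) (hFW : ∀ v ∈ Icc (0 : ℝ) 1,
      W v = deriv01 m X (a + (b - a) * v) - deriv01 m X a)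
    {t : ℝ} (ht : t ∈ Icc a b) :
    X t - hermitePiece r X a b t =
      (b - a) ^ m • remainderFunctional m r ((t - a) / (b - a)) W := by
  have hpos : 0 < b - a := sub_pos.2 hab
  have hmaps : MapsTo (fun v : ℝ => a + (b - a) * v) (Icc 0 1) (Icc a b) := by
    intro v hv
    constructor
    · nlinarith [hv.1]
    · nlinarith [hv.2]
  -- The derivatives of the function transported to `[0,1]`; the chain rule produces the powers of
  -- `b - a`.
  set G : ℕ → ℝ → E := fun j v => (b - a) ^ j • deriv01 j X (a + (b - a) * v) with hGdef
  have hG : DerivChain m 0 1 G := by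
    constructor
    · intro j hj v hv
      have h1 : HasDerivWithinAt (fun v : ℝ => a + (b - a) * v) (b - a) (Icc 0 1) v := by
        simpa using ((hasDerivAt_id v).const_mul (b - a)).const_add a |>.hasDerivWithinAt
      have h2 := (hF.hasDerivWithinAt j hj _ (hmaps hv)).scomp v h1 hmaps
      have h3 := h2.const_smul ((b - a) ^ j)
      rw [smul_smul, ← pow_succ] at h3
      exact h3
    · exact (hF.continuousOn.comp (by fun_prop) hmaps).const_smul _
  have hu : (t - a) / (b - a) ∈ Icc (0 : ℝ) 1 :=
    ⟨div_nonneg (by linarith [ht.1]) hpos.le, (div_le_one hpos).2 (by linarith [ht.2])⟩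
  have key := hG.sub_hermite (r := r) (W := fun v => (b - a) ^ m • W v) hrm hmr (hW.const_smul _)
    (fun x hx => by simp [hGdef, hFW x hx, smul_sub]) hu
  have h4 : remainderFunctional m r ((t - a) / (b - a)) (fun v => (b - a) ^ m • W v) =
      (b - a) ^ m • remainderFunctional m r ((t - a) / (b - a)) W := by
    have (i : ℕ) := iterate_primitive_clm ((b - a) ^ m • ContinuousLinearMap.id ℝ E) hW i
    simp only [FunLike.coe_smul, ContinuousLinearMap.coe_id', Pi.smul_apply, id] at this
    simp only [remainderFunctional, this, smul_sub, Finset.smul_sum]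
    congr 1
    exact Finset.sum_congr rfl fun j _ => smul_comm _ _ _
  rw [← h4, ← key]
  have h5 : a + (b - a) * ((t - a) / (b - a)) = t := by field_simp; ring
  simp only [hGdef, h5, pow_zero, one_smul, mul_zero, add_zero, mul_one, hX t ht]
  rw [hermitePiece]
  congr 1
  refine Finset.sum_congr rfl fun j _ => ?_
  rw [smul_add, smul_comm, smul_comm ((b - a) ^ j), add_sub_cancel]

theorem continuous_remainderFunctional (m r : ℕ) {W : ℝ → E} (hW : Continuous W) :
    Continuous fun u => remainderFunctional m r u W := by
  unfold remainderFunctional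
  refine (continuous_iterate_primitive hW m).sub (continuous_finsetSum _ fun j _ => ?_)
  exact (hermitePoly r 0 (Pi.single j 1)).continuous.smul continuous_const

theorem remainderFunctional_clm [CompleteSpace E] [CompleteSpace F] (m r : ℕ) (u : ℝ)
    (L : E →L[ℝ] F) {W : ℝ → E} (hW : Continuous W) :
    remainderFunctional m r u (fun x => L (W x)) = L (remainderFunctional m r u W) := by
  simp only [remainderFunctional, iterate_primitive_clm L hW, map_sub, map_sum, map_smul]

theorem remainderFunctional_sub_smul (m r : ℕ) (u : ℝ) {W Y : ℝ → E} (hW : Continuous W)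
    (hY : Continuous Y) (σ : ℝ) : remainderFunctional m r u (fun x => W x - σ • Y x) =
      remainderFunctional m r u W - σ • remainderFunctional m r u Y := by
  simp only [remainderFunctional, iterate_primitive_sub_smul hW hY, smul_sub,
    Finset.sum_sub_distrib, Finset.smul_sum, smul_comm σ]
  abel

/-- Primitives do not increase a bound on `[0,1]`, and the fundamental polynomials are bounded
there. The constant does not depend on the space: it serves both for curves and for their real Gram
kernels. -/
theorem exists_remainderFunctional_bound (m r : ℕ) : ∃ K > 0, ∀ u ∈ Icc (0 : ℝ) 1,
    ∀ {E : Type*} [NormedAddCommGroup E] [NormedSpace ℝ E] (W : ℝ → E) (ε : ℝ),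
      (∀ x ∈ Icc (0 : ℝ) 1, ‖W x‖ ≤ ε) → ‖remainderFunctional m r u W‖ ≤ K * ε := by
  have (j : ℕ) : ∃ K, ∀ u ∈ Icc (0 : ℝ) 1,
      ‖(hermitePoly r 0 (Pi.single j 1)).eval u‖ ≤ K :=
    isCompact_Icc.exists_bound_of_continuousOn (hermitePoly r 0 (Pi.single j 1)).continuousOn
  choose B hB using this
  have hB0 (j : ℕ) : 0 ≤ B j := (norm_nonneg _).trans (hB j 0 (by simp))
  refine ⟨1 + ∑ j ∈ Finset.range (r + 1), B j,
    by have := Finset.sum_nonneg fun j (_ : j ∈ Finset.range (r + 1)) => hB0 j; linarith, ?_⟩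
  intro u hu E _ _ W ε hε
  rw [remainderFunctional, add_mul, one_mul, Finset.sum_mul]
  refine (norm_sub_le _ _).trans (add_le_add (norm_iterate_primitive_le hε m u hu) ?_)
  refine (norm_sum_le _ _).trans (Finset.sum_le_sum fun j _ => ?_)
  rw [norm_smul]
  exact mul_le_mul (hB j u hu) (norm_iterate_primitive_le hε _ 1 (by simp)) (norm_nonneg _) (hB0 j)

end Remainder

/-! ### Second moments of the remainder from the Gram kernel -/

section Gram

variable {E : Type*} [NormedAddCommGroup E] [InnerProductSpace ℝ E] [CompleteSpace E]
variable {F : Type*} [NormedAddCommGroup F] [InnerProductSpace ℝ F] [CompleteSpace F]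

/-- Curves with nearly proportional Gram kernels have nearly proportional remainders. -/
theorem abs_norm_sq_remainderFunctional_sub_le {m r : ℕ} {K u ε σ : ℝ}
    (hK : ∀ (W : ℝ → ℝ) (ε : ℝ), (∀ x ∈ Icc (0 : ℝ) 1, ‖W x‖ ≤ ε) →
      ‖remainderFunctional m r u W‖ ≤ K * ε)
    {W : ℝ → E} {B : ℝ → F} (hW : Continuous W) (hB : Continuous B)
    (h : ∀ s ∈ Icc (0 : ℝ) 1, ∀ t ∈ Icc (0 : ℝ) 1,
      |inner ℝ (W s) (W t) - σ * inner ℝ (B s) (B t)| ≤ ε) :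
    |‖remainderFunctional m r u W‖ ^ 2 - σ * ‖remainderFunctional m r u B‖ ^ 2| ≤ K * (K * ε) := by
  set w := remainderFunctional m r u W
  set b := remainderFunctional m r u B
  -- The functional commutes with the inner product by a fixed vector. Doing this in both variables
  -- writes each squared norm as the functional applied twice to a Gram kernel.
  have e1 (s : ℝ) : inner ℝ (W s) w = remainderFunctional m r u fun t => inner ℝ (W s) (W t) :=
    (remainderFunctional_clm m r u (innerSL ℝ (W s)) hW).symm
  have e2 (s : ℝ) : inner ℝ (B s) b = remainderFunctional m r u fun t => inner ℝ (B s) (B t) :=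
    (remainderFunctional_clm m r u (innerSL ℝ (B s)) hB).symm
  have e3 : ‖w‖ ^ 2 = remainderFunctional m r u fun t => inner ℝ (W t) w := by
    rw [← real_inner_self_eq_norm_sq]
    simp_rw [real_inner_comm w]
    exact (remainderFunctional_clm m r u (innerSL ℝ w) hW).symm
  have e4 : ‖b‖ ^ 2 = remainderFunctional m r u fun t => inner ℝ (B t) b := by
    rw [← real_inner_self_eq_norm_sq]
    simp_rw [real_inner_comm b]
    exact (remainderFunctional_clm m r u (innerSL ℝ b) hB).symm
  -- By linearity the two Gram kernels can be subtracted inside. The bound by `K` is then used once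
  -- for each variable.
  rw [e3, e4, ← smul_eq_mul σ, ← remainderFunctional_sub_smul m r u (hW.inner continuous_const)
    (hB.inner continuous_const)]
  refine hK _ _ fun s hs => ?_
  rw [e1, e2, ← remainderFunctional_sub_smul m r u (continuous_const.inner hW)
    (continuous_const.inner hB)]
  exact hK _ _ fun t ht => h s hs t ht

end Gram

/-! ## The remainder for integrated fractional Brownian motion -/

section FBMRemainder

variable {β : ℝ}

theorem inner_fbm (h0 : 0 < β) (h1 : β < 1) (t s : ℝ) :
    inner ℝ (fbm β t) (fbm β s) = (|t| ^ (2 * β) + |s| ^ (2 * β) - |t - s| ^ (2 * β)) / 2 := by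
  have h := isFractionalBrownianMotion_fbm h0 h1
  rw [← h.cov_eq, covariance_eq_sub (Lp.memLp _) (Lp.memLp _), h.mean_zero, h.mean_zero,
    L2.inner_def]
  simp [mul_comm]

theorem norm_fbm_sub (h0 : 0 < β) (h1 : β < 1) (t s : ℝ) : ‖fbm β t - fbm β s‖ = |t - s| ^ β := by
  have hz : (0 : ℝ) ^ (2 * β) = 0 := Real.zero_rpow (by positivity)
  have h2 : ‖fbm β t - fbm β s‖ ^ 2 = (|t - s| ^ β) ^ 2 := by
    rw [norm_sub_sq_real, ← real_inner_self_eq_norm_sq, ← real_inner_self_eq_norm_sq]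
    simp only [inner_fbm h0 h1, sub_self, abs_zero, hz]
    rw [← Real.rpow_natCast, ← Real.rpow_mul (abs_nonneg _)]
    push_cast
    rw [mul_comm β 2]
    ring
  exact (pow_left_inj₀ (norm_nonneg _) (Real.rpow_nonneg (abs_nonneg _) _) two_ne_zero).1 h2

theorem fbm_zero (h0 : 0 < β) (h1 : β < 1) : fbm β 0 = 0 := by
  have hz : (0 : ℝ) ^ (2 * β) = 0 := Real.zero_rpow (by positivity)
  rw [← inner_self_eq_zero (𝕜 := ℝ), inner_fbm h0 h1]
  simp [hz]

theorem continuous_fbm (h0 : 0 < β) (h1 : β < 1) : Continuous (fbm β) := by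
  rw [continuous_iff_continuousAt]
  intro s
  rw [ContinuousAt, tendsto_iff_norm_sub_tendsto_zero]
  simp_rw [norm_fbm_sub h0 h1]
  have : Continuous fun t => |t - s| ^ β := by
    refine Continuous.rpow_const (by fun_prop) fun x => Or.inr h0.le
  simpa [Real.zero_rpow h0.ne'] using this.tendsto s

theorem integratedFBM_eq_primitive (h0 : 0 < β) (h1 : β < 1) (m : ℕ) (t : ℝ) :
    integratedFBM m β t = primitive^[m] (fbm β) t := by
  cases m with
  | zero => simp [integratedFBM]
  | succ m =>
    rw [integratedFBM, if_neg (by omega), Nat.add_sub_cancel,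
      integral_pow_smul_eq_iterate_primitive (continuous_fbm h0 h1)]

theorem derivChain_primitive {E : Type*} [NormedAddCommGroup E] [NormedSpace ℝ E] [CompleteSpace E]
    {W : ℝ → E} (hW : Continuous W) (m : ℕ) (a b : ℝ) :
    DerivChain m a b fun j => primitive^[m - j] W where
  hasDerivWithinAt j hj t _ := by
    obtain ⟨i, hi⟩ : ∃ i, m - j = i + 1 := ⟨m - j - 1, by omega⟩
    have : m - (j + 1) = i := by omega
    simp only [hi, this, Function.iterate_succ_apply']
    exact (hasDerivAt_primitive (continuous_iterate_primitive hW i) t).hasDerivWithinAt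
  continuousOn := (continuous_iterate_primitive hW _).continuousOn

theorem DerivChain.congr {E : Type*} [NormedAddCommGroup E] [NormedSpace ℝ E] {m : ℕ} {a b : ℝ}
    {F G : ℕ → ℝ → E} (hG : DerivChain m a b G)
    (h : ∀ j ≤ m, ∀ t ∈ Icc a b, F j t = G j t) : DerivChain m a b F where
  hasDerivWithinAt j hj t ht := by
    rw [h (j + 1) hj t ht]
    exact (hG.hasDerivWithinAt j hj t ht).congr (h j hj.le) (h j hj.le t ht)
  continuousOn := hG.continuousOn.congr (h m le_rfl)

theorem integratedFBM_sub_hermitePiece (h0 : 0 < β) (h1 : β < 1) {m r : ℕ} (hrm : r ≤ m)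
    (hmr : m ≤ 2 * r + 1) {t : ℝ} (ht : t ∈ Icc (0 : ℝ) 1) :
    integratedFBM m β t - hermitePiece r (integratedFBM m β) 0 1 t =
      remainderFunctional m r t (fbm β) := by
  have hB := continuous_fbm h0 h1
  have hG := derivChain_primitive hB m 0 1
  have hd := deriv01_eq_of_derivChain hG (X := integratedFBM m β)
    (fun x _ => integratedFBM_eq_primitive h0 h1 m x)
  have := sub_hermitePiece hrm hmr one_pos (hG.congr hd)
    (fun t ht => by rw [hd 0 (by omega) t ht]; exact (integratedFBM_eq_primitive h0 h1 m t).symm) hB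
    (fun v hv => by
      have h2 : (0 : ℝ) + (1 - 0) * v = v := by ring
      rw [h2, hd m le_rfl v hv, hd m le_rfl 0 (by simp)]
      simp [fbm_zero h0 h1]) ht
  simpa using this

/-- Otherwise the `m`-fold primitive of `B` would be, on `[0,1]`, a combination of real polynomials
with fixed coefficients in `L²`. Differentiating `m` times, the same would hold for `B`, which is
not differentiable at `0`. -/
theorem exists_remainderFunctional_fbm_ne_zero (h0 : 0 < β) (h1 : β < 1) (m r : ℕ) :
    ∃ u ∈ Icc (0 : ℝ) 1, remainderFunctional m r u (fbm β) ≠ 0 := by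
  by_contra! hcon
  have hB := continuous_fbm h0 h1
  -- Differentiation changes the polynomials but not the vectors `v j`, which makes the induction
  -- run for arbitrary `P`.
  have hpoly (i : ℕ) : ∀ (P : ℕ → ℝ[X]) (v : ℕ → Lp ℝ 2 gaussianSeq),
      (∀ u ∈ Icc (0 : ℝ) 1, primitive^[i] (fbm β) u =
        ∑ j ∈ Finset.range (r + 1), (P j).eval u • v j) →
      ∃ Q : ℕ → ℝ[X], ∀ u ∈ Icc (0 : ℝ) 1, fbm β u =
        ∑ j ∈ Finset.range (r + 1), (Q j).eval u • v j := by
    induction i with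
    | zero => exact fun P v h => ⟨P, h⟩
    | succ i ih =>
      intro P v h
      refine ih (fun j => derivative (P j)) v fun u hu => ?_
      have hd1 : HasDerivWithinAt (primitive^[i + 1] (fbm β)) (primitive^[i] (fbm β) u)
          (Icc 0 1) u := by
        rw [Function.iterate_succ_apply']
        exact (hasDerivAt_primitive (continuous_iterate_primitive hB i) u).hasDerivWithinAt
      have hd2 : HasDerivWithinAt (primitive^[i + 1] (fbm β))
          (∑ j ∈ Finset.range (r + 1), (derivative (P j)).eval u • v j) (Icc 0 1) u := by
        have : HasDerivAt (fun u => ∑ j ∈ Finset.range (r + 1), (P j).eval u • v j)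
            (∑ j ∈ Finset.range (r + 1), (derivative (P j)).eval u • v j) u :=
          HasDerivAt.fun_sum fun j _ => ((P j).hasDerivAt u).smul_const _
        exact this.hasDerivWithinAt.congr h (h u hu)
      exact (uniqueDiffOn_Icc one_pos u hu).eq_deriv _ hd1 hd2
  obtain ⟨Q, hQ⟩ := hpoly m (fun j => hermitePoly r 0 (Pi.single j 1))
    (fun j => primitive^[m - j] (fbm β) 1) fun u hu => sub_eq_zero.1 (hcon u hu)
  have hd : HasDerivAt (fun u => ∑ j ∈ Finset.range (r + 1),
      (Q j).eval u • primitive^[m - j] (fbm β) 1) _ 0 :=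
    HasDerivAt.fun_sum fun j _ => ((Q j).hasDerivAt 0).smul_const _
  obtain ⟨K, hK⟩ := (hd.isBigO_sub).bound
  -- Differentiability would give `u^β ≤ K u` near `0`, that is `1 ≤ K u^{1-β}`, which fails for
  -- small `u`.
  have hlim : Tendsto (fun u : ℝ => K * u ^ (1 - β)) (𝓝[>] 0) (𝓝 0) := by
    have : Continuous fun u : ℝ => K * u ^ (1 - β) :=
      continuous_const.mul (Real.continuous_rpow_const (by linarith))
    have h2 := (this.tendsto 0).mono_left (nhdsWithin_le_nhds (s := Ioi 0))
    simpa [Real.zero_rpow (by linarith : 1 - β ≠ 0)] using h2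
  have hlt := hlim.eventually (gt_mem_nhds one_pos)
  have hmem : ∀ᶠ u in 𝓝[>] (0 : ℝ), u ∈ Ioo (0 : ℝ) 1 := Ioo_mem_nhdsGT one_pos
  obtain ⟨u, hu1, hu2, hu3⟩ := (hlt.and (hmem.and (hK.filter_mono nhdsWithin_le_nhds))).exists
  rw [← hQ u ⟨hu2.1.le, hu2.2.le⟩, ← hQ 0 (by simp), norm_fbm_sub h0 h1, sub_zero,
    abs_of_pos hu2.1, Real.norm_of_nonneg hu2.1.le] at hu3
  have : u = u ^ (1 - β) * u ^ β := by
    rw [← Real.rpow_add hu2.1]; simp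
  have hpos : 0 < u ^ β := Real.rpow_pos_of_pos hu2.1 _
  have h5 : u ^ β ≤ K * u ^ (1 - β) * u ^ β := by rw [mul_assoc, ← this]; exact hu3
  nlinarith

end FBMRemainder

/-! ## Local comparability of regularly varying functions -/

section RegularVariation

theorem rpow_mem_Icc_of_mem_Icc_one_four (ρ : ℝ) {x : ℝ} (hx : x ∈ Icc (1 : ℝ) 4) :
    x ^ ρ ∈ Icc ((4 : ℝ) ^ (-|ρ|)) (4 ^ |ρ|) := by
  have h0 : 0 < x := by linarith [hx.1]
  have hl : x ^ |ρ| ≤ 4 ^ |ρ| := Real.rpow_le_rpow h0.le hx.2 (abs_nonneg _)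
  constructor
  · calc (4 : ℝ) ^ (-|ρ|) ≤ x ^ (-|ρ|) := by
          rw [Real.rpow_neg h0.le, Real.rpow_neg (by norm_num)]
          exact inv_anti₀ (Real.rpow_pos_of_pos h0 _) hl
      _ ≤ x ^ ρ := Real.rpow_le_rpow_of_exponent_le hx.1 (neg_abs_le ρ)
  · exact (Real.rpow_le_rpow_of_exponent_le hx.1 (le_abs_self ρ)).trans hl

/-- Regular variation along a sequence is regular variation in measure. -/
theorem RegularlyVarying.tendsto_volume {ρ : ℝ} {f : ℝ → ℝ} (hf : RegularlyVarying ρ f) {ε : ℝ}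
    (hε : 0 < ε) {x : ℕ → ℝ} (hx0 : ∀ n, 0 < x n) (hx : Tendsto x atTop (𝓝 0)) :
    Tendsto (fun n => volume {y | y ∈ Icc (1 : ℝ) 4 ∧ ε ≤ |f (y * x n) / f (x n) - y ^ ρ|})
      atTop (𝓝 0) := by
  obtain ⟨a, ha, -, hmeas⟩ := hf.pos_measurable
  obtain ⟨N, hN⟩ := eventually_atTop.1 (hx.eventually (gt_mem_nhds (by positivity : 0 < a / 4)))
  -- Measurability of `f` is known only on `(0,a]`. For indices from `N` on, the points `y * x n`
  -- with `y ≤ 4` lie there, so the cutoff changes nothing. Pointwise convergence on the finite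
  -- measure space `[1,4]` then gives convergence in measure.
  set g : ℝ → ℝ := (Ioc (0 : ℝ) a).indicator f with hg
  have hgm : Measurable g := by
    refine measurable_of_restrict_of_restrict_compl (s := Ioc 0 a) measurableSet_Ioc ?_ ?_
    · rwa [show (Ioc 0 a).domRestrict g = (Ioc 0 a).domRestrict f from
        funext fun y => indicator_of_mem y.2 f]
    · rw [show (Ioc 0 a)ᶜ.domRestrict g = fun _ => 0 from
        funext fun y => indicator_of_notMem y.2 f]
      exact measurable_const
  have hgf (n : ℕ) (y : ℝ) (hy : y ∈ Icc (1 : ℝ) 4) : g (y * x (n + N)) = f (y * x (n + N)) := by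
    refine indicator_of_mem (s := Ioc 0 a) ⟨mul_pos (by linarith [hy.1]) (hx0 _), ?_⟩ f
    have := hN (n + N) (by omega)
    nlinarith [hy.2, hx0 (n + N), hy.1]
  have key := tendstoInMeasure_of_tendsto_ae (μ := volume.restrict (Icc (1 : ℝ) 4))
    (f := fun n y => g (y * x (n + N)) / f (x (n + N))) (g := fun y => y ^ ρ)
    (fun n => by
      have : Measurable fun y => g (y * x (n + N)) / f (x (n + N)) := by fun_prop
      exact this.aestronglyMeasurable)
    (by
      filter_upwards [ae_restrict_mem measurableSet_Icc] with y hy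
      have h1 := hf.limit y (by linarith [hy.1])
      have h2 : Tendsto (fun n => x (n + N)) atTop (𝓝[>] 0) :=
        tendsto_nhdsWithin_iff.2 ⟨hx.comp (tendsto_add_atTop_nat N), by simp [hx0]⟩
      simp only [hgf _ y hy]
      exact h1.comp h2)
  have h3 := key (ENNReal.ofReal ε) (by simpa using hε)
  rw [← tendsto_add_atTop_iff_nat N]
  refine h3.congr fun n => ?_
  rw [Measure.restrict_apply']
  · congr 1
    ext y
    simp only [mem_inter_iff, mem_ofPred_eq, edist_dist, Real.dist_eq]
    rw [and_comm, ENNReal.ofReal_le_ofReal_iff (abs_nonneg _)]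
    refine and_congr_right fun hy => ?_
    rw [hgf n y hy]
  · exact measurableSet_Icc

/-- A weak form of the uniform convergence theorem, proved by measure. If it failed along `x_n ≤ y_n
≤ 2x_n` tending to `0`, most dilates of either sequence would still be good. Hence some point is a
good dilate of both `x_n` and `y_n`, and comparing `f` there with its values at `x_n` and at `y_n`
gives a contradiction. -/
theorem RegularlyVarying.exists_comparable {ρ : ℝ} {f : ℝ → ℝ} (hf : RegularlyVarying ρ f) :
    ∃ K > 0, ∃ a > 0, (∀ x ∈ Ioc (0 : ℝ) a, 0 < f x) ∧ ∀ x ∈ Ioc (0 : ℝ) a, ∀ y ∈ Ioc (0 : ℝ) a,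
      x ≤ 2 * y → y ≤ 2 * x → f x ≤ K * f y := by
  obtain ⟨a, ha, hpos, -⟩ := id hf.pos_measurable
  -- Half a lower bound of `z^ρ` on `[1,4]`: off the exceptional sets the ratio `f (z * x) / f x`
  -- lies between `ε` and `A`.
  set ε : ℝ := 4 ^ (-|ρ|) / 2 with hε
  have hε0 : 0 < ε := by positivity
  set A : ℝ := 4 ^ |ρ| + ε with hA
  have hA0 : 0 < A := by positivity
  suffices h : ∃ b > 0, ∀ x y : ℝ, 0 < x → x ≤ y → y ≤ 2 * x → y ≤ b →
      f y ≤ A / ε * f x ∧ f x ≤ A / ε * f y by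
    obtain ⟨b, hb, h⟩ := h
    refine ⟨A / ε, by positivity, min a b, lt_min ha hb,
      fun x hx => hpos x ⟨hx.1, hx.2.trans (min_le_left _ _)⟩, fun x hx y hy h1 h2 => ?_⟩
    rcases le_total x y with hxy | hxy
    · exact (h x y hx.1 hxy h2 (hy.2.trans (min_le_right _ _))).2
    · exact (h y x hy.1 hxy h1 (hx.2.trans (min_le_right _ _))).1
  by_contra! hcon
  choose! x y hx hxy hyx hy hbad using fun n : ℕ => hcon (1 / ((n : ℝ) + 1)) (by positivity)
  have hy0 (n : ℕ) : 0 < y n := (hx n).trans_le (hxy n)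
  have hty : Tendsto y atTop (𝓝 0) :=
    squeeze_zero (fun n => (hy0 n).le) hy tendsto_one_div_add_atTop_nhds_zero_nat
  have htx : Tendsto x atTop (𝓝 0) := squeeze_zero (fun n => (hx n).le) hxy hty
  have hEx := (hf.tendsto_volume hε0 hx htx).eventually (gt_mem_nhds (by norm_num : (0 : ℝ≥0∞) < 1 / 4))
  have hEy := (hf.tendsto_volume hε0 hy0 hty).eventually
    (gt_mem_nhds (by norm_num : (0 : ℝ≥0∞) < 1 / 4))
  have hea : ∀ᶠ n in atTop, y n < a := hty.eventually (gt_mem_nhds ha)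
  obtain ⟨n, hn1, hn2, hn3⟩ := (hEx.and (hEy.and hea)).exists
  set lam := y n / x n with hlam
  have hlam1 : 1 ≤ lam := (one_le_div (hx n)).2 (hxy n)
  have hlam2 : lam ≤ 2 := (div_le_iff₀ (hx n)).2 (hyx n)
  have hlam0 : 0 < lam := by linarith
  set U := {z | z ∈ Icc (1 : ℝ) 4 ∧ ε ≤ |f (z * x n) / f (x n) - z ^ ρ|}
  set V := {z | z ∈ Icc (1 : ℝ) 4 ∧ ε ≤ |f (z * y n) / f (y n) - z ^ ρ|}
  -- With `lam ∈ [1,2]` and `z ∈ [2,4]`, the point `lam⁻¹ * z` stays in `[1,4]`. The exceptional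
  -- sets cover at most `1/4 + 2 * (1/4)` of an interval of length `2`.
  have hex : ∃ z ∈ Icc (2 : ℝ) 4, z ∉ U ∧ lam⁻¹ * z ∉ V := by
    by_contra! hc
    have hsub : Icc (2 : ℝ) 4 ⊆ U ∪ (fun z => lam⁻¹ * z) ⁻¹' V := by
      intro z hz
      by_cases h : z ∈ U
      · exact Or.inl h
      · exact Or.inr (hc z hz h)
    have h1 := (measure_mono hsub).trans (measure_union_le (μ := volume) _ _)
    rw [Real.volume_Icc, Real.volume_preimage_mul_left (inv_ne_zero hlam0.ne'), inv_inv,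
      abs_of_pos hlam0] at h1
    have h2 : ENNReal.ofReal lam ≤ 2 := by
      rw [← ENNReal.ofReal_ofNat]; exact ENNReal.ofReal_le_ofReal hlam2
    have h3 : ENNReal.ofReal (4 - 2) ≤ 1 / 4 + 2 * (1 / 4) :=
      h1.trans (add_le_add hn1.le (mul_le_mul' h2 hn2.le))
    have h4 : (1 / 4 + 2 * (1 / 4) : ℝ≥0∞) = ENNReal.ofReal (3 / 4) := by
      rw [show (1 / 4 : ℝ≥0∞) = ENNReal.ofReal (1 / 4) by
        rw [ENNReal.ofReal_div_of_pos (by norm_num)]; simp, ← ENNReal.ofReal_ofNat 2,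
        ← ENNReal.ofReal_mul (by norm_num), ← ENNReal.ofReal_add (by norm_num) (by norm_num)]
      norm_num
    rw [h4, ENNReal.ofReal_le_ofReal_iff (by norm_num)] at h3
    norm_num at h3
  obtain ⟨z, hz, hzU, hzV⟩ := hex
  have hbd (w : ℝ) (hw : w ∈ Icc (1 : ℝ) 4) (x : ℝ)
      (h : w ∉ {z | z ∈ Icc (1 : ℝ) 4 ∧ ε ≤ |f (z * x) / f x - z ^ ρ|}) (hfx : 0 < f x) :
      ε * f x ≤ f (w * x) ∧ f (w * x) ≤ A * f x := by
    have h1 : |f (w * x) / f x - w ^ ρ| < ε := by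
      by_contra! h2
      exact h ⟨hw, h2⟩
    have h2 := rpow_mem_Icc_of_mem_Icc_one_four ρ hw
    have h3 := abs_lt.1 h1
    rw [← le_div_iff₀ hfx, ← div_le_iff₀ hfx]
    constructor
    · have : (4 : ℝ) ^ (-|ρ|) = 2 * ε := by rw [hε]; ring
      linarith [h2.1]
    · linarith [h2.2]
  have hfx : 0 < f (x n) := hpos _ ⟨hx n, (hxy n).trans hn3.le⟩
  have hfy : 0 < f (y n) := hpos _ ⟨hy0 n, hn3.le⟩
  have b1 := hbd z ⟨by linarith [hz.1], hz.2⟩ (x n) hzU hfx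
  have hzl : lam⁻¹ * z ∈ Icc (1 : ℝ) 4 := by
    rw [mem_Icc, inv_mul_eq_div, le_div_iff₀ hlam0, div_le_iff₀ hlam0]
    constructor
    · linarith [hz.1]
    · linarith [hz.2]
  have b2 := hbd _ hzl (y n) hzV hfy
  have heq : lam⁻¹ * z * y n = z * x n := by
    have := (hx n).ne'
    have := (hy0 n).ne'
    rw [hlam]; field_simp
  rw [heq] at b2
  have c1 : f (y n) ≤ A / ε * f (x n) := by
    rw [div_mul_eq_mul_div, le_div_iff₀ hε0]; linarith [b2.1, b1.2]
  have c2 : f (x n) ≤ A / ε * f (y n) := by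
    rw [div_mul_eq_mul_div, le_div_iff₀ hε0]; linarith [b2.2, b1.1]
  exact absurd c2 (not_le.2 (hbad n c1))

end RegularVariation

/-! ## Designs -/

section DesignLemmas

variable {h : ℝ → ℝ}

namespace IsDesignDensity

theorem intervalIntegrable (hd : IsDesignDensity h) : IntervalIntegrable h volume 0 1 := by
  -- The integral of a non-integrable function is `0` by convention, not `1`.
  by_contra hc
  have := hd.total
  rw [intervalIntegral.integral_undef hc] at this
  exact zero_ne_one this

theorem intervalIntegrable_of_mem (hd : IsDesignDensity h) {a b : ℝ} (ha : a ∈ Icc (0 : ℝ) 1)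
    (hb : b ∈ Icc (0 : ℝ) 1) : IntervalIntegrable h volume a b :=
  hd.intervalIntegrable.mono_set (by
    rw [uIcc_of_le (zero_le_one' ℝ)]
    exact uIcc_subset_Icc ha hb)

theorem continuousOn_distrib (hd : IsDesignDensity h) : ContinuousOn (distrib h) (Icc 0 1) := by
  have := intervalIntegral.continuousOn_primitive_interval' hd.intervalIntegrable
    (left_mem_uIcc)
  rwa [uIcc_of_le (zero_le_one' ℝ)] at this

theorem continuousAt (hd : IsDesignDensity h) {t : ℝ} (ht : t ∈ Ioo (0 : ℝ) 1) :
    ContinuousAt h t :=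
  hd.continuousOn.continuousAt (Ioc_mem_nhds ht.1 ht.2)

theorem hasDerivAt_distrib (hd : IsDesignDensity h) {t : ℝ} (ht : t ∈ Ioo (0 : ℝ) 1) :
    HasDerivAt (distrib h) (h t) t := by
  refine intervalIntegral.integral_hasDerivAt_right
    (hd.intervalIntegrable_of_mem (by simp) ⟨ht.1.le, ht.2.le⟩) ?_ (hd.continuousAt ht)
  exact (hd.continuousOn.mono Ioo_subset_Ioc_self).stronglyMeasurableAtFilter isOpen_Ioo t ht

theorem distrib_zero (h : ℝ → ℝ) : distrib h 0 = 0 := intervalIntegral.integral_same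

theorem distrib_one (hd : IsDesignDensity h) : distrib h 1 = 1 := hd.total

theorem exists_slope (hd : IsDesignDensity h) {a b : ℝ} (ha : 0 ≤ a) (hab : a < b) (hb : b ≤ 1) :
    ∃ ξ ∈ Ioo a b, h ξ * (b - a) = distrib h b - distrib h a := by
  obtain ⟨ξ, hξ, he⟩ := exists_hasDerivAt_eq_slope (distrib h) h hab
    (hd.continuousOn_distrib.mono (Icc_subset_Icc ha hb))
    (fun x hx => hd.hasDerivAt_distrib ⟨ha.trans_lt hx.1, hx.2.trans_le hb⟩)
  exact ⟨ξ, hξ, by rw [he, div_mul_cancel₀ _ (sub_pos.2 hab).ne']⟩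

theorem strictMonoOn_distrib (hd : IsDesignDensity h) : StrictMonoOn (distrib h) (Icc 0 1) := by
  intro a ha b hb hab
  obtain ⟨ξ, hξ, he⟩ := hd.exists_slope ha.1 hab hb.2
  have := mul_pos (hd.pos ξ ⟨ha.1.trans_lt hξ.1, hξ.2.le.trans hb.2⟩) (sub_pos.2 hab)
  linarith

theorem distrib_pos (hd : IsDesignDensity h) {t : ℝ} (ht : t ∈ Ioc (0 : ℝ) 1) :
    0 < distrib h t := by
  rw [← distrib_zero h]
  exact hd.strictMonoOn_distrib (by simp) ⟨ht.1.le, ht.2⟩ ht.1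

theorem quantile_distrib (hd : IsDesignDensity h) {t : ℝ} (ht : t ∈ Icc (0 : ℝ) 1) :
    quantile h (distrib h t) = t := by
  have : {u | u ∈ Icc (0 : ℝ) 1 ∧ distrib h t ≤ distrib h u} = Icc t 1 := by
    ext u
    constructor
    · rintro ⟨hu, hle⟩
      exact ⟨(hd.strictMonoOn_distrib.le_iff_le ht hu).1 hle, hu.2⟩
    · rintro ⟨h1, h2⟩
      have hu : u ∈ Icc (0 : ℝ) 1 := ⟨ht.1.trans h1, h2⟩
      exact ⟨hu, (hd.strictMonoOn_distrib.le_iff_le ht hu).2 h1⟩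
  rw [quantile, this, csInf_Icc ht.2]

/-- The limit at `0` excludes small values near `0`, and compactness excludes them elsewhere. This
is what makes the mesh of the designs of order `1/n`. -/
theorem exists_lower_bound (hd : IsDesignDensity h) : ∃ y > 0, ∀ t ∈ Ioc (0 : ℝ) 1, y ≤ h t := by
  have h1 : ∃ y > 0, ∀ᶠ t in 𝓝[>] (0 : ℝ), y ≤ h t := by
    rcases hd.at_zero with h1 | ⟨y, hy, h1⟩
    · exact ⟨1, one_pos, h1.eventually_ge_atTop 1⟩
    · exact ⟨y / 2, by positivity, h1.eventually (le_mem_nhds (by linarith))⟩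
  obtain ⟨y, hy, h1⟩ := h1
  obtain ⟨a, ha, h2⟩ := mem_nhdsGT_iff_exists_Ioo_subset.1 h1
  have ha : (0 : ℝ) < a := ha
  obtain ⟨z, hz, h3⟩ : ∃ z > 0, ∀ t ∈ Icc (min a 1) 1, z ≤ h t := by
    obtain ⟨t, ht, hmin⟩ := isCompact_Icc.exists_isMinOn (nonempty_Icc.2 (min_le_right a 1))
      (hd.continuousOn.mono fun t ht => ⟨(lt_min ha one_pos).trans_le ht.1, ht.2⟩)
    exact ⟨h t, hd.pos t ⟨(lt_min ha one_pos).trans_le ht.1, ht.2⟩, hmin⟩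
  refine ⟨min y z, lt_min hy hz, fun t ht => ?_⟩
  by_cases hta : t < a
  · exact (min_le_left _ _).trans (h2 ⟨ht.1, hta⟩)
  · exact (min_le_right _ _).trans (h3 t ⟨(min_le_left _ _).trans (not_lt.1 hta), ht.2⟩)

theorem tendsto_distrib_zero (hd : IsDesignDensity h) :
    Tendsto (distrib h) (𝓝[>] 0) (𝓝[>] 0) := by
  refine tendsto_nhdsWithin_iff.2 ⟨?_, ?_⟩
  · have h1 := (hd.continuousOn_distrib 0 (by simp)).tendsto
    rw [distrib_zero] at h1
    exact h1.mono_left (nhdsWithin_le_of_mem (mem_of_superset (Ioo_mem_nhdsGT one_pos)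
      Ioo_subset_Icc_self))
  · filter_upwards [Ioc_mem_nhdsGT (one_pos : (0 : ℝ) < 1)] with t ht
    exact hd.distrib_pos ht

end IsDesignDensity

namespace IsQRS

variable {T : ℕ → ℕ → ℝ} (hT : IsQRS h T)
include hT

theorem knot_lt {n i j : ℕ} (hn : 1 ≤ n) (hij : i < j) (hj : j ≤ n) : T n i < T n j := by
  rw [← hT.density.strictMonoOn_distrib.lt_iff_lt (hT.knot_mem n hn i (by omega))
    (hT.knot_mem n hn j hj), hT.knot n hn i (by omega), hT.knot n hn j hj]
  have : (0 : ℝ) < n := by exact_mod_cast hn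
  gcongr

theorem knot_mem_Ioc {n i : ℕ} (hi0 : 1 ≤ i) (hi : i ≤ n) : T n i ∈ Ioc (0 : ℝ) 1 := by
  have hn : 1 ≤ n := hi0.trans hi
  refine ⟨?_, (hT.knot_mem n hn i hi).2⟩
  rw [← hT.knot_zero n hn]
  exact hT.knot_lt hn (by omega) hi

theorem knot_last {n : ℕ} (hn : 1 ≤ n) : T n n = 1 := by
  refine hT.density.strictMonoOn_distrib.injOn (hT.knot_mem n hn n le_rfl) (by simp) ?_
  rw [hT.knot n hn n le_rfl, hT.density.distrib_one, div_self (by positivity)]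

theorem exists_spacing {n i : ℕ} (hi : i + 1 ≤ n) :
    ∃ ξ ∈ Ioo (T n i) (T n (i + 1)), n * (T n (i + 1) - T n i) = (h ξ)⁻¹ := by
  have hn : 1 ≤ n := by omega
  obtain ⟨ξ, hξ, he⟩ := hT.density.exists_slope (hT.knot_mem n hn i (by omega)).1
    (hT.knot_lt hn (Nat.lt_succ_self i) hi) (hT.knot_mem n hn (i + 1) hi).2
  refine ⟨ξ, hξ, ?_⟩
  rw [hT.knot n hn i (by omega), hT.knot n hn (i + 1) hi, ← sub_div] at he
  have hn0 : (n : ℝ) ≠ 0 := by positivity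
  have hh := hT.density.pos ξ ⟨(hT.knot_mem n hn i (by omega)).1.trans_lt hξ.1,
    hξ.2.le.trans (hT.knot_mem n hn (i + 1) hi).2⟩
  push_cast at he
  field_simp at he ⊢
  linarith

theorem exists_mesh_bound : ∃ y > 0, ∀ n i : ℕ, i + 1 ≤ n →
    n * (T n (i + 1) - T n i) ≤ y := by
  obtain ⟨z, hz, hb⟩ := hT.density.exists_lower_bound
  refine ⟨z⁻¹, inv_pos.2 hz, fun n i hi => ?_⟩
  have hn : 1 ≤ n := by omega
  obtain ⟨ξ, hξ, he⟩ := hT.exists_spacing hi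
  rw [he]
  exact inv_anti₀ hz (hb ξ ⟨(hT.knot_mem n hn i (by omega)).1.trans_lt hξ.1,
    hξ.2.le.trans (hT.knot_mem n hn (i + 1) hi).2⟩)

theorem eventually_mesh_lt {δ : ℝ} (hδ : 0 < δ) : ∀ᶠ n : ℕ in atTop, ∀ i, i + 1 ≤ n →
    T n (i + 1) - T n i < δ := by
  obtain ⟨y, hy, hb⟩ := hT.exists_mesh_bound
  filter_upwards [tendsto_natCast_atTop_atTop.eventually (eventually_gt_atTop (y / δ)),
    eventually_ge_atTop 1] with n hn hn1 i hi
  have h1 := hb n i hi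
  have hn0 : (0 : ℝ) < n := by positivity
  rw [div_lt_iff₀ hδ] at hn
  by_contra! h2
  have := mul_le_mul_of_nonneg_left h2 hn0.le
  linarith

/-- Formally `t_1 = G(1/n) = ∫₀^{1/n} g`, and `g(s) = o(s^{γ-1})` integrates to `o(n^{-γ})`. To
avoid differentiating `G`, the estimate is carried out in the variable `t`, by monotonicity of
`(η/γ) H(t)^γ - t`. -/
theorem tendsto_first_knot {r : ℝ → ℝ} {γ : ℝ} (hγ : 0 < γ)
    (hgr : ∀ᶠ s in 𝓝[>] (0 : ℝ), quantileDensity h s ≤ r s)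
    (hr : r =o[𝓝[>] 0] fun s : ℝ => s ^ (γ - 1)) :
    Tendsto (fun n : ℕ => (n : ℝ) ^ γ * T n 1) atTop (𝓝 0) := by
  have hd := hT.density
  rw [Metric.tendsto_nhds]
  intro ε hε
  -- Integration of `η s^{γ-1}` brings in `η/γ = ε/2`, strictly below `ε`.
  set η := ε * γ / 2 with hη
  have hη0 : 0 < η := by positivity
  have hev : ∀ᶠ s in 𝓝[>] (0 : ℝ), quantileDensity h s ≤ η * s ^ (γ - 1) := by
    filter_upwards [hgr, hr.bound hη0, self_mem_nhdsWithin] with s h1 h2 (h3 : 0 < s)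
    rw [Real.norm_of_nonneg (Real.rpow_nonneg h3.le _)] at h2
    exact h1.trans ((le_abs_self _).trans h2)
  obtain ⟨s₀, hs₀, hsub⟩ := mem_nhdsGT_iff_exists_Ioo_subset.1 hev
  have hs₀ : (0 : ℝ) < s₀ := hs₀
  filter_upwards [tendsto_natCast_atTop_atTop.eventually (eventually_gt_atTop (1 / s₀)),
    eventually_ge_atTop 1] with n hn hn1
  have hn0 : (0 : ℝ) < n := by positivity
  have hns : 1 / (n : ℝ) < s₀ := by rwa [one_div_lt hn0 hs₀]
  have ht := hT.knot_mem_Ioc le_rfl hn1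
  set t₁ := T n 1
  have hHt : distrib h t₁ = 1 / n := by simpa using hT.knot n hn1 1 hn1
  have hsubI : Icc 0 t₁ ⊆ Icc (0 : ℝ) 1 := Icc_subset_Icc le_rfl ht.2
  have hder : ∀ x ∈ Ioo 0 t₁, HasDerivAt (fun t => η / γ * distrib h t ^ γ - t)
      (η / γ * (h x * γ * distrib h x ^ (γ - 1)) - 1) x := by
    intro x hx
    have hx1 : x ∈ Ioo (0 : ℝ) 1 := ⟨hx.1, hx.2.trans_le ht.2⟩
    exact (((hd.hasDerivAt_distrib hx1).rpow_const
      (Or.inl (hd.distrib_pos ⟨hx1.1, hx1.2.le⟩).ne')).const_mul _).sub (hasDerivAt_id x)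
  -- The derivative is `η H^{γ-1} h - 1`, and it is nonnegative because `1/h = g ∘ H ≤ η H^{γ-1}`.
  have hmono : MonotoneOn (fun t => η / γ * distrib h t ^ γ - t) (Icc 0 t₁) := by
    refine monotoneOn_of_deriv_nonneg (convex_Icc _ _) ?_ ?_ ?_
    · refine ContinuousOn.sub (continuousOn_const.mul ?_) continuousOn_id
      exact (hd.continuousOn_distrib.mono hsubI).rpow_const fun x _ => Or.inr hγ.le
    · rw [interior_Icc]
      exact fun x hx => (hder x hx).differentiableAt.differentiableWithinAt
    · rw [interior_Icc]
      intro x hx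
      rw [(hder x hx).deriv]
      have hx1 : x ∈ Icc (0 : ℝ) 1 := hsubI (Ioo_subset_Icc_self hx)
      have hHx := hd.distrib_pos ⟨hx.1, hx1.2⟩
      have hlt : distrib h x < s₀ := by
        refine lt_trans ?_ hns
        rw [← hHt]
        exact hd.strictMonoOn_distrib hx1 ⟨ht.1.le, ht.2⟩ hx.2
      have h1 : quantileDensity h (distrib h x) ≤ η * distrib h x ^ (γ - 1) := hsub ⟨hHx, hlt⟩
      have hhx := hd.pos x ⟨hx.1, hx1.2⟩
      rw [quantileDensity, hd.quantile_distrib hx1, div_le_iff₀ hhx] at h1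
      have : η / γ * (h x * γ * distrib h x ^ (γ - 1)) = η * distrib h x ^ (γ - 1) * h x := by
        field_simp
      linarith
  have hle := hmono (left_mem_Icc.2 ht.1.le) (right_mem_Icc.2 ht.1.le) ht.1.le
  simp only [IsDesignDensity.distrib_zero, Real.zero_rpow hγ.ne', hHt] at hle
  rw [Real.dist_eq, sub_zero, abs_of_nonneg (mul_nonneg (Real.rpow_nonneg hn0.le _) ht.1.le)]
  have h2 : (n : ℝ) ^ γ * (1 / n) ^ γ = 1 := by
    rw [← Real.mul_rpow hn0.le (by positivity), mul_one_div_cancel hn0.ne', Real.one_rpow]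
  have h3 : η / γ = ε / 2 := by rw [hη]; field_simp
  have hnγ : 0 < (n : ℝ) ^ γ := Real.rpow_pos_of_pos hn0 _
  rw [h3] at hle
  have h4 := mul_le_mul_of_nonneg_left hle hnγ.le
  nlinarith

end IsQRS

open Classical in
/-- The index of the knot to the left of `t`, as in `hermiteSpline`. -/
def knotIndex (n : ℕ) (T : ℕ → ℝ) (t : ℝ) : ℕ := Nat.findGreatest (fun i => T i ≤ t) (n - 1)

namespace IsQRS

variable {T : ℕ → ℕ → ℝ} (hT : IsQRS h T)
include hT

theorem knotIndex_mem {n : ℕ} (hn : 1 ≤ n) {t : ℝ} (ht : t ∈ Icc (0 : ℝ) 1) :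
    knotIndex n (T n) t + 1 ≤ n ∧
      t ∈ Icc (T n (knotIndex n (T n) t)) (T n (knotIndex n (T n) t + 1)) := by
  classical
  have hle : knotIndex n (T n) t ≤ n - 1 := Nat.findGreatest_le _
  refine ⟨by omega, ?_, ?_⟩
  · exact Nat.findGreatest_spec (P := fun i => T n i ≤ t) (Nat.zero_le (n - 1))
      (by rw [hT.knot_zero n hn]; exact ht.1)
  -- The search stops at `n - 1`, so that the end point `1` belongs to the last cell.
  · rcases hle.eq_or_lt with he | hlt
    · rw [he, Nat.sub_add_cancel hn, hT.knot_last hn]; exact ht.2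
    · exact (not_le.1 (Nat.findGreatest_is_greatest (P := fun i => T n i ≤ t)
        (Nat.lt_succ_self _) hlt)).le

theorem knotIndex_eq {n i : ℕ} (hi : i + 1 ≤ n) {t : ℝ} (ht : t ∈ Ico (T n i) (T n (i + 1))) :
    knotIndex n (T n) t = i := by
  classical
  rw [knotIndex, Nat.findGreatest_eq_iff]
  refine ⟨by omega, fun _ => ht.1, fun j hj1 hj2 => not_le.2 ?_⟩
  refine ht.2.trans_le ?_
  rcases (Nat.succ_le_of_lt hj1).eq_or_lt with he | hlt
  · rw [← he]
  · exact (hT.knot_lt (by omega) hlt (by omega)).le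

end IsQRS

theorem one_le_knotIndex {n : ℕ} (hn : 2 ≤ n) {T : ℕ → ℝ} {t : ℝ} (ht : T 1 ≤ t) :
    1 ≤ knotIndex n T t := by
  classical
  exact Nat.le_findGreatest (P := fun i => T i ≤ t) (by omega) ht

end DesignLemmas

/-! ## Derivatives of the process -/

section LocalRegularity

variable {E : Type*} [NormedAddCommGroup E] [NormedSpace ℝ E]

/-- Derivatives within a set depend only on its germ at the point, and `[a,1]` and `[0,1]` agree
near every `t > a`, including `t = 1`. All local hypotheses can thus be restated for the single
family `deriv01`. -/
theorem iteratedDerivWithin_Icc_one_eq_deriv01 {X : ℝ → E} (j : ℕ) {a t : ℝ} (ha : 0 ≤ a)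
    (hat : a < t) : iteratedDerivWithin j X (Icc a 1) t = deriv01 j X t := by
  rw [deriv01, iteratedDerivWithin, iteratedDerivWithin]
  congr 1
  refine iteratedFDerivWithin_congr_set ?_ j
  filter_upwards [Ioi_mem_nhds hat] with x (hx : a < x)
  exact propext ⟨fun h => ⟨ha.trans h.1, h.2⟩, fun h => ⟨hx.le, h.2⟩⟩

theorem derivChain_of_contDiffOn {X : ℝ → E} {m : ℕ} {a b : ℝ} (hab : a < b)
    (hX : ContDiffOn ℝ m X (Icc a b)) :
    DerivChain m a b fun j => iteratedDerivWithin j X (Icc a b) where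
  hasDerivWithinAt j hj t ht := by
    have hu := uniqueDiffOn_Icc hab
    rw [iteratedDerivWithin_succ]
    exact (hX.differentiableOn_iteratedDerivWithin (by exact_mod_cast hj) hu t ht).hasDerivWithinAt
  continuousOn := hX.continuousOn_iteratedDerivWithin le_rfl (uniqueDiffOn_Icc hab)

theorem DerivChain.mono {m : ℕ} {a b a' b' : ℝ} {F : ℕ → ℝ → E} (hF : DerivChain m a b F)
    (h : Icc a' b' ⊆ Icc a b) : DerivChain m a' b' F where
  hasDerivWithinAt j hj t ht := (hF.hasDerivWithinAt j hj t (h ht)).mono h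
  continuousOn := hF.continuousOn.mono h

namespace LocallyHolderStationary

variable {m : ℕ} {β : ℝ} {c V : ℝ → ℝ} {X : ℝ → E} (hX : LocallyHolderStationary m β c V X)
include hX

theorem derivChain {a b : ℝ} (ha : 0 < a) (hab : a ≤ b) (hb : b ≤ 1) :
    DerivChain m a b fun j => deriv01 j X := by
  -- The larger interval `[a/2,1]` keeps `a` away from the left end, where one-sided derivatives
  -- could differ from `deriv01`.
  have h := (hX (a / 2) 1 (by linarith) (by linarith) le_rfl).1
  have h1 := (derivChain_of_contDiffOn (by linarith) h.contDiffOn).mono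
    (Icc_subset_Icc (by linarith : a / 2 ≤ a) hb)
  exact h1.congr fun j _ t ht =>
    (iteratedDerivWithin_Icc_one_eq_deriv01 j (by linarith) (by linarith [ht.1])).symm

theorem exists_holder {s t : ℝ} (hs : s ∈ Ioc (0 : ℝ) 1) (ht : t ∈ Ioc (0 : ℝ) 1) :
    ∃ w ∈ uIcc t s, ‖deriv01 m X s - deriv01 m X t‖ ≤ √(V w) * |s - t| ^ β := by
  have hpos : 0 < min s t := lt_min hs.1 ht.1
  have h1 : min s t ≤ 1 := (min_le_left _ _).trans hs.2
  have h := (hX (min s t / 2) 1 (by linarith) (by linarith) le_rfl).1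
  have hs' : min s t / 2 < s := (half_lt_self hpos).trans_le (min_le_left _ _)
  have ht' : min s t / 2 < t := (half_lt_self hpos).trans_le (min_le_right _ _)
  have := h.bound t ⟨ht'.le, ht.2⟩ s ⟨hs'.le, hs.2⟩
  rwa [iteratedDerivWithin_Icc_one_eq_deriv01 m (by linarith) hs',
    iteratedDerivWithin_Icc_one_eq_deriv01 m (by linarith) ht'] at this

theorem exists_stationary {δ ε : ℝ} (hδ0 : 0 < δ) (hδ1 : δ ≤ 1) (hε : 0 < ε) :
    ∃ η > 0, ∀ s ∈ Icc δ 1, ∀ t ∈ Icc δ 1, |s - t| < η →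
      |‖deriv01 m X s - deriv01 m X t‖ - √(c t) * |s - t| ^ β| ≤ ε * |s - t| ^ β := by
  have h := (hX (δ / 2) 1 (by linarith) (by linarith) le_rfl).2
  obtain ⟨η, hη, hlim⟩ := h.limit ε hε
  refine ⟨η, hη, fun s hs t ht hst => ?_⟩
  by_cases hne : s = t
  · subst hne
    simp [Real.zero_rpow h.exponent_pos.ne']
  have h0 : 0 < |s - t| ^ β := Real.rpow_pos_of_pos (abs_pos.2 (sub_ne_zero.2 hne)) _
  have := hlim t ⟨by linarith [ht.1], ht.2⟩ (s - t)
    (by rw [add_sub_cancel]; exact ⟨by linarith [hs.1], hs.2⟩) (sub_ne_zero.2 hne) hst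
  rw [add_sub_cancel, iteratedDerivWithin_Icc_one_eq_deriv01 m (by linarith) (by linarith [hs.1]),
    iteratedDerivWithin_Icc_one_eq_deriv01 m (by linarith) (by linarith [ht.1])] at this
  have h2 : ‖deriv01 m X s - deriv01 m X t‖ - √(c t) * |s - t| ^ β =
      (‖deriv01 m X s - deriv01 m X t‖ / |s - t| ^ β - √(c t)) * |s - t| ^ β := by
    field_simp
  rw [h2, abs_mul, abs_of_pos h0]
  exact mul_le_mul_of_nonneg_right this.le h0.le

theorem pos {t : ℝ} (ht : t ∈ Ioc (0 : ℝ) 1) : 0 < c t ∧ 0 < V t := by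
  have h := hX (t / 2) 1 (by linarith [ht.1]) (by linarith [ht.2]) le_rfl
  have : t ∈ Icc (t / 2) 1 := ⟨by linarith [ht.1], ht.2⟩
  exact ⟨h.2.pos t this, h.1.pos t this⟩

theorem continuousOn : ContinuousOn c (Ioc 0 1) ∧ ContinuousOn V (Ioc 0 1) := by
  have key (t : ℝ) (ht : t ∈ Ioc (0 : ℝ) 1) : Icc (t / 2) 1 ∈ 𝓝[Ioc 0 1] t := by
    rw [mem_nhdsWithin_iff_eventually]
    filter_upwards [Ioi_mem_nhds (by linarith [ht.1] : t / 2 < t)] with x hx hx1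
    exact ⟨le_of_lt hx, hx1.2⟩
  refine ⟨fun t ht => ?_, fun t ht => ?_⟩
  all_goals
    have h := hX (t / 2) 1 (by linarith [ht.1]) (by linarith [ht.2]) le_rfl
    have hm : t ∈ Icc (t / 2) 1 := ⟨by linarith [ht.1], ht.2⟩
  · exact (h.2.continuousOn t hm).mono_of_mem_nhdsWithin (key t ht)
  · exact (h.1.continuousOn t hm).mono_of_mem_nhdsWithin (key t ht)

/-- Dividing the Hölder bound by `|s - t|^β` and letting `s` tend to `t`, the left side tends to
`√(c t)` and `V` is evaluated at points tending to `t`. -/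
theorem sqrt_le {t : ℝ} (ht : t ∈ Ioc (0 : ℝ) 1) : √(c t) ≤ √(V t) := by
  refine le_of_forall_pos_le_add fun ε hε => ?_
  obtain ⟨η, hη, hst⟩ := hX.exists_stationary (by linarith [ht.1] : 0 < t / 2)
    (by linarith [ht.1, ht.2]) (half_pos hε)
  have hc : ContinuousWithinAt (fun w => √(V w)) (Ioc 0 1) t := (hX.continuousOn.2 t ht).sqrt
  obtain ⟨κ, hκ, hball⟩ := Metric.continuousWithinAt_iff.1 hc (ε / 2) (half_pos hε)
  -- To the left of `t`, since `t` may be `1`; the last minimum keeps `s ≥ t/2`.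
  set s := t - min (min η κ) t / 2 with hs
  have hm0 : 0 < min (min η κ) t := lt_min (lt_min hη hκ) ht.1
  have hm1 : min (min η κ) t ≤ η := (min_le_left _ _).trans (min_le_left _ _)
  have hm2 : min (min η κ) t ≤ κ := (min_le_left _ _).trans (min_le_right _ _)
  have hm3 : min (min η κ) t ≤ t := min_le_right _ _
  have hst' : |s - t| = min (min η κ) t / 2 := by
    rw [hs, sub_sub_cancel_left, abs_neg, abs_of_pos (half_pos hm0)]
  have h1 := hst s ⟨by linarith, by linarith [ht.2]⟩ t ⟨by linarith [ht.1], ht.2⟩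
    (by rw [hst']; linarith)
  obtain ⟨w, hw, h2⟩ := hX.exists_holder (s := s) (t := t) ⟨by linarith, by linarith [ht.2]⟩ ht
  rw [uIcc_of_ge (by linarith)] at hw
  have h3 := hball (x := w) ⟨by linarith [hw.1], hw.2.trans ht.2⟩
    (by rw [Real.dist_eq, abs_lt]; constructor <;> linarith [hw.1, hw.2])
  rw [Real.dist_eq] at h3
  have h0 : 0 < |s - t| ^ β := Real.rpow_pos_of_pos (by rw [hst']; linarith) _
  have h4 := (abs_le.1 h1).1
  have h5 : √(c t) ≤ √(V w) + ε / 2 := by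
    refine le_of_mul_le_mul_right ?_ h0
    linarith
  linarith [(abs_lt.1 h3).2]

end LocallyHolderStationary

theorem LocallyHolder.derivChain_deriv01 {l : ℕ} {α : ℝ} {V : ℝ → ℝ} {X : ℝ → E}
    (hX : LocallyHolder l α V 0 1 X) : DerivChain l 0 1 fun j => deriv01 j X :=
  derivChain_of_contDiffOn one_pos hX.contDiffOn

theorem deriv01_zero (X : ℝ → E) (t : ℝ) : deriv01 0 X t = X t := by simp [deriv01]

section Rescaling

variable {E : Type*} [NormedAddCommGroup E]

/-- A curve on `[a,b]`, moved to `[0,1]` and extended by constants. -/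
def rescaled (D : ℝ → E) (a b v : ℝ) : E := D (a + (b - a) * projIcc 0 1 zero_le_one v) - D a

theorem rescale_mem {a b v : ℝ} (hab : a ≤ b) (hv : v ∈ Icc (0 : ℝ) 1) :
    a + (b - a) * v ∈ Icc a b :=
  ⟨by nlinarith [hv.1], by nlinarith [hv.2]⟩

theorem rescaled_apply (D : ℝ → E) (a b : ℝ) {v : ℝ} (hv : v ∈ Icc (0 : ℝ) 1) :
    rescaled D a b v = D (a + (b - a) * v) - D a := by
  rw [rescaled, projIcc_of_mem _ hv]

theorem continuous_rescaled {D : ℝ → E} {a b : ℝ} (hab : a ≤ b) (hD : ContinuousOn D (Icc a b)) :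
    Continuous (rescaled D a b) := by
  refine Continuous.sub ?_ continuous_const
  refine hD.comp_continuous ?_ fun v => rescale_mem hab (Subtype.property _)
  have : Continuous (projIcc (0 : ℝ) 1 zero_le_one) := continuous_projIcc
  fun_prop

end Rescaling

/-- Serves in the first cell with `l`, `α` and the global Hölder constant, and in the other cells
with `m`, `β` and a bound of `√V` on the cell. -/
theorem norm_sub_hermitePiece_le [CompleteSpace E] {m r : ℕ} (hrm : r ≤ m) (hmr : m ≤ 2 * r + 1)
    {K : ℝ} (hK : ∀ u ∈ Icc (0 : ℝ) 1, ∀ (W : ℝ → E) (ε : ℝ), (∀ x ∈ Icc (0 : ℝ) 1, ‖W x‖ ≤ ε) →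
      ‖remainderFunctional m r u W‖ ≤ K * ε)
    {a b A β : ℝ} (hab : a < b) {X : ℝ → E} (hF : DerivChain m a b (fun j => deriv01 j X))
    (hA : ∀ s ∈ Icc a b, ‖deriv01 m X s - deriv01 m X a‖ ≤ A * (b - a) ^ β)
    {t : ℝ} (ht : t ∈ Icc a b) :
    ‖X t - hermitePiece r X a b t‖ ≤ K * A * (b - a) ^ ((m : ℝ) + β) := by
  have hpos : 0 < b - a := sub_pos.2 hab
  have hu : (t - a) / (b - a) ∈ Icc (0 : ℝ) 1 :=
    ⟨div_nonneg (by linarith [ht.1]) hpos.le, (div_le_one hpos).2 (by linarith [ht.2])⟩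
  rw [sub_hermitePiece hrm hmr hab hF (fun t _ => deriv01_zero X t)
    (continuous_rescaled hab.le hF.continuousOn) (fun v hv => rescaled_apply _ _ _ hv) ht,
    norm_smul, Real.norm_of_nonneg (pow_nonneg hpos.le _), Real.rpow_add hpos, Real.rpow_natCast]
  have := hK _ hu (rescaled (deriv01 m X) a b) (A * (b - a) ^ β) fun v hv => by
    rw [rescaled_apply _ _ _ hv]
    exact hA _ (rescale_mem hab.le hv)
  calc _ ≤ (b - a) ^ m * (K * (A * (b - a) ^ β)) :=
        mul_le_mul_of_nonneg_left this (pow_nonneg hpos.le _)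
    _ = _ := by ring

end LocalRegularity

/-! ### Comparison with fractional Brownian motion in one cell -/

section LocalCovariance

variable {E : Type*} [NormedAddCommGroup E] [InnerProductSpace ℝ E] [CompleteSpace E]

/-- On an interval where the `m`-th derivative is nearly a multiple of a fractional Brownian motion
in covariance, so is the remainder. -/
theorem abs_norm_sq_sub_hermitePiece_sub_le {m r : ℕ} (hrm : r ≤ m) (hmr : m ≤ 2 * r + 1)
    {K : ℝ} (hK : ∀ u ∈ Icc (0 : ℝ) 1, ∀ (W : ℝ → ℝ) (ε : ℝ), (∀ x ∈ Icc (0 : ℝ) 1, ‖W x‖ ≤ ε) →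
      ‖remainderFunctional m r u W‖ ≤ K * ε)
    {a b β σ ε : ℝ} (h0 : 0 < β) (h1 : β < 1) (hab : a < b) {X : ℝ → E}
    (hF : DerivChain m a b (fun j => deriv01 j X))
    (hσ : ∀ s ∈ Icc a b, ∀ t ∈ Icc a b,
      |‖deriv01 m X s - deriv01 m X t‖ ^ 2 - σ * |s - t| ^ (2 * β)| ≤ ε * (b - a) ^ (2 * β))
    {t : ℝ} (ht : t ∈ Icc a b) :
    |‖X t - hermitePiece r X a b t‖ ^ 2 - (b - a) ^ (2 * ((m : ℝ) + β)) *
      (σ * ‖remainderFunctional m r ((t - a) / (b - a)) (fbm β)‖ ^ 2)| ≤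
      (b - a) ^ (2 * ((m : ℝ) + β)) * (2 * K ^ 2 * ε) := by
  have hpos : 0 < b - a := sub_pos.2 hab
  have hu : (t - a) / (b - a) ∈ Icc (0 : ℝ) 1 :=
    ⟨div_nonneg (by linarith [ht.1]) hpos.le, (div_le_one hpos).2 (by linarith [ht.2])⟩
  set u := (t - a) / (b - a)
  set D := deriv01 m X
  have hW := continuous_rescaled hab.le hF.continuousOn
  set W := rescaled D a b
  set H := (b - a) ^ (2 * β) with hH
  have hH0 : 0 < H := Real.rpow_pos_of_pos hpos _
  have hz : (0 : ℝ) ^ (2 * β) = 0 := Real.zero_rpow (by positivity)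
  have hsq (s v : ℝ) (hs : s ∈ Icc (0 : ℝ) 1) (hv : v ∈ Icc (0 : ℝ) 1) :
      |‖W s - W v‖ ^ 2 - σ * H * |s - v| ^ (2 * β)| ≤ ε * H := by
    have := hσ _ (rescale_mem hab.le hs) _ (rescale_mem hab.le hv)
    rw [add_sub_add_left_eq_sub, ← mul_sub, abs_mul, abs_of_pos hpos,
      Real.mul_rpow hpos.le (abs_nonneg _), ← mul_assoc] at this
    simp only [W]
    rwa [rescaled_apply _ _ _ hs, rescaled_apply _ _ _ hv, sub_sub_sub_cancel_right]
  have hW0 : W 0 = 0 := by simp [W, rescaled_apply D a b (v := 0) (by simp)]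
  -- Polarization: as `W 0 = 0`, the kernel `⟨W s, W v⟩` is half a combination of three squared
  -- increments, each within `ε * H` of its target. The total `3/2 * ε * H` is rounded up to `2 * ε
  -- * H`.
  have key := abs_norm_sq_remainderFunctional_sub_le (ε := 2 * ε * H) (σ := σ * H) (hK u hu) hW
    (continuous_fbm h0 h1) (fun s hs v hv => by
      have e1 := abs_le.1 (hsq s 0 hs (by simp))
      have e2 := abs_le.1 (hsq v 0 hv (by simp))
      have e3 := abs_le.1 (hsq s v hs hv)
      rw [hW0, sub_zero, sub_zero] at e1 e2
      rw [norm_sub_sq_real] at e3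
      have hεH : 0 ≤ ε * H := (abs_nonneg _).trans (hsq s v hs hv)
      rw [inner_fbm h0 h1, abs_le]
      constructor <;> linarith [e1.1, e1.2, e2.1, e2.2, e3.1, e3.2])
  have hpow : (b - a) ^ (2 * ((m : ℝ) + β)) = ((b - a) ^ m) ^ 2 * H := by
    rw [mul_add, Real.rpow_add hpos, ← pow_mul, mul_comm m 2, ← Real.rpow_natCast]
    push_cast
    rfl
  rw [sub_hermitePiece hrm hmr hab hF (fun t _ => deriv01_zero X t) hW
    (fun v hv => rescaled_apply _ _ _ hv) ht, norm_smul,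
    Real.norm_of_nonneg (pow_nonneg hpos.le _), mul_pow, hpow, mul_assoc (((b - a) ^ m) ^ 2),
    ← mul_sub, abs_mul, abs_of_nonneg (by positivity), mul_assoc (((b - a) ^ m) ^ 2), ← mul_assoc H,
    mul_comm H σ]
  refine mul_le_mul_of_nonneg_left (key.trans (le_of_eq ?_)) (by positivity)
  ring

end LocalCovariance

/-! ## Limits of norms of functions that oscillate in the cells of a design -/

section Cells

/-- The knot to the left of `t`. -/
def leftKnot (n : ℕ) (T : ℕ → ℝ) (t : ℝ) : ℝ := T (knotIndex n T t)

/-- The knot to the right of `t`. -/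
def rightKnot (n : ℕ) (T : ℕ → ℝ) (t : ℝ) : ℝ := T (knotIndex n T t + 1)

/-- The relative position of `t` in its cell. -/
def cellCoord (n : ℕ) (T : ℕ → ℝ) (t : ℝ) : ℝ :=
  (t - leftKnot n T t) / (rightKnot n T t - leftKnot n T t)

theorem measurable_knotIndex (n : ℕ) (T : ℕ → ℝ) : Measurable (knotIndex n T) := by
  classical
  exact measurable_findGreatest fun k _ => measurableSet_le measurable_const measurable_id

theorem measurable_comp_knotIndex {γ : Type*} [MeasurableSpace γ] (n : ℕ) (T : ℕ → ℝ)
    {F : ℕ → ℝ → γ} (hF : ∀ i, Measurable (F i)) : Measurable fun t => F (knotIndex n T t) t := by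
  have h1 : Measurable fun x : ℕ × ℝ => F x.1 x.2 := measurable_from_prod_countable_right hF
  exact h1.comp ((measurable_knotIndex n T).prodMk measurable_id)

theorem measurable_cellCoord (n : ℕ) (T : ℕ → ℝ) : Measurable (cellCoord n T) :=
  measurable_comp_knotIndex n T (F := fun i t => (t - T i) / (T (i + 1) - T i))
    fun _ => by fun_prop

variable {h : ℝ → ℝ} {T : ℕ → ℕ → ℝ}

namespace IsQRS

variable (hT : IsQRS h T)
include hT

theorem leftKnot_lt_rightKnot {n : ℕ} (hn : 1 ≤ n) {t : ℝ} (ht : t ∈ Icc (0 : ℝ) 1) :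
    leftKnot n (T n) t < rightKnot n (T n) t :=
  hT.knot_lt hn (Nat.lt_succ_self _) (hT.knotIndex_mem hn ht).1

theorem mem_cell {n : ℕ} (hn : 1 ≤ n) {t : ℝ} (ht : t ∈ Icc (0 : ℝ) 1) :
    t ∈ Icc (leftKnot n (T n) t) (rightKnot n (T n) t) := (hT.knotIndex_mem hn ht).2

theorem rightKnot_le_one {n : ℕ} (hn : 1 ≤ n) {t : ℝ} (ht : t ∈ Icc (0 : ℝ) 1) :
    rightKnot n (T n) t ≤ 1 := (hT.knot_mem n hn _ (hT.knotIndex_mem hn ht).1).2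

theorem cellCoord_mem {n : ℕ} (hn : 1 ≤ n) {t : ℝ} (ht : t ∈ Icc (0 : ℝ) 1) :
    cellCoord n (T n) t ∈ Icc (0 : ℝ) 1 := by
  have h1 := sub_pos.2 (hT.leftKnot_lt_rightKnot hn ht)
  have h2 := hT.mem_cell hn ht
  exact ⟨div_nonneg (by linarith [h2.1]) h1.le, (div_le_one h1).2 (by linarith [h2.2])⟩

theorem eventually_leftKnot {δ : ℝ} (hδ : 0 < δ) : ∀ᶠ n : ℕ in atTop, 2 ≤ n ∧
    ∀ t ∈ Icc (0 : ℝ) 1, t - δ < leftKnot n (T n) t ∧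
      rightKnot n (T n) t - leftKnot n (T n) t < δ := by
  filter_upwards [hT.eventually_mesh_lt hδ, eventually_ge_atTop 2] with n hn h2
  refine ⟨h2, fun t ht => ?_⟩
  have h1 := hn _ (hT.knotIndex_mem (n := n) (by omega) ht).1
  have h3 := hT.mem_cell (n := n) (by omega) ht
  exact ⟨by simp only [leftKnot, rightKnot] at *; linarith [h3.2], h1⟩

theorem eventually_first_knot_lt {δ : ℝ} (hδ : 0 < δ) : ∀ᶠ n : ℕ in atTop, T n 1 < δ := by
  filter_upwards [hT.eventually_mesh_lt hδ, eventually_ge_atTop 1] with n hn h1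
  have := hn 0 (by omega)
  rwa [hT.knot_zero n h1, sub_zero] at this

theorem tendsto_leftKnot {t : ℝ} (ht : t ∈ Icc (0 : ℝ) 1) :
    Tendsto (fun n => leftKnot n (T n) t) atTop (𝓝 t) := by
  rw [Metric.tendsto_nhds]
  intro ε hε
  filter_upwards [hT.eventually_leftKnot hε] with n hn
  have h1 := (hn.2 t ht).1
  have h2 := (hT.mem_cell (n := n) (by omega) ht).1
  rw [Real.dist_eq, abs_lt]
  constructor <;> linarith

/-- Averaging over the cells of a design. -/
theorem integral_cells {n : ℕ} (hn : 1 ≤ n) (F : ℝ → ℝ) {Ψ : ℝ → ℝ} (hΨ : Continuous Ψ) :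
    ∫ t in (T n 1)..1, F (leftKnot n (T n) t) * Ψ (cellCoord n (T n) t) =
      (∫ u in (0 : ℝ)..1, Ψ u) * ∫ t in (T n 1)..1, F (leftKnot n (T n) t) := by
  -- Integrals run over cells closed on the right, whereas a knot below `1` is indexed with the cell
  -- to its right; hence "almost every".
  have hcell (i : ℕ) (hi : i + 1 ≤ n) : ∀ᵐ t, t ∈ uIoc (T n i) (T n (i + 1)) →
      knotIndex n (T n) t = i := by
    have hne : ∀ᵐ t : ℝ, t ≠ T n (i + 1) := by simp [ae_iff]
    filter_upwards [hne] with t ht hm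
    rw [uIoc_of_le (hT.knot_lt hn (Nat.lt_succ_self i) hi).le] at hm
    exact hT.knotIndex_eq hi ⟨hm.1.le, lt_of_le_of_ne hm.2 ht⟩
  have e1 (i : ℕ) (hi : i + 1 ≤ n) : ∀ᵐ t, t ∈ uIoc (T n i) (T n (i + 1)) →
      F (leftKnot n (T n) t) = F (T n i) := by
    filter_upwards [hcell i hi] with t ht hm
    rw [leftKnot, ht hm]
  have e2 (i : ℕ) (hi : i + 1 ≤ n) : ∀ᵐ t, t ∈ uIoc (T n i) (T n (i + 1)) →
      F (leftKnot n (T n) t) * Ψ (cellCoord n (T n) t) =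
        F (T n i) * Ψ ((t - T n i) / (T n (i + 1) - T n i)) := by
    filter_upwards [hcell i hi] with t ht hm
    rw [cellCoord, leftKnot, rightKnot, ht hm]
  have i1 (i : ℕ) (hi : i + 1 ≤ n) : IntervalIntegrable (fun t => F (leftKnot n (T n) t)) volume
      (T n i) (T n (i + 1)) :=
    (intervalIntegrable_const (c := F (T n i))).congr_ae
      ((ae_restrict_iff' measurableSet_uIoc).2 ((e1 i hi).mono fun t ht hm => (ht hm).symm))
  have i2 (i : ℕ) (hi : i + 1 ≤ n) : IntervalIntegrable
      (fun t => F (leftKnot n (T n) t) * Ψ (cellCoord n (T n) t)) volume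
      (T n i) (T n (i + 1)) := by
    have : Continuous fun t => F (T n i) * Ψ ((t - T n i) / (T n (i + 1) - T n i)) := by fun_prop
    exact (this.intervalIntegrable _ _).congr_ae
      ((ae_restrict_iff' measurableSet_uIoc).2 ((e2 i hi).mono fun t ht hm => (ht hm).symm))
  rw [← hT.knot_last hn,
    ← intervalIntegral.sum_integral_adjacent_intervals_Ico hn
      (fun i hi => i1 i (by simp at hi; omega)),
    ← intervalIntegral.sum_integral_adjacent_intervals_Ico hn
      (fun i hi => i2 i (by simp at hi; omega)), hT.knot_last hn, Finset.mul_sum]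
  refine Finset.sum_congr rfl fun i hi => ?_
  have hi : i + 1 ≤ n := by simp at hi; omega
  rw [intervalIntegral.integral_congr_ae (e1 i hi), intervalIntegral.integral_congr_ae (e2 i hi),
    intervalIntegral.integral_const_mul, intervalIntegral.integral_const]
  have hpos := sub_pos.2 (hT.knot_lt hn (Nat.lt_succ_self i) hi)
  -- The affine substitution gives the same average of `Ψ` in every cell, which is why it factors
  -- out of the sum.
  have : ∫ t in (T n i)..(T n (i + 1)), Ψ ((t - T n i) / (T n (i + 1) - T n i)) =
      (T n (i + 1) - T n i) * ∫ u in (0 : ℝ)..1, Ψ u := by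
    simp_rw [sub_div]
    rw [intervalIntegral.integral_comp_div_sub _ hpos.ne', sub_self, ← sub_div,
      div_self hpos.ne', smul_eq_mul]
  rw [this, smul_eq_mul]
  ring

end IsQRS

/-- Uniform continuity of the power on a bounded interval. Neither sequence need converge, which
matters because the cell coordinate of a fixed point keeps oscillating. -/
theorem tendsto_rpow_sub_rpow {x y : ℕ → ℝ} {K s : ℝ} (hs : 0 ≤ s)
    (hx : ∀ᶠ n in atTop, x n ∈ Icc 0 K) (hy : ∀ᶠ n in atTop, y n ∈ Icc 0 K)
    (hxy : Tendsto (fun n => x n - y n) atTop (𝓝 0)) :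
    Tendsto (fun n => x n ^ s - y n ^ s) atTop (𝓝 0) := by
  have hu := isCompact_Icc.uniformContinuousOn_of_continuous
    ((Real.continuous_rpow_const hs).continuousOn (s := Icc 0 K))
  rw [Metric.uniformContinuousOn_iff] at hu
  rw [Metric.tendsto_nhds]
  intro ε hε
  obtain ⟨δ, hδ, h⟩ := hu ε hε
  filter_upwards [hx, hy, (Metric.tendsto_nhds.1 hxy) δ hδ] with n h1 h2 h3
  rw [Real.dist_eq, sub_zero] at h3 ⊢
  exact h _ h1 _ h2 h3

theorem exists_bound_Icc_one {φ : ℝ → ℝ} (hφ : ContinuousOn φ (Ioc 0 1)) {δ : ℝ} (hδ : 0 < δ) :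
    ∃ K > 0, ∀ t ∈ Icc δ 1, |φ t| ≤ K := by
  obtain ⟨K, hK⟩ := isCompact_Icc.exists_bound_of_continuousOn
    (hφ.mono fun t (ht : t ∈ Icc δ 1) => ⟨hδ.trans_le ht.1, ht.2⟩)
  exact ⟨max K 1, lt_max_of_lt_right one_pos, fun t ht => (hK t ht).trans (le_max_left _ _)⟩

/-- Convergence of the `p`-th power integrals over the cells other than the first. -/
theorem IsQRS.tendsto_integral_rpow (hT : IsQRS h T) {e : ℕ → ℝ → ℝ} {φ ψ : ℝ → ℝ} {s : ℝ}
    (hs : 0 < s) (he : ∀ n t, 0 ≤ e n t) (hφ : ContinuousOn φ (Ioc 0 1))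
    (hφ0 : ∀ t ∈ Ioc (0 : ℝ) 1, 0 ≤ φ t) (hψ : Continuous ψ) (hψ0 : ∀ u, 0 ≤ ψ u)
    (hem : ∀ n, AEMeasurable (e n) (volume.restrict (Ioc 0 1)))
    (happrox : ∀ δ > 0, ∀ ε > 0, ∀ᶠ n in atTop, ∀ t ∈ Icc δ 1,
      |e n t - φ (leftKnot n (T n) t) * ψ (cellCoord n (T n) t)| ≤ ε)
    {δ : ℝ} (hδ : 0 < δ) {D : ℝ → ℝ} (hD : IntegrableOn D (Ioc 0 δ))
    (hdom : ∀ᶠ n in atTop, ∀ t ∈ Ioc (0 : ℝ) 1, T n 1 < t → t ≤ δ →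
      e n t ^ s ≤ D t ∧ φ (leftKnot n (T n) t) ^ s ≤ D t) :
    IntegrableOn (fun t => φ t ^ s) (Ioc 0 1) ∧
    (∀ᶠ n in atTop, IntegrableOn (fun t => e n t ^ s) (Ioc (T n 1) 1)) ∧
    Tendsto (fun n => ∫ t in Ioc (T n 1) 1, e n t ^ s) atTop
      (𝓝 ((∫ u in Ioc (0 : ℝ) 1, ψ u ^ s) * ∫ t in Ioc (0 : ℝ) 1, φ t ^ s)) := by
  set μ : Measure ℝ := volume.restrict (Ioc 0 1) with hμ
  -- Half of `δ`, because the left knot of a point beyond `δ` may fall slightly below `δ`.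
  obtain ⟨Kφ, hKφ0, hKφ⟩ := exists_bound_Icc_one hφ (half_pos hδ)
  obtain ⟨Kψ, hKψ⟩ := isCompact_Icc.exists_bound_of_continuousOn (hψ.continuousOn (s := Icc 0 1))
  have hKψ0 : 0 ≤ Kψ := (norm_nonneg _).trans (hKψ 0 (by simp))
  have hψle (u : ℝ) (hu : u ∈ Icc (0 : ℝ) 1) : ψ u ≤ Kψ := (le_abs_self _).trans (hKψ u hu)
  -- Beyond `δ` the approximation with error `1` bounds `e` by `Kφ * Kψ + 1`; the second term bounds
  -- the step functions of `φ`.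
  set Q : ℝ := (Kφ * Kψ + 1) ^ s + Kφ ^ s with hQ
  have hQ0 : 0 ≤ Q := by positivity
  set B : ℝ → ℝ := fun t => (Ioc 0 δ).indicator (fun t => |D t|) t + Q with hB
  have hBint : Integrable B μ := by
    refine Integrable.add ?_ (integrable_const _)
    exact ((integrable_indicator_iff measurableSet_Ioc).2 hD.abs).mono_measure
      Measure.restrict_le_self
  have hB0 (t : ℝ) : 0 ≤ B t :=
    add_nonneg (indicator_nonneg (fun _ _ => abs_nonneg _) _) hQ0
  set a : ℕ → ℝ → ℝ := fun n t => φ (leftKnot n (T n) t) with ha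
  set w : ℕ → ℝ → ℝ := fun n t => ψ (cellCoord n (T n) t) with hw
  -- facts valid for large `n`
  have hgood : ∀ᶠ n in atTop, 2 ≤ n ∧ ∀ t ∈ Ioc (0 : ℝ) 1, T n 1 < t →
      0 ≤ a n t ∧ w n t ≤ Kψ ∧ e n t ^ s ≤ B t ∧ a n t ^ s ≤ B t := by
    filter_upwards [hdom, hT.eventually_leftKnot (half_pos hδ), happrox δ hδ 1 one_pos]
      with n h1 h2 h3
    refine ⟨h2.1, fun t ht ht1 => ?_⟩
    have ht' : t ∈ Icc (0 : ℝ) 1 := ⟨ht.1.le, ht.2⟩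
    have hn : 1 ≤ n := by omega
    have hlk : leftKnot n (T n) t ∈ Ioc (0 : ℝ) 1 :=
      hT.knot_mem_Ioc (one_le_knotIndex h2.1 ht1.le)
        (by have := (hT.knotIndex_mem hn ht').1; omega)
    have ha0 : 0 ≤ a n t := hφ0 _ hlk
    have hw1 : w n t ≤ Kψ := hψle _ (hT.cellCoord_mem hn ht')
    refine ⟨ha0, hw1, ?_⟩
    by_cases htδ : t ≤ δ
    · have h4 := h1 t ht ht1 htδ
      have : B t = |D t| + Q := by
        simp only [hB]; rw [indicator_of_mem (show t ∈ Ioc 0 δ from ⟨ht.1, htδ⟩)]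
      rw [this]
      exact ⟨by linarith [le_abs_self (D t), h4.1], by linarith [le_abs_self (D t), h4.2]⟩
    · push Not at htδ
      have h4 := (h2.2 t ht').1
      have h5 : a n t ≤ Kφ := (le_abs_self _).trans (hKφ _ ⟨by linarith, hlk.2⟩)
      have h6 := (abs_le.1 (h3 t ⟨htδ.le, ht.2⟩)).2
      have h7 : a n t * w n t ≤ Kφ * Kψ := mul_le_mul h5 hw1 (hψ0 _) hKφ0.le
      have h8 : e n t ^ s ≤ (Kφ * Kψ + 1) ^ s :=
        Real.rpow_le_rpow (he n t) (by linarith) hs.le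
      have h9 : a n t ^ s ≤ Kφ ^ s := Real.rpow_le_rpow ha0 h5 hs.le
      have : Q ≤ B t := by
        simp only [hB]
        linarith [indicator_nonneg (s := Ioc 0 δ) (f := fun t => |D t|) (fun _ _ => abs_nonneg _) t]
      have h10 : 0 ≤ Kφ ^ s := by positivity
      have h11 : 0 ≤ (Kφ * Kψ + 1) ^ s := by positivity
      exact ⟨by linarith, by linarith⟩
  -- pointwise facts
  have hpt (t : ℝ) (ht : t ∈ Ioc (0 : ℝ) 1) : Tendsto (fun n => a n t) atTop (𝓝 (φ t)) ∧
      Tendsto (fun n => e n t - a n t * w n t) atTop (𝓝 0) ∧ ∀ᶠ n in atTop, T n 1 < t := by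
    have ht' : t ∈ Icc (0 : ℝ) 1 := ⟨ht.1.le, ht.2⟩
    refine ⟨?_, ?_, hT.eventually_first_knot_lt ht.1⟩
    · have h1 := hT.tendsto_leftKnot ht'
      have h2 : ∀ᶠ n in atTop, leftKnot n (T n) t ∈ Ioc (0 : ℝ) 1 := by
        filter_upwards [h1.eventually (lt_mem_nhds ht.1), eventually_ge_atTop 1] with n h3 hn
        exact ⟨h3, (hT.leftKnot_lt_rightKnot hn ht').le.trans (hT.rightKnot_le_one hn ht')⟩
      exact (hφ t ht).tendsto.comp (tendsto_nhdsWithin_iff.2 ⟨h1, h2⟩)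
    · rw [Metric.tendsto_nhds]
      intro ε hε
      filter_upwards [happrox t ht.1 (ε / 2) (half_pos hε)] with n hn
      rw [Real.dist_eq, sub_zero]
      exact (hn t ⟨le_rfl, ht.2⟩).trans_lt (half_lt_self hε)
  have ham (n : ℕ) : Measurable fun t => a n t ^ s := by
    have : Measurable fun t => a n t := measurable_comp_knotIndex n (T n)
      (F := fun i _ => φ (T n i)) fun _ => measurable_const
    exact this.pow_const s
  have hwm (n : ℕ) : Measurable fun t => w n t ^ s :=
    (hψ.measurable.comp (measurable_cellCoord n (T n))).pow_const s
  have hem' (n : ℕ) : AEStronglyMeasurable (fun t => e n t ^ s) μ :=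
    ((hem n).pow_const s).aestronglyMeasurable
  -- integrals over `(T n 1, 1]` as integrals of indicators
  have hind (n : ℕ) (hn : 1 ≤ n) (f : ℝ → ℝ) :
      ∫ t in Ioc (T n 1) 1, f t = ∫ t, (Ioi (T n 1)).indicator f t ∂μ := by
    rw [hμ, setIntegral_indicator measurableSet_Ioi]
    congr 2
    ext t
    have := (hT.knot_mem_Ioc le_rfl hn).1
    exact ⟨fun ht => ⟨⟨this.trans ht.1, ht.2⟩, ht.1⟩, fun ht => ⟨ht.2, ht.1.2⟩⟩
  -- limit of the step functions
  have hφlim : Tendsto (fun n => ∫ t, (Ioi (T n 1)).indicator (fun t => a n t ^ s) t ∂μ) atTop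
      (𝓝 (∫ t, φ t ^ s ∂μ)) := by
    refine tendsto_integral_filter_of_dominated_convergence B
      (Eventually.of_forall fun n => ((ham n).indicator measurableSet_Ioi).aestronglyMeasurable)
      ?_ hBint ?_
    · filter_upwards [hgood] with n hn
      filter_upwards [ae_restrict_mem measurableSet_Ioc] with t ht
      by_cases h1 : T n 1 < t
      · obtain ⟨h2, -, -, h3⟩ := hn.2 t ht h1
        rw [indicator_of_mem (show t ∈ Ioi (T n 1) from h1),
          Real.norm_of_nonneg (Real.rpow_nonneg h2 _)]
        exact h3
      · rw [indicator_of_notMem (show t ∉ Ioi (T n 1) from h1), norm_zero]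
        exact hB0 t
    · filter_upwards [ae_restrict_mem measurableSet_Ioc] with t ht
      obtain ⟨h1, -, h2⟩ := hpt t ht
      refine (h1.rpow_const (Or.inr hs.le)).congr' ?_
      filter_upwards [h2] with n hn
      exact (indicator_of_mem (show t ∈ Ioi (T n 1) from hn) (fun t => a n t ^ s)).symm
  -- The majorant of the step functions passes to their pointwise limit.
  have hφint : IntegrableOn (fun t => φ t ^ s) (Ioc 0 1) := by
    refine Integrable.mono' hBint
      ((hφ.rpow_const fun _ _ => Or.inr hs.le).aestronglyMeasurable measurableSet_Ioc) ?_
    filter_upwards [ae_restrict_mem measurableSet_Ioc] with t ht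
    obtain ⟨h1, -, h2⟩ := hpt t ht
    rw [Real.norm_of_nonneg (Real.rpow_nonneg (hφ0 t ht) _)]
    refine le_of_tendsto (h1.rpow_const (Or.inr hs.le)) ?_
    filter_upwards [hgood, h2] with n hn h3
    exact (hn.2 t ht h3).2.2.2
  have hsub (n : ℕ) (hn : 1 ≤ n) : Ioc (T n 1) 1 ⊆ Ioc (0 : ℝ) 1 :=
    Ioc_subset_Ioc (hT.knot_mem_Ioc le_rfl hn).1.le le_rfl
  have hmem (n : ℕ) (hn : 1 ≤ n) (f : ℝ → ℝ) (hf : AEStronglyMeasurable f μ) (L : ℝ)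
      (hfB : ∀ t ∈ Ioc (0 : ℝ) 1, T n 1 < t → |f t| ≤ L * B t) :
      IntegrableOn f (Ioc (T n 1) 1) := by
    refine Integrable.mono' ((hBint.mono_measure (Measure.restrict_mono_set _ (hsub n hn))).const_mul L)
      (hf.mono_measure (Measure.restrict_mono_set _ (hsub n hn))) ?_
    filter_upwards [ae_restrict_mem measurableSet_Ioc] with t ht
    exact hfB t (hsub n hn ht) ht.1
  have heint : ∀ᶠ n in atTop, IntegrableOn (fun t => e n t ^ s) (Ioc (T n 1) 1) := by
    filter_upwards [hgood] with n hn
    refine hmem n (by omega) _ (hem' n) 1 fun t ht h1 => ?_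
    rw [abs_of_nonneg (Real.rpow_nonneg (he n t) _), one_mul]
    exact (hn.2 t ht h1).2.2.1
  have hawB (n : ℕ) (hn : 2 ≤ n ∧ ∀ t ∈ Ioc (0 : ℝ) 1, T n 1 < t →
      0 ≤ a n t ∧ w n t ≤ Kψ ∧ e n t ^ s ≤ B t ∧ a n t ^ s ≤ B t) (t : ℝ)
      (ht : t ∈ Ioc (0 : ℝ) 1) (h1 : T n 1 < t) :
      |a n t ^ s * w n t ^ s| ≤ Kψ ^ s * B t := by
    obtain ⟨h2, h3, -, h4⟩ := hn.2 t ht h1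
    rw [abs_of_nonneg (mul_nonneg (Real.rpow_nonneg h2 _) (Real.rpow_nonneg (hψ0 _) _)), mul_comm]
    exact mul_le_mul (Real.rpow_le_rpow (hψ0 _) h3 hs.le) h4 (Real.rpow_nonneg h2 _)
      (Real.rpow_nonneg hKψ0 _)
  have hawint : ∀ᶠ n in atTop, IntegrableOn (fun t => a n t ^ s * w n t ^ s) (Ioc (T n 1) 1) := by
    filter_upwards [hgood] with n hn
    exact hmem n (by omega) _ ((ham n).mul (hwm n)).aestronglyMeasurable (Kψ ^ s) (hawB n hn)
  -- the error of replacing `e` by its approximation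
  have hdiff : Tendsto (fun n => ∫ t, (Ioi (T n 1)).indicator
      (fun t => e n t ^ s - a n t ^ s * w n t ^ s) t ∂μ) atTop (𝓝 (∫ _, (0 : ℝ) ∂μ)) := by
    refine tendsto_integral_filter_of_dominated_convergence (fun t => (1 + Kψ ^ s) * B t)
      (Eventually.of_forall fun n => ((hem' n).sub
        ((ham n).mul (hwm n)).aestronglyMeasurable).indicator measurableSet_Ioi)
      ?_ (hBint.const_mul _) ?_
    · filter_upwards [hgood] with n hn
      filter_upwards [ae_restrict_mem measurableSet_Ioc] with t ht
      by_cases h1 : T n 1 < t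
      · rw [indicator_of_mem (show t ∈ Ioi (T n 1) from h1)]
        refine (norm_sub_le _ _).trans ?_
        rw [Real.norm_of_nonneg (Real.rpow_nonneg (he n t) _), add_mul, one_mul]
        exact add_le_add (hn.2 t ht h1).2.2.1 (hawB n hn t ht h1)
      · rw [indicator_of_notMem (show t ∉ Ioi (T n 1) from h1), norm_zero]
        exact mul_nonneg (by positivity) (hB0 t)
    · filter_upwards [ae_restrict_mem measurableSet_Ioc] with t ht
      obtain ⟨h1, h2, h3⟩ := hpt t ht
      have h1' : ∀ᶠ n in atTop, a n t ≤ φ t + 1 :=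
        h1.eventually (ge_mem_nhds (by linarith))
      have h2' : ∀ᶠ n in atTop, e n t - a n t * w n t ≤ 1 :=
        h2.eventually (ge_mem_nhds one_pos)
      have hφt := hφ0 t ht
      have haw : ∀ᶠ n in atTop, a n t * w n t ∈ Icc 0 ((φ t + 1) * Kψ + 1) := by
        filter_upwards [hgood, h1', h3] with n h4 h5 h6
        obtain ⟨h7, h8, -⟩ := h4.2 t ht h6
        refine ⟨mul_nonneg h7 (hψ0 _), ?_⟩
        have := mul_le_mul h5 h8 (hψ0 _) (by linarith)
        linarith
      have hee : ∀ᶠ n in atTop, e n t ∈ Icc 0 ((φ t + 1) * Kψ + 1) := by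
        filter_upwards [hgood, h1', h2', h3] with n h4 h5 h6 h9
        obtain ⟨h7, h8, -⟩ := h4.2 t ht h9
        refine ⟨he n t, ?_⟩
        have := mul_le_mul h5 h8 (hψ0 _) (by linarith)
        linarith
      refine (tendsto_rpow_sub_rpow hs.le hee haw h2).congr' ?_
      filter_upwards [h3, hgood] with n hn hg
      rw [indicator_of_mem (show t ∈ Ioi (T n 1) from hn),
        Real.mul_rpow (hg.2 t ht hn).1 (hψ0 _)]
  refine ⟨hφint, heint, ?_⟩
  rw [integral_zero] at hdiff
  -- The integral of `e^s` is that of the error plus that of the approximation, and averaging over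
  -- cells turns the latter exactly into the product.
  have hlim := hdiff.add (hφlim.const_mul (∫ u in Ioc (0 : ℝ) 1, ψ u ^ s))
  rw [zero_add] at hlim
  refine hlim.congr' ?_
  filter_upwards [heint, hawint, eventually_ge_atTop 1] with n h1 h2 hn
  have hT1 : T n 1 ≤ 1 := (hT.knot_mem_Ioc le_rfl hn).2
  have h3 := hT.integral_cells hn (fun x => φ x ^ s) (hψ.rpow_const (p := s) fun _ => Or.inr hs.le)
  rw [intervalIntegral.integral_of_le hT1, intervalIntegral.integral_of_le hT1,
    intervalIntegral.integral_of_le zero_le_one] at h3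
  rw [← hind n hn, ← hind n hn, ← h3, integral_sub h1 h2]
  simp only [ha, hw]
  ring

/-- Convergence of the suprema. -/
theorem IsQRS.tendsto_iSup (hT : IsQRS h T) {e : ℕ → ℝ → ℝ} {φ ψ : ℝ → ℝ}
    (he : ∀ n t, 0 ≤ e n t) (hφ : ContinuousOn φ (Ioc 0 1))
    (hφ0 : ∀ t ∈ Ioc (0 : ℝ) 1, 0 ≤ φ t) (hψ : Continuous ψ) (hψ0 : ∀ u, 0 ≤ ψ u)
    (happrox : ∀ δ > 0, ∀ ε > 0, ∀ᶠ n in atTop, ∀ t ∈ Icc δ 1,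
      |e n t - φ (leftKnot n (T n) t) * ψ (cellCoord n (T n) t)| ≤ ε)
    (hzero : ∀ ε > 0, ∃ δ > 0, ∀ᶠ n in atTop, ∀ t ∈ Icc (0 : ℝ) 1, t ≤ δ → e n t ≤ ε)
    {Kφ : ℝ} (hKφ : ∀ t ∈ Ioc (0 : ℝ) 1, φ t ≤ Kφ) :
    Tendsto (fun n => ⨆ t ∈ Icc (0 : ℝ) 1, ‖e n t‖ₑ) atTop
      (𝓝 ((⨆ u ∈ Icc (0 : ℝ) 1, ‖ψ u‖ₑ) * ⨆ t ∈ Ioc (0 : ℝ) 1, ‖φ t‖ₑ)) := by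
  have hnorm {x : ℝ} (hx : 0 ≤ x) : ‖x‖ₑ = ENNReal.ofReal x := Real.enorm_of_nonneg hx
  set A := ⨆ u ∈ Icc (0 : ℝ) 1, ‖ψ u‖ₑ with hA
  set F := ⨆ t ∈ Ioc (0 : ℝ) 1, ‖φ t‖ₑ with hF
  have hFfin : F ≠ ∞ := by
    refine ne_top_of_le_ne_top (ENNReal.ofReal_ne_top (r := Kφ)) (iSup₂_le fun t ht => ?_)
    rw [hnorm (hφ0 t ht)]
    exact ENNReal.ofReal_le_ofReal (hKφ t ht)
  have hAfin : A ≠ ∞ := by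
    obtain ⟨K, hK⟩ := isCompact_Icc.exists_bound_of_continuousOn (hψ.continuousOn (s := Icc 0 1))
    refine ne_top_of_le_ne_top (ENNReal.ofReal_ne_top (r := K)) (iSup₂_le fun t ht => ?_)
    rw [← ofReal_norm]
    exact ENNReal.ofReal_le_ofReal (hK t ht)
  refine tendsto_order.2 ⟨fun b hb => ?_, fun b hb => ?_⟩
  · obtain ⟨u₁, hu₁, t₀, ht₀, hlt⟩ : ∃ u ∈ Icc (0 : ℝ) 1, ∃ t ∈ Ioc (0 : ℝ) 1,
        b < ‖ψ u‖ₑ * ‖φ t‖ₑ := by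
      simp only [hA, hF, ENNReal.iSup_mul, ENNReal.mul_iSup, lt_iSup_iff] at hb
      obtain ⟨t, ht, u, hu, h⟩ := hb
      exact ⟨u, hu, t, ht, h⟩
    rw [hnorm (hψ0 _), hnorm (hφ0 _ ht₀), ← ENNReal.ofReal_mul (hψ0 _),
      ENNReal.lt_ofReal_iff_toReal_lt hlt.ne_top] at hlt
    -- The coordinate `1` is avoided: a right knot below `1` is counted in the next cell, with
    -- coordinate `0`.
    obtain ⟨u₀, hu₀, hlt⟩ : ∃ u ∈ Ico (0 : ℝ) 1, b.toReal < ψ u * φ t₀ := by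
      have hopen : IsOpen {u | b.toReal < ψ u * φ t₀} :=
        isOpen_lt continuous_const (hψ.mul continuous_const)
      have hcl : u₁ ∈ closure (Ico (0 : ℝ) 1) := by rwa [closure_Ico zero_ne_one]
      obtain ⟨u, h1, h2⟩ := mem_closure_iff.1 hcl _ hopen hlt
      exact ⟨u, h2, h1⟩
    have ht₀' : t₀ ∈ Icc (0 : ℝ) 1 := ⟨ht₀.1.le, ht₀.2⟩
    set ε := (ψ u₀ * φ t₀ - b.toReal) / 2 with hε
    have hε0 : 0 < ε := by linarith
    have hlk := hT.tendsto_leftKnot ht₀'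
    have hmem : ∀ᶠ n in atTop, t₀ / 2 < leftKnot n (T n) t₀ :=
      hlk.eventually (lt_mem_nhds (by linarith [ht₀.1]))
    have hle1 : ∀ᶠ n in atTop, leftKnot n (T n) t₀ ∈ Ioc (0 : ℝ) 1 := by
      filter_upwards [hmem, eventually_ge_atTop 1] with n h3 hn
      exact ⟨by linarith [ht₀.1],
        (hT.leftKnot_lt_rightKnot hn ht₀').le.trans (hT.rightKnot_le_one hn ht₀')⟩
    have hφl : Tendsto (fun n => φ (leftKnot n (T n) t₀) * ψ u₀) atTop (𝓝 (φ t₀ * ψ u₀)) :=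
      ((hφ t₀ ht₀).tendsto.comp (tendsto_nhdsWithin_iff.2 ⟨hlk, hle1⟩)).mul_const _
    filter_upwards [happrox (t₀ / 2) (by linarith [ht₀.1]) ε hε0, hmem, eventually_ge_atTop 1,
      hφl.eventually (lt_mem_nhds (show φ t₀ * ψ u₀ - ε < φ t₀ * ψ u₀ by linarith))]
      with n h1 h2 hn h3
    set x := leftKnot n (T n) t₀ with hx
    set y := rightKnot n (T n) t₀ with hy
    have hxy : x < y := hT.leftKnot_lt_rightKnot hn ht₀'
    have hy1 : y ≤ 1 := hT.rightKnot_le_one hn ht₀'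
    -- In the cell of `t₀`, the point whose coordinate is the nearly optimal `u₀`. The approximation
    -- there involves the left knot of `t₀`, where `φ` is close to `φ t₀`.
    set t := x + u₀ * (y - x) with ht
    have htxy : t ∈ Ico x y := by
      constructor
      · nlinarith [hu₀.1]
      · nlinarith [hu₀.2]
    have hidx : knotIndex n (T n) t = knotIndex n (T n) t₀ :=
      hT.knotIndex_eq (hT.knotIndex_mem hn ht₀').1 htxy
    have hl : leftKnot n (T n) t = x := by rw [leftKnot, hidx]; rfl
    have hc : cellCoord n (T n) t = u₀ := by
      rw [cellCoord, rightKnot, hl, hidx, ht]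
      have : T n (knotIndex n (T n) t₀ + 1) = y := rfl
      rw [this, add_sub_cancel_left, mul_div_assoc, div_self (by linarith), mul_one]
    have h4 := h1 t ⟨by linarith [htxy.1], by linarith [htxy.2]⟩
    rw [hl, hc] at h4
    have h5 := (abs_le.1 h4).1
    have h6 : b.toReal < e n t := by nlinarith
    have h7 : b < ‖e n t‖ₑ := by
      rwa [hnorm (he n t), ENNReal.lt_ofReal_iff_toReal_lt (ne_top_of_lt hb)]
    exact h7.trans_le (le_iSup₂_of_le t
      ⟨by linarith [htxy.1, ht₀.1], by linarith [htxy.2]⟩ le_rfl)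
  · obtain ⟨ε, hε0, hεb⟩ : ∃ ε : ℝ, 0 < ε ∧ A * F + ENNReal.ofReal ε < b := by
      have hAF : A * F ≠ ∞ := ENNReal.mul_ne_top hAfin hFfin
      obtain ⟨z, hz, hz'⟩ := ENNReal.lt_iff_exists_add_pos_lt.1 hb
      exact ⟨z, hz, by simpa using hz'⟩
    obtain ⟨δ, hδ, hz⟩ := hzero ε hε0
    filter_upwards [hz, happrox δ hδ ε hε0, hT.eventually_leftKnot hδ] with n h1 h2 h3
    refine lt_of_le_of_lt (iSup₂_le fun t ht => ?_) hεb
    rw [hnorm (he n t)]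
    by_cases htδ : t ≤ δ
    · exact (ENNReal.ofReal_le_ofReal (h1 t ht htδ)).trans le_add_self
    · push Not at htδ
      have hn : 1 ≤ n := by omega
      have h4 := (abs_le.1 (h2 t ⟨htδ.le, ht.2⟩)).2
      have hlk : leftKnot n (T n) t ∈ Ioc (0 : ℝ) 1 :=
        ⟨by linarith [(h3.2 t ht).1],
          (hT.leftKnot_lt_rightKnot hn ht).le.trans (hT.rightKnot_le_one hn ht)⟩
      calc ENNReal.ofReal (e n t) ≤
          ENNReal.ofReal (ψ (cellCoord n (T n) t) * φ (leftKnot n (T n) t) + ε) :=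
            ENNReal.ofReal_le_ofReal (by linarith)
        _ = ‖ψ (cellCoord n (T n) t)‖ₑ * ‖φ (leftKnot n (T n) t)‖ₑ + ENNReal.ofReal ε := by
            rw [ENNReal.ofReal_add (mul_nonneg (hψ0 _) (hφ0 _ hlk)) hε0.le,
              ENNReal.ofReal_mul (hψ0 _), hnorm (hψ0 _), hnorm (hφ0 _ hlk)]
        _ ≤ A * F + ENNReal.ofReal ε := by
            gcongr
            · exact le_iSup₂_of_le (f := fun u (_ : u ∈ Icc (0 : ℝ) 1) => ‖ψ u‖ₑ) _
                (hT.cellCoord_mem hn ht) le_rfl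
            · exact le_iSup₂_of_le (f := fun u (_ : u ∈ Ioc (0 : ℝ) 1) => ‖φ u‖ₑ) _ hlk le_rfl

end Cells

/-! ## The scaled error of spline approximation -/

section ScaledError

section Basic

variable {E : Type*} [NormedAddCommGroup E] [NormedSpace ℝ E]

/-- The error of the composite spline at `t`, multiplied by `n^κ`. -/
def scaledError (κ : ℝ) (q k : ℕ) (T : ℕ → ℕ → ℝ) (X : ℝ → E) (n : ℕ) (t : ℝ) : ℝ :=
  (n : ℝ) ^ κ * ‖X t - compositeSpline q k n (T n) X t‖

variable {κ : ℝ} {q k : ℕ} {h : ℝ → ℝ} {T : ℕ → ℕ → ℝ} {X : ℝ → E}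

theorem scaledError_nonneg (n : ℕ) (t : ℝ) : 0 ≤ scaledError κ q k T X n t := by
  unfold scaledError; positivity

theorem compositeSpline_of_lt {n : ℕ} {T : ℕ → ℝ} {t : ℝ} (ht : T 1 < t) :
    compositeSpline q k n T X t =
      hermitePiece ((k - 1) / 2) X (leftKnot n T t) (rightKnot n T t) t := by
  rw [compositeSpline, if_neg (not_le.2 ht)]
  rfl

theorem compositeSpline_of_le {n : ℕ} {T : ℕ → ℝ} {t : ℝ} (ht : t ≤ T 1) :
    compositeSpline q k n T X t =
      hermitePiece ((q - 1) / 2) X (leftKnot n T t) (rightKnot n T t) t := by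
  rw [compositeSpline, if_pos ht]
  rfl

theorem continuous_hermitePiece (r : ℕ) (X : ℝ → E) (a b : ℝ) :
    Continuous (hermitePiece r X a b) := by
  unfold hermitePiece
  refine continuous_finsetSum _ fun j _ => Continuous.const_smul (Continuous.add ?_ ?_) _
  · exact ((hermitePoly r (Pi.single j 1) 0).continuous.comp (by fun_prop)).smul continuous_const
  · exact ((hermitePoly r 0 (Pi.single j 1)).continuous.comp (by fun_prop)).smul continuous_const

theorem aemeasurable_scaledError (hX : ContinuousOn X (Icc 0 1)) (n : ℕ) :
    AEMeasurable (scaledError κ q k T X n) (volume.restrict (Ioc 0 1)) := by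
  -- `X` is controlled only on `[0,1]`. Extended by constants it is continuous, and the error is a
  -- continuous expression for each value of the cell index.
  set Y : ℝ → E := fun t => X (projIcc 0 1 zero_le_one t) with hY
  have hYc : Continuous Y := hX.comp_continuous
    (continuous_subtype_val.comp continuous_projIcc) fun t => Subtype.property _
  have hm (r : ℕ) : Measurable fun t =>
      ‖Y t - hermitePiece r X (leftKnot n (T n) t) (rightKnot n (T n) t) t‖ :=
    measurable_comp_knotIndex n (T n)
      (F := fun i t => ‖Y t - hermitePiece r X (T n i) (T n (i + 1)) t‖)
      fun i => (hYc.sub (continuous_hermitePiece r X _ _)).norm.measurable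
  have hm2 : Measurable fun t => (n : ℝ) ^ κ * if t ≤ T n 1 then
      ‖Y t - hermitePiece ((q - 1) / 2) X (leftKnot n (T n) t) (rightKnot n (T n) t) t‖ else
      ‖Y t - hermitePiece ((k - 1) / 2) X (leftKnot n (T n) t) (rightKnot n (T n) t) t‖ :=
    (Measurable.ite measurableSet_Iic (hm _) (hm _)).const_mul _
  refine hm2.aemeasurable.congr ?_
  filter_upwards [ae_restrict_mem measurableSet_Ioc] with t ht
  have hYt : Y t = X t := by
    simp only [hY]; rw [projIcc_of_mem _ ⟨ht.1.le, ht.2⟩]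
  simp only [scaledError, hYt]
  congr 1
  by_cases h1 : t ≤ T n 1
  · rw [if_pos h1, compositeSpline_of_le h1]
  · rw [if_neg h1, compositeSpline_of_lt (not_le.1 h1)]

theorem hermitePiece_left (r : ℕ) (X : ℝ → E) {a b : ℝ} (hab : a < b) :
    hermitePiece r X a b a = X a := by
  simpa [deriv01] using (hermitePiece_spec r X hab (Nat.zero_le r)).1

/-- The error in the first cell. -/
theorem LocallyHolder.exists_scaledError_le [CompleteSpace E] {l : ℕ} {α M : ℝ}
    (hX : LocallyHolder l α (fun _ => M) 0 1 X) (hlq : (q - 1) / 2 ≤ l)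
    (hql : l ≤ 2 * ((q - 1) / 2) + 1) (hT : IsQRS h T) (κ : ℝ) (k : ℕ) :
    ∃ K ≥ 0, ∀ n ≥ 2, ∀ t ∈ Icc 0 (T n 1),
      scaledError κ q k T X n t ≤ K * ((n : ℝ) ^ κ * T n 1 ^ ((l : ℝ) + α)) := by
  obtain ⟨K, hK0, hK⟩ := exists_remainderFunctional_bound l ((q - 1) / 2)
  refine ⟨K * √M, by positivity, fun n hn t ht => ?_⟩
  have h1 := hT.knot_mem_Ioc (n := n) le_rfl (by omega)
  have h0 := hT.knot_zero n (by omega)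
  have ht1 : t ∈ Icc (0 : ℝ) 1 := ⟨ht.1, ht.2.trans h1.2⟩
  rw [scaledError, compositeSpline_of_le ht.2, mul_left_comm]
  refine mul_le_mul_of_nonneg_left ?_ (by positivity)
  -- At `t = T n 1` the branch of degree `q` is in force, but the cell index is already `1`. The
  -- piece used is the one on the second cell, which interpolates at its left end, so the error is
  -- zero.
  rcases ht.2.eq_or_lt with he | hlt
  · have hidx : knotIndex n (T n) t = 1 := by
      refine hT.knotIndex_eq (by omega) ⟨he.symm.le, ?_⟩
      rw [he]
      exact hT.knot_lt (by omega) (by omega) (by omega)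
    have hl : leftKnot n (T n) t = t := by rw [leftKnot, hidx, he]
    have h2 := hT.leftKnot_lt_rightKnot (n := n) (by omega) ht1
    rw [hl] at h2 ⊢
    rw [hermitePiece_left _ _ h2, sub_self, norm_zero]
    have := h1.1
    positivity
  · have hidx : knotIndex n (T n) t = 0 :=
      hT.knotIndex_eq (by omega) ⟨by rw [h0]; exact ht.1, by simpa using hlt⟩
    rw [leftKnot, rightKnot, hidx, zero_add, h0]
    have hsub : Icc 0 (T n 1) ⊆ Icc (0 : ℝ) 1 := Icc_subset_Icc le_rfl h1.2
    have key := norm_sub_hermitePiece_le hlq hql (fun u hu W ε hW => hK u hu W ε hW) h1.1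
      (A := √M) (β := α) (hX.derivChain_deriv01.mono hsub) (fun s hs => by
        obtain ⟨w, -, hw⟩ := hX.bound 0 (by simp) s (hsub hs)
        refine hw.trans (mul_le_mul_of_nonneg_left ?_ (Real.sqrt_nonneg _))
        refine Real.rpow_le_rpow (abs_nonneg _) ?_ hX.exponent_pos.le
        rw [sub_zero, sub_zero, abs_of_nonneg hs.1]
        exact hs.2) ht
    rwa [sub_zero] at key

end Basic

/-! ### Error bounds in the cells other than the first -/

section CellBound

variable {h : ℝ → ℝ} {T : ℕ → ℕ → ℝ} (hT : IsQRS h T)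
include hT

/-- In the cells other than the first, the distribution function is constant up to a factor `2`. -/
theorem IsQRS.distrib_le_two_mul {n : ℕ} (hn : 2 ≤ n) {t : ℝ} (ht : t ∈ Icc (0 : ℝ) 1)
    (ht1 : T n 1 < t) : ∀ w ∈ Icc (leftKnot n (T n) t) (rightKnot n (T n) t),
      w ∈ Ioc (0 : ℝ) 1 ∧ ∀ w' ∈ Icc (leftKnot n (T n) t) (rightKnot n (T n) t),
        distrib h w ≤ 2 * distrib h w' := by
  have hi1 := one_le_knotIndex hn ht1.le
  have hi2 := (hT.knotIndex_mem (n := n) (by omega) ht).1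
  have hl : leftKnot n (T n) t ∈ Ioc (0 : ℝ) 1 := hT.knot_mem_Ioc hi1 (by omega)
  have hr : rightKnot n (T n) t ∈ Ioc (0 : ℝ) 1 := hT.knot_mem_Ioc (by omega) hi2
  have hmem : ∀ w ∈ Icc (leftKnot n (T n) t) (rightKnot n (T n) t), w ∈ Icc (0 : ℝ) 1 :=
    fun w hw => ⟨hl.1.le.trans hw.1, hw.2.trans hr.2⟩
  have hmono := hT.density.strictMonoOn_distrib.monotoneOn
  refine fun w hw => ⟨⟨hl.1.trans_le hw.1, hw.2.trans hr.2⟩, fun w' hw' => ?_⟩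
  have e1 := hmono (hmem w hw) ⟨hr.1.le, hr.2⟩ hw.2
  have e2 := hmono ⟨hl.1.le, hl.2⟩ (hmem w' hw') hw'.1
  rw [rightKnot, hT.knot n (by omega) _ hi2] at e1
  rw [leftKnot, hT.knot n (by omega) _ (by omega)] at e2
  have hn0 : (0 : ℝ) < n := by positivity
  -- At the two knots `H` equals `i/n` and `(i+1)/n`, and `i ≥ 1` outside the first cell.
  have e3 : ((knotIndex n (T n) t + 1 : ℕ) : ℝ) / n ≤ 2 * ((knotIndex n (T n) t : ℕ) / n) := by
    rw [mul_div_assoc']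
    gcongr
    have : (1 : ℝ) ≤ (knotIndex n (T n) t : ℕ) := by exact_mod_cast hi1
    push_cast
    linarith
  linarith

theorem IsQRS.exists_cell_spacing {n : ℕ} (hn : 1 ≤ n) {t : ℝ} (ht : t ∈ Icc (0 : ℝ) 1) :
    ∃ ξ ∈ Icc (leftKnot n (T n) t) (rightKnot n (T n) t),
      n * (rightKnot n (T n) t - leftKnot n (T n) t) = (h ξ)⁻¹ := by
  obtain ⟨ξ, hξ, he⟩ := hT.exists_spacing (hT.knotIndex_mem hn ht).1
  exact ⟨ξ, Ioo_subset_Icc_self hξ, he⟩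

variable {E : Type*} [NormedAddCommGroup E] [NormedSpace ℝ E] [CompleteSpace E]

/-- The error in a cell that is not the first one, in terms of the local Hölder function. -/
theorem LocallyHolderStationary.scaledError_le {m q k : ℕ} {β : ℝ} {c V : ℝ → ℝ} {X : ℝ → E}
    (hX : LocallyHolderStationary m β c V X) (hβ : 0 < β) (hrm : (k - 1) / 2 ≤ m)
    (hmr : m ≤ 2 * ((k - 1) / 2) + 1) {K : ℝ}
    (hK : ∀ u ∈ Icc (0 : ℝ) 1, ∀ (W : ℝ → E) (ε : ℝ), (∀ x ∈ Icc (0 : ℝ) 1, ‖W x‖ ≤ ε) →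
      ‖remainderFunctional m ((k - 1) / 2) u W‖ ≤ K * ε)
    {r : ℝ → ℝ} {a Kr : ℝ} (hr : ∀ x ∈ Ioc (0 : ℝ) a, ∀ y ∈ Ioc (0 : ℝ) a, x ≤ 2 * y → y ≤ 2 * x →
      r x ≤ Kr * r y) (hKr : 0 < Kr) (hr0 : ∀ x ∈ Ioc (0 : ℝ) a, 0 < r x)
    (hg : ∀ s ∈ Ioc (0 : ℝ) a, quantileDensity h s ≤ r s) {n : ℕ} (hn : 2 ≤ n) {t : ℝ}
    (ht : t ∈ Icc (0 : ℝ) 1) (ht1 : T n 1 < t) (hta : 2 * distrib h t ≤ a) {A : ℝ}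
    (hA : ∀ w ∈ Icc (leftKnot n (T n) t) (rightKnot n (T n) t),
      √(V w) * r (distrib h w) ^ ((m : ℝ) + β) ≤ A) :
    scaledError ((m : ℝ) + β) q k T X n t ≤ K * (Kr ^ ((m : ℝ) + β) * A) := by
  have hn1 : 1 ≤ n := by omega
  set κ := (m : ℝ) + β with hκ
  have hκ0 : 0 < κ := by positivity
  have hcell := hT.distrib_le_two_mul hn ht ht1
  have htc := hT.mem_cell hn1 ht
  have hlr := hT.leftKnot_lt_rightKnot hn1 ht
  obtain ⟨ξ, hξ, hsp⟩ := hT.exists_cell_spacing hn1 ht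
  set x := leftKnot n (T n) t
  set y := rightKnot n (T n) t
  have hpos : 0 < y - x := sub_pos.2 hlr
  have hH (w : ℝ) (hw : w ∈ Icc x y) : distrib h w ∈ Ioc (0 : ℝ) a :=
    ⟨hT.density.distrib_pos (hcell w hw).1, ((hcell w hw).2 t htc).trans hta⟩
  have hξ1 := (hcell ξ hξ).1
  -- The scaled length is `1/h(ξ) = g(H(ξ)) ≤ r(H(ξ))`; comparability of `r` moves `ξ` to any `w` in
  -- the cell.
  have hspr (w : ℝ) (hw : w ∈ Icc x y) : n * (y - x) ≤ Kr * r (distrib h w) := by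
    have h2 := hg _ (hH ξ hξ)
    rw [quantileDensity, hT.density.quantile_distrib ⟨hξ1.1.le, hξ1.2⟩, one_div, ← hsp] at h2
    exact h2.trans (hr _ (hH ξ hξ) _ (hH w hw) ((hcell ξ hξ).2 w hw) ((hcell w hw).2 ξ hξ))
  have hn0 : (0 : ℝ) < n := by positivity
  have hsp0 : 0 < (n : ℝ) * (y - x) := by positivity
  have hspκ : 0 < ((n : ℝ) * (y - x)) ^ κ := Real.rpow_pos_of_pos hsp0 _
  -- A bound of `√V` on the cell, chosen so that the power of the scaled length in the error
  -- estimate cancels.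
  set A' := Kr ^ κ * A / ((n : ℝ) * (y - x)) ^ κ with hA'
  have hVA (w : ℝ) (hw : w ∈ Icc x y) : √(V w) ≤ A' := by
    rw [hA', le_div_iff₀ hspκ]
    have h3 : ((n : ℝ) * (y - x)) ^ κ ≤ Kr ^ κ * r (distrib h w) ^ κ := by
      rw [← Real.mul_rpow hKr.le (hr0 _ (hH w hw)).le]
      exact Real.rpow_le_rpow hsp0.le (hspr w hw) hκ0.le
    calc √(V w) * ((n : ℝ) * (y - x)) ^ κ ≤ √(V w) * (Kr ^ κ * r (distrib h w) ^ κ) :=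
          mul_le_mul_of_nonneg_left h3 (Real.sqrt_nonneg _)
      _ = Kr ^ κ * (√(V w) * r (distrib h w) ^ κ) := by ring
      _ ≤ Kr ^ κ * A := mul_le_mul_of_nonneg_left (hA w hw) (by positivity)
  have hxm : x ∈ Icc x y := left_mem_Icc.2 hlr.le
  have hA'0 : 0 ≤ A' := (Real.sqrt_nonneg _).trans (hVA x hxm)
  have hx1 := (hcell x hxm).1
  have hy1 := (hcell y (right_mem_Icc.2 hlr.le)).1
  have key := norm_sub_hermitePiece_le hrm hmr hK hlr (A := A') (β := β)
    (hX.derivChain hx1.1 hlr.le hy1.2) (fun s hs => by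
      obtain ⟨w, hw, hle⟩ := hX.exists_holder (hcell s hs).1 hx1
      rw [uIcc_of_le hs.1] at hw
      refine hle.trans (mul_le_mul (hVA w ⟨hw.1, hw.2.trans hs.2⟩) ?_
        (Real.rpow_nonneg (abs_nonneg _) _) hA'0)
      refine Real.rpow_le_rpow (abs_nonneg _) ?_ hβ.le
      rw [abs_of_nonneg (sub_nonneg.2 hs.1)]
      linarith [hs.2]) htc
  rw [scaledError, compositeSpline_of_lt ht1]
  calc (n : ℝ) ^ κ * _ ≤ (n : ℝ) ^ κ * (K * A' * (y - x) ^ κ) :=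
        mul_le_mul_of_nonneg_left key (by positivity)
    _ = K * (A' * ((n : ℝ) * (y - x)) ^ κ) := by
        rw [Real.mul_rpow hn0.le hpos.le]; ring
    _ = K * (Kr ^ κ * A) := by rw [hA', div_mul_cancel₀ _ hspκ.ne']

end CellBound

/-! ### Uniform approximation of the scaled error away from `0` -/

section Approximation

variable {E : Type*} [NormedAddCommGroup E] [InnerProductSpace ℝ E]

/-- Local stationarity in the form needed for Gram kernels: squared increments, with `c` frozen at
one point `a` for all pairs in a short interval. -/
theorem LocallyHolderStationary.exists_norm_sq_stationary {m : ℕ} {β : ℝ} {c V : ℝ → ℝ} {X : ℝ → E}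
    (hX : LocallyHolderStationary m β c V X) {δ ε : ℝ} (hδ0 : 0 < δ) (hδ1 : δ ≤ 1) (hε : 0 < ε) :
    ∃ η > 0, ∀ s ∈ Icc δ 1, ∀ t ∈ Icc δ 1, ∀ a ∈ Icc δ 1, |s - t| < η → |t - a| < η →
      |‖deriv01 m X s - deriv01 m X t‖ ^ 2 - c a * |s - t| ^ (2 * β)| ≤ ε * |s - t| ^ (2 * β) := by
  obtain ⟨K, hK0, hK⟩ := exists_bound_Icc_one (φ := fun t => √(c t)) hX.continuousOn.1.sqrt hδ0
  -- In `z² - v²y² = (z - vy)(z + vy)` the first factor is at most `ε₁ y` and, as `ε₁ ≤ 1`, the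
  -- second at most `(1 + 2K) y`. The other half of `ε` pays for freezing `c`.
  set ε₁ := min 1 (ε / 2 / (2 * K + 1)) with hε₁
  have hε₁0 : 0 < ε₁ := by positivity
  have hε₁1 : ε₁ ≤ 1 := min_le_left _ _
  have hε₁2 : (2 * K + 1) * ε₁ ≤ ε / 2 := by
    rw [mul_comm, ← le_div_iff₀ (by positivity)]; exact min_le_right _ _
  obtain ⟨η₁, hη₁, h1⟩ := hX.exists_stationary hδ0 hδ1 hε₁0
  have hu := isCompact_Icc.uniformContinuousOn_of_continuous
    (hX.continuousOn.1.mono fun t (ht : t ∈ Icc δ 1) => ⟨hδ0.trans_le ht.1, ht.2⟩)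
  obtain ⟨η₂, hη₂, h2⟩ := Metric.uniformContinuousOn_iff.1 hu (ε / 2) (half_pos hε)
  refine ⟨min η₁ η₂, lt_min hη₁ hη₂, fun s hs t ht a ha hst hta => ?_⟩
  have e1 := h1 s hs t ht (hst.trans_le (min_le_left _ _))
  have e2 := h2 t ht a ha (by rw [Real.dist_eq]; exact hta.trans_le (min_le_right _ _))
  rw [Real.dist_eq] at e2
  set y := |s - t| ^ β with hy
  have hy0 : 0 ≤ y := Real.rpow_nonneg (abs_nonneg _) _
  have hy2 : |s - t| ^ (2 * β) = y ^ 2 := by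
    rw [hy, ← Real.rpow_natCast, ← Real.rpow_mul (abs_nonneg _)]
    congr 1; push_cast; ring
  rw [hy2]
  set z := ‖deriv01 m X s - deriv01 m X t‖
  set v := √(c t) with hv
  have hv2 : c t = v ^ 2 := (Real.sq_sqrt (hX.pos ⟨hδ0.trans_le ht.1, ht.2⟩).1.le).symm
  have hv0 : 0 ≤ v := Real.sqrt_nonneg _
  have hvK : v ≤ K := (le_abs_self _).trans (hK t ht)
  have e3 : |z ^ 2 - v ^ 2 * y ^ 2| ≤ ε / 2 * y ^ 2 := by
    have : z ^ 2 - v ^ 2 * y ^ 2 = (z - v * y) * ((z - v * y) + 2 * v * y) := by ring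
    rw [this, abs_mul]
    have e4 : |(z - v * y) + 2 * v * y| ≤ (1 + 2 * K) * y := by
      refine (abs_add_le _ _).trans ?_
      rw [abs_of_nonneg (by positivity : 0 ≤ 2 * v * y)]
      nlinarith
    calc _ ≤ ε₁ * y * ((1 + 2 * K) * y) := mul_le_mul e1 e4 (abs_nonneg _) (by positivity)
      _ = (2 * K + 1) * ε₁ * y ^ 2 := by ring
      _ ≤ _ := mul_le_mul_of_nonneg_right hε₁2 (sq_nonneg _)
  have e5 : |c t - c a| * y ^ 2 ≤ ε / 2 * y ^ 2 := mul_le_mul_of_nonneg_right e2.le (sq_nonneg _)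
  have e6 : z ^ 2 - c a * y ^ 2 = (z ^ 2 - v ^ 2 * y ^ 2) + (c t - c a) * y ^ 2 := by
    rw [hv2]; ring
  rw [e6]
  refine (abs_add_le _ _).trans ?_
  rw [abs_mul, abs_of_nonneg (sq_nonneg y)]
  linarith

/-- For nonnegative numbers `|x - y| ≤ x + y`, so roots can be compared without a lower bound. This
matters because the limiting error vanishes at the knots. -/
theorem abs_sub_le_of_abs_sq_sub_sq_le {x y ε : ℝ} (hx : 0 ≤ x) (hy : 0 ≤ y) (hε : 0 ≤ ε)
    (h : |x ^ 2 - y ^ 2| ≤ ε ^ 2) : |x - y| ≤ ε := by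
  refine abs_le_of_sq_le_sq (le_trans ?_ h) hε
  have h1 : x ^ 2 - y ^ 2 = (x - y) * (x + y) := by ring
  rw [h1, abs_mul, ← sq_abs, sq, abs_of_nonneg (add_nonneg hx hy)]
  exact mul_le_mul_of_nonneg_left (abs_le.2 ⟨by linarith, by linarith⟩) (abs_nonneg _)

/-- Away from `0`, the scaled error is close to the error for a locally rescaled integrated
fractional Brownian motion. -/
theorem LocallyHolderStationary.eventually_scaledError_approx [CompleteSpace E] {m q k : ℕ} {β : ℝ}
    {c V h : ℝ → ℝ} {T : ℕ → ℕ → ℝ} {X : ℝ → E} (hX : LocallyHolderStationary m β c V X)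
    (h0 : 0 < β) (h1 : β < 1) (hrm : (k - 1) / 2 ≤ m) (hmr : m ≤ 2 * ((k - 1) / 2) + 1)
    (hT : IsQRS h T) {δ ε : ℝ} (hδ : 0 < δ) (hε : 0 < ε) :
    ∀ᶠ n in atTop, ∀ t ∈ Icc δ 1, |scaledError ((m : ℝ) + β) q k T X n t -
      √(c (leftKnot n (T n) t)) * h (leftKnot n (T n) t) ^ (-((m : ℝ) + β)) *
        ‖remainderFunctional m ((k - 1) / 2) (cellCoord n (T n) t) (fbm β)‖| ≤ ε := by
  rcases lt_or_ge 1 δ with hδ1 | hδ1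
  · exact Eventually.of_forall fun n t ht => absurd (ht.1.trans ht.2) (not_le.2 hδ1)
  set κ := (m : ℝ) + β with hκ
  set r := (k - 1) / 2 with hr
  have hδ2 : 0 < δ / 2 := half_pos hδ
  obtain ⟨K, hK0, hK⟩ := exists_remainderFunctional_bound m r
  set f : ℝ → ℝ := fun t => (h t ^ (-κ)) ^ 2 with hf
  have hfc : ContinuousOn f (Ioc 0 1) :=
    (hT.density.continuousOn.rpow_const fun t ht => Or.inl (hT.density.pos t ht).ne').pow 2
  obtain ⟨Kf, hKf0, hKf⟩ := exists_bound_Icc_one hfc hδ2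
  obtain ⟨Kc, hKc0, hKc⟩ := exists_bound_Icc_one hX.continuousOn.1 hδ2
  obtain ⟨Kψ, hKψ⟩ := isCompact_Icc.exists_bound_of_continuousOn
    ((continuous_remainderFunctional m r (continuous_fbm h0 h1)).continuousOn (s := Icc 0 1))
  -- The budget `ε²` for squares is split evenly: `ε₂` serves the covariance comparison, `ε₃` the
  -- replacement of `h(ξ)` by `h` at the left knot.
  set ε₂ := ε ^ 2 / 2 / (Kf * (2 * K ^ 2)) with hε₂
  have hε₂0 : 0 < ε₂ := by positivity
  set ε₃ := ε ^ 2 / 2 / (Kc * (Kψ ^ 2 + 1)) with hε₃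
  have hε₃0 : 0 < ε₃ := by positivity
  obtain ⟨η₁, hη₁, hstat⟩ := hX.exists_norm_sq_stationary hδ2 (by linarith) hε₂0
  have hu := isCompact_Icc.uniformContinuousOn_of_continuous
    (hfc.mono fun t (ht : t ∈ Icc (δ / 2) 1) => ⟨hδ2.trans_le ht.1, ht.2⟩)
  obtain ⟨η₂, hη₂, hunif⟩ := Metric.uniformContinuousOn_iff.1 hu ε₃ hε₃0
  filter_upwards [hT.eventually_leftKnot (lt_min hδ2 (lt_min hη₁ hη₂)),
    hT.eventually_first_knot_lt hδ] with n hn hfirst t ht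
  have hn1 : 1 ≤ n := by omega
  have ht' : t ∈ Icc (0 : ℝ) 1 := ⟨hδ.le.trans ht.1, ht.2⟩
  obtain ⟨hlk, hmesh⟩ := hn.2 t ht'
  have htc := hT.mem_cell hn1 ht'
  have hlr := hT.leftKnot_lt_rightKnot hn1 ht'
  have hr1 := hT.rightKnot_le_one hn1 ht'
  obtain ⟨ξ, hξ, hsp⟩ := hT.exists_cell_spacing hn1 ht'
  have huc := hT.cellCoord_mem hn1 ht'
  rw [scaledError, compositeSpline_of_lt (hfirst.trans_le ht.1)]
  have hcc : cellCoord n (T n) t =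
    (t - leftKnot n (T n) t) / (rightKnot n (T n) t - leftKnot n (T n) t) := rfl
  set a := leftKnot n (T n) t with ha
  set b := rightKnot n (T n) t with hb
  have hm1 : min (δ / 2) (min η₁ η₂) ≤ δ / 2 := min_le_left _ _
  have hm2 : min (δ / 2) (min η₁ η₂) ≤ η₁ := (min_le_right _ _).trans (min_le_left _ _)
  have hm3 : min (δ / 2) (min η₁ η₂) ≤ η₂ := (min_le_right _ _).trans (min_le_right _ _)
  have hsub : Icc a b ⊆ Icc (δ / 2) 1 := Icc_subset_Icc (by linarith [ht.1]) hr1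
  have haI : a ∈ Icc a b := left_mem_Icc.2 hlr.le
  have hab (s v : ℝ) (hs : s ∈ Icc a b) (hv : v ∈ Icc a b) : |s - v| ≤ b - a :=
    abs_le.2 ⟨by linarith [hs.1, hv.2], by linarith [hs.2, hv.1]⟩
  have hba : 0 < b - a := sub_pos.2 hlr
  have ha0 : 0 < a := hδ2.trans_le (hsub haI).1
  have key := abs_norm_sq_sub_hermitePiece_sub_le hrm hmr (fun u hu W ε hW => hK u hu W ε hW) h0 h1
    hlr (σ := c a) (ε := ε₂) (hX.derivChain ha0 hlr.le hr1) (fun s hs v hv => by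
      refine (hstat s (hsub hs) v (hsub hv) a (hsub haI) (by linarith [hab s v hs hv])
        (by linarith [hab v a hv haI])).trans ?_
      refine mul_le_mul_of_nonneg_left ?_ hε₂0.le
      exact Real.rpow_le_rpow (abs_nonneg _) (hab s v hs hv) (by positivity)) htc
  rw [← hcc] at key
  have hψK := hKψ _ huc
  set ψ := ‖remainderFunctional m r (cellCoord n (T n) t) (fbm β)‖
  set e := ‖X t - hermitePiece r X a b t‖
  have hn0 : (0 : ℝ) < n := by positivity
  -- An exact identity, since `n(b-a) = 1/h(ξ)`.
  have hfξ : ((n : ℝ) ^ κ) ^ 2 * (b - a) ^ (2 * κ) = f ξ := by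
    have hξ0 : 0 < h ξ := hT.density.pos ξ ⟨ha0.trans_le hξ.1, hξ.2.trans hr1⟩
    have h2 : (b - a) ^ (2 * κ) = ((b - a) ^ κ) ^ 2 := by
      rw [← Real.rpow_natCast, ← Real.rpow_mul hba.le]; congr 1; push_cast; ring
    rw [h2, ← mul_pow, ← Real.mul_rpow hn0.le hba.le, hsp, Real.inv_rpow hξ0.le,
      ← Real.rpow_neg hξ0.le]
  have hca : c a = √(c a) ^ 2 := (Real.sq_sqrt (hX.pos ⟨ha0, by linarith⟩).1.le).symm
  have hfξK : f ξ ≤ Kf := (le_abs_self _).trans (hKf ξ (hsub hξ))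
  have hcK : c a ≤ Kc := (le_abs_self _).trans (hKc a (hsub haI))
  have hc0 : 0 < c a := (hX.pos ⟨ha0, by linarith⟩).1
  have e1 : |((n : ℝ) ^ κ * e) ^ 2 - f ξ * (c a * ψ ^ 2)| ≤ ε ^ 2 / 2 := by
    have := mul_le_mul_of_nonneg_left key (sq_nonneg ((n : ℝ) ^ κ))
    rw [← abs_of_nonneg (sq_nonneg ((n : ℝ) ^ κ)), ← abs_mul,
      abs_of_nonneg (sq_nonneg ((n : ℝ) ^ κ)), mul_sub, ← mul_assoc, ← mul_assoc, hfξ,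
      ← mul_pow] at this
    rw [← mul_assoc (f ξ)]
    refine this.trans ?_
    rw [← mul_assoc, hfξ]
    calc f ξ * (2 * K ^ 2 * ε₂) ≤ Kf * (2 * K ^ 2 * ε₂) :=
          mul_le_mul_of_nonneg_right hfξK (by positivity)
      _ = ε ^ 2 / 2 := by rw [hε₂]; field_simp
  have e2 : |f ξ - f a| ≤ ε₃ := by
    have := hunif ξ (hsub hξ) a (hsub haI) (by
      rw [Real.dist_eq]; linarith [hab ξ a hξ haI])
    rw [Real.dist_eq] at this
    exact this.le
  have e3 : |f ξ * (c a * ψ ^ 2) - f a * (c a * ψ ^ 2)| ≤ ε ^ 2 / 2 := by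
    rw [← sub_mul, abs_mul, abs_of_nonneg (by positivity : 0 ≤ c a * ψ ^ 2)]
    have : ψ ^ 2 ≤ Kψ ^ 2 + 1 := by
      have := pow_le_pow_left₀ (norm_nonneg _) hψK 2
      linarith
    calc _ ≤ ε₃ * (Kc * (Kψ ^ 2 + 1)) := by gcongr
      _ = ε ^ 2 / 2 := by rw [hε₃]; field_simp
  refine abs_sub_le_of_abs_sq_sub_sq_le (by positivity) ?_ hε.le ?_
  · have := hT.density.pos a ⟨ha0, by linarith⟩
    positivity
  · have h4 : (√(c a) * h a ^ (-κ) * ψ) ^ 2 = f a * (c a * ψ ^ 2) := by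
      rw [mul_pow, mul_pow, ← hca]; ring
    rw [h4]
    have := abs_sub_le (((n : ℝ) ^ κ * e) ^ 2) (f ξ * (c a * ψ ^ 2)) (f a * (c a * ψ ^ 2))
    linarith

end Approximation

end ScaledError

/-! ## Norms of processes -/

section NormLemmas

variable {E F : Type*} [NormedAddCommGroup E] [NormedAddCommGroup F]

theorem pNorm_congr_norm {p : ℝ≥0∞} {S : Set ℝ} (hS : MeasurableSet S) {X : ℝ → E} {Y : ℝ → F}
    (h : ∀ t ∈ S, ‖X t‖ = ‖Y t‖) : pNorm p S X = pNorm p S Y := by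
  have he : ∀ t ∈ S, ‖X t‖ₑ = ‖Y t‖ₑ := fun t ht => by rw [← ofReal_norm, h t ht, ofReal_norm]
  unfold pNorm
  split_ifs
  · exact biSup_congr he
  · congr 1
    exact setLIntegral_congr_fun hS fun t ht => by simp only [he t ht]

theorem pNorm_scaledError [NormedSpace ℝ E] {p : ℝ≥0∞} (hp : 1 ≤ p) {κ : ℝ} {q k : ℕ}
    {T : ℕ → ℕ → ℝ} {X : ℝ → E} (n : ℕ) (S : Set ℝ) :
    ENNReal.ofReal ((n : ℝ) ^ κ) * pNorm p S (fun t => X t - compositeSpline q k n (T n) X t) =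
      pNorm p S (scaledError κ q k T X n) := by
  have he (t : ℝ) : ‖scaledError κ q k T X n t‖ₑ =
      ENNReal.ofReal ((n : ℝ) ^ κ) * ‖X t - compositeSpline q k n (T n) X t‖ₑ := by
    rw [Real.enorm_of_nonneg (scaledError_nonneg n t), scaledError,
      ENNReal.ofReal_mul (by positivity), ofReal_norm]
  unfold pNorm
  split_ifs with h
  · simp only [he, ENNReal.mul_iSup]
  · have hs : 0 < p.toReal := ENNReal.toReal_pos (zero_lt_one.trans_le hp).ne' h
    simp only [he, ENNReal.mul_rpow_of_nonneg _ _ hs.le]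
    rw [lintegral_const_mul' _ _ (ENNReal.rpow_ne_top_of_nonneg hs.le ENNReal.ofReal_ne_top),
      ENNReal.mul_rpow_of_nonneg _ _ (by positivity), ← ENNReal.rpow_mul, mul_one_div_cancel hs.ne',
      ENNReal.rpow_one]

theorem pNorm_pos {p : ℝ≥0∞} (hp : 1 ≤ p) {S : Set ℝ} {X : ℝ → E} {x y : ℝ} (hxy : x < y)
    (hS : Ioo x y ⊆ S) (hc : ContinuousOn X (Ioo x y)) (hX : ∀ t ∈ Ioo x y, X t ≠ 0) :
    0 < pNorm p S X := by
  unfold pNorm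
  split_ifs with h
  · have hm : (x + y) / 2 ∈ Ioo x y := ⟨by linarith, by linarith⟩
    exact lt_of_lt_of_le (by simpa using hX _ hm)
      (le_iSup₂_of_le (f := fun t (_ : t ∈ S) => ‖X t‖ₑ) _ (hS hm) le_rfl)
  · have hs : 0 < p.toReal := ENNReal.toReal_pos (zero_lt_one.trans_le hp).ne' h
    refine ENNReal.rpow_pos_of_nonneg ?_ (by positivity)
    refine lt_of_lt_of_le (pos_iff_ne_zero.2 fun h0 => ?_)
      (lintegral_mono_set (μ := volume) (f := fun t => ‖X t‖ₑ ^ p.toReal) hS)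
    have hm : AEMeasurable (fun t => ‖X t‖ₑ ^ p.toReal) (volume.restrict (Ioo x y)) :=
      ((continuous_enorm.comp_continuousOn hc).aemeasurable measurableSet_Ioo).pow_const _
    rw [lintegral_eq_zero_iff' hm] at h0
    have hne : volume.restrict (Ioo x y) ≠ 0 := by
      rw [Ne, Measure.restrict_eq_zero, Real.volume_Ioo]
      simpa using hxy
    have := NeZero.mk hne
    have : (ae (volume.restrict (Ioo x y))).NeBot := ae_neBot.2 hne
    obtain ⟨t, ht1, ht2⟩ := (h0.and (ae_restrict_mem measurableSet_Ioo)).exists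
    have : ‖X t‖ₑ ≠ 0 := by simpa using hX t ht2
    simp only [Pi.zero_apply, ENNReal.rpow_eq_zero_iff, this, false_and, false_or] at ht1
    exact absurd ht1.2 (by linarith)

end NormLemmas

/-! ### The limit theorem in the uniform and the integral norms -/

section Main

variable {E : Type*} [NormedAddCommGroup E] [InnerProductSpace ℝ E]
variable {X : ℝ → E} {l m q k : ℕ} {α β M : ℝ} {c V h : ℝ → ℝ} {T : ℕ → ℕ → ℝ} {p : ℝ≥0∞}

/-- The limit density `c^{1/2} h^{-(m+β)}`. -/
def limitDensity (c h : ℝ → ℝ) (κ t : ℝ) : ℝ := √(c t) * h t ^ (-κ)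

/-- The remainder of integrated fractional Brownian motion. -/
def remainderFBM (m r : ℕ) (β u : ℝ) : ℝ := ‖remainderFunctional m r u (fbm β)‖

theorem continuousOn_limitDensity (hX : LocallyHolderStationary m β c V X) (hd : IsDesignDensity h)
    (κ : ℝ) : ContinuousOn (limitDensity c h κ) (Ioc 0 1) :=
  hX.continuousOn.1.sqrt.mul (hd.continuousOn.rpow_const fun t ht => Or.inl (hd.pos t ht).ne')

theorem limitDensity_pos (hX : LocallyHolderStationary m β c V X) (hd : IsDesignDensity h)
    (κ : ℝ) {t : ℝ} (ht : t ∈ Ioc (0 : ℝ) 1) : 0 < limitDensity c h κ t :=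
  mul_pos (Real.sqrt_pos.2 (hX.pos ht).1) (Real.rpow_pos_of_pos (hd.pos t ht) _)

theorem remainderFBM_nonneg (m r : ℕ) (β u : ℝ) : 0 ≤ remainderFBM m r β u := norm_nonneg _

theorem continuous_remainderFBM (h0 : 0 < β) (h1 : β < 1) (m r : ℕ) :
    Continuous (remainderFBM m r β) :=
  (continuous_remainderFunctional m r (continuous_fbm h0 h1)).norm

theorem hermiteConst_eq (h0 : 0 < β) (h1 : β < 1) (hrm : (k - 1) / 2 ≤ m)
    (hmr : m ≤ 2 * ((k - 1) / 2) + 1) :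
    hermiteConst m k β p = pNorm p (Icc 0 1) (remainderFBM m ((k - 1) / 2) β) := by
  refine pNorm_congr_norm measurableSet_Icc fun t ht => ?_
  rw [integratedFBM_sub_hermitePiece h0 h1 hrm hmr ht, remainderFBM, norm_norm]

theorem pNorm_remainderFBM_pos (hp : 1 ≤ p) (h0 : 0 < β) (h1 : β < 1) (m r : ℕ) :
    0 < pNorm p (Icc 0 1) (remainderFBM m r β) := by
  have hc := continuous_remainderFBM h0 h1 m r
  obtain ⟨u, hu, hne⟩ := exists_remainderFunctional_fbm_ne_zero h0 h1 m r
  have hopen : IsOpen {u | remainderFBM m r β u ≠ 0} := isOpen_ne.preimage hc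
  -- The point `u` may be an end point; nearby interior points also have nonzero remainder.
  have hcl : u ∈ closure (Ioo (0 : ℝ) 1) := by rwa [closure_Ioo zero_ne_one]
  obtain ⟨v, hv1, hv2⟩ := mem_closure_iff.1 hcl _ hopen (norm_ne_zero_iff.2 hne)
  obtain ⟨x, y, hxy, hsub⟩ := mem_nhds_iff_exists_Ioo_subset.1
    ((hopen.inter isOpen_Ioo).mem_nhds ⟨hv1, hv2⟩)
  exact pNorm_pos hp (hxy.1.trans hxy.2) (fun t ht => Ioo_subset_Icc_self (hsub ht).2)
    hc.continuousOn fun t ht => (hsub ht).1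

/-- The limit density is dominated by the bound of the local Hölder condition. -/
theorem limitDensity_le (hX : LocallyHolderStationary m β c V X) (hd : IsDesignDensity h) {κ : ℝ}
    (hκ : 0 ≤ κ) {r : ℝ → ℝ} {t : ℝ} (ht : t ∈ Ioc (0 : ℝ) 1)
    (hg : quantileDensity h (distrib h t) ≤ r (distrib h t)) :
    limitDensity c h κ t ≤ √(V t) * r (distrib h t) ^ κ := by
  have hh := hd.pos t ht
  rw [quantileDensity, hd.quantile_distrib ⟨ht.1.le, ht.2⟩, one_div] at hg
  rw [limitDensity, Real.rpow_neg hh.le, ← Real.inv_rpow hh.le]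
  exact mul_le_mul (hX.sqrt_le ht) (Real.rpow_le_rpow (inv_pos.2 hh).le hg hκ) (by positivity)
    (Real.sqrt_nonneg _)

theorem exists_distrib_le (hd : IsDesignDensity h) {a b : ℝ} (ha : 0 < a) (hb : 0 < b) :
    ∃ δ > 0, δ ≤ b ∧ δ ≤ 1 ∧ ∀ t ∈ Ioc (0 : ℝ) 1, t ≤ δ → 2 * distrib h t ≤ a := by
  have h1 : ∀ᶠ t in 𝓝[>] (0 : ℝ), distrib h t ≤ a / 2 :=
    (hd.tendsto_distrib_zero.mono_right nhdsWithin_le_nhds).eventually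
      (ge_mem_nhds (by positivity))
  obtain ⟨δ, h2, h3⟩ := (h1.and (Ioc_mem_nhdsGT (lt_min hb one_pos))).exists
  refine ⟨δ, h3.1, h3.2.trans (min_le_left _ _), h3.2.trans (min_le_right _ _), fun t ht htδ => ?_⟩
  have := hd.strictMonoOn_distrib.monotoneOn ⟨ht.1.le, ht.2⟩
    ⟨h3.1.le, h3.2.trans (min_le_right _ _)⟩ htδ
  linarith

theorem RegularlyDominated.eventually_le {f r : ℝ → ℝ} (hf : RegularlyDominated f r) :
    ∀ᶠ s in 𝓝[>] (0 : ℝ), f s ≤ r s := by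
  obtain ⟨a, ha, h⟩ := hf.2
  filter_upwards [Ioc_mem_nhdsGT ha] with s hs using h s hs

theorem RegularlyDominated.exists_comparable {f r : ℝ → ℝ} (hf : RegularlyDominated f r) :
    ∃ K > 0, ∃ a > 0, ∀ x ∈ Ioc (0 : ℝ) a, (0 < r x ∧ f x ≤ r x) ∧
      ∀ y ∈ Ioc (0 : ℝ) a, x ≤ 2 * y → y ≤ 2 * x → r x ≤ K * r y := by
  obtain ⟨ρ, hρ⟩ := hf.1
  obtain ⟨K, hK, a, ha, h1, h2⟩ := hρ.exists_comparable
  obtain ⟨b, hb, h3⟩ := hf.2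
  have hsub (x : ℝ) (hx : x ∈ Ioc (0 : ℝ) (min a b)) : x ∈ Ioc 0 a ∧ x ∈ Ioc 0 b :=
    ⟨⟨hx.1, hx.2.trans (min_le_left _ _)⟩, ⟨hx.1, hx.2.trans (min_le_right _ _)⟩⟩
  exact ⟨K, hK, min a b, lt_min ha hb, fun x hx => ⟨⟨h1 x (hsub x hx).1, h3 x (hsub x hx).2⟩,
    fun y hy => h2 x (hsub x hx).1 y (hsub y hy).1⟩⟩

variable [CompleteSpace E] (hq : (q - 1) / 2 ≤ l) (hq' : l ≤ 2 * ((q - 1) / 2) + 1) (hk : (k - 1) / 2 ≤ m)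
  (hk' : m ≤ 2 * ((k - 1) / 2) + 1) (h0 : 0 < β) (h1 : β < 1)
  (hXl : LocallyHolder l α (fun _ => M) 0 1 X) (hX : LocallyHolderStationary m β c V X)
  (hT : IsQRS h T)
include hq hq' hk hk' h0 h1 hXl hX hT

/-- The limit in the uniform norm. -/
theorem tendsto_pNorm_top (hC : ConditionC l m α β ∞ h V) :
    pNorm ∞ (Ioc 0 1) (limitDensity c h ((m : ℝ) + β)) < ∞ ∧
    Tendsto (fun n => pNorm ∞ (Icc 0 1) (scaledError ((m : ℝ) + β) q k T X n)) atTop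
      (𝓝 (pNorm ∞ (Icc 0 1) (remainderFBM m ((k - 1) / 2) β) *
        pNorm ∞ (Ioc 0 1) (limitDensity c h ((m : ℝ) + β)))) := by
  obtain ⟨r, hgr, hro, hC1, -⟩ := hC
  have hC1 := hC1 rfl
  have hd := hT.density
  set κ := (m : ℝ) + β with hκ
  have hκ0 : 0 < κ := by positivity
  have hα := hXl.exponent_pos
  have hlα : 0 < (l : ℝ) + α := by positivity
  obtain ⟨Kr, hKr, a, ha, hr⟩ := hgr.exists_comparable
  obtain ⟨K, hK0, hK⟩ := exists_remainderFunctional_bound m ((k - 1) / 2)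
  have hsmall (ε : ℝ) (hε : 0 < ε) : ∃ δ > 0, δ ≤ 1 ∧ ∀ t ∈ Ioc (0 : ℝ) 1, t ≤ δ →
      2 * distrib h t ≤ a ∧ √(V t) * r (distrib h t) ^ κ ≤ ε := by
    obtain ⟨b, hb, hsub⟩ := mem_nhdsGT_iff_exists_Ioc_subset.1
      (hC1.eventually (ge_mem_nhds hε))
    obtain ⟨δ, hδ, hδb, hδ1, hδa⟩ := exists_distrib_le hd ha hb
    exact ⟨δ, hδ, hδ1, fun t ht htδ => ⟨hδa t ht htδ, hsub ⟨ht.1, htδ.trans hδb⟩⟩⟩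
  have hbound : ∃ Kφ, ∀ t ∈ Ioc (0 : ℝ) 1, limitDensity c h κ t ≤ Kφ := by
    obtain ⟨δ, hδ, hδ1, hs⟩ := hsmall 1 one_pos
    obtain ⟨B, hB0, hB⟩ := exists_bound_Icc_one (continuousOn_limitDensity hX hd κ) hδ
    refine ⟨max 1 B, fun t ht => ?_⟩
    by_cases htδ : t ≤ δ
    · obtain ⟨h2, h3⟩ := hs t ht htδ
      have hH := hd.distrib_pos ht
      exact ((limitDensity_le hX hd hκ0.le ht (hr _ ⟨hH, by linarith⟩).1.2).trans h3).trans
        (le_max_left _ _)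
    · exact ((le_abs_self _).trans (hB t ⟨(not_le.1 htδ).le, ht.2⟩)).trans (le_max_right _ _)
  obtain ⟨Kφ, hKφ⟩ := hbound
  obtain ⟨K₁, hK₁0, hfirst⟩ := hXl.exists_scaledError_le hq hq' hT κ k
  -- The exponent of condition (C) for `1/p = 0`; raising `n^γ t_1 → 0` to the power `l + α` gives
  -- `n^κ t_1^{l+α} → 0`.
  have hγ : 0 < κ / ((l : ℝ) + α) := by positivity
  have hlim : Tendsto (fun n : ℕ => K₁ * ((n : ℝ) ^ κ * T n 1 ^ ((l : ℝ) + α))) atTop (𝓝 0) := by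
    have ht := hT.tendsto_first_knot hγ hgr.eventually_le (by simpa using hro)
    have h2 := (ht.rpow_const (p := (l : ℝ) + α) (Or.inr hlα.le)).const_mul K₁
    rw [Real.zero_rpow hlα.ne', mul_zero] at h2
    refine h2.congr' ?_
    filter_upwards [eventually_ge_atTop 1] with n hn
    rw [Real.mul_rpow (by positivity) (hT.knot_mem_Ioc le_rfl hn).1.le,
      ← Real.rpow_mul (by positivity), div_mul_cancel₀ _ hlα.ne']
  constructor
  · rw [pNorm, if_pos rfl]
    refine lt_of_le_of_lt (iSup₂_le fun t ht => ?_) (ENNReal.ofReal_lt_top (r := Kφ))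
    rw [Real.enorm_of_nonneg (limitDensity_pos hX hd κ ht).le]
    exact ENNReal.ofReal_le_ofReal (hKφ t ht)
  simp only [pNorm, if_true]
  refine hT.tendsto_iSup (fun n t => scaledError_nonneg n t) (continuousOn_limitDensity hX hd κ)
    (fun t ht => (limitDensity_pos hX hd κ ht).le) (continuous_remainderFBM h0 h1 _ _)
    (fun u => remainderFBM_nonneg _ _ _ u)
    (fun δ hδ ε hε => hX.eventually_scaledError_approx h0 h1 hk hk' hT hδ hε) (fun ε hε => ?_) hKφ
  set ε' := ε / (K * Kr ^ κ) with hε'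
  have hKK : 0 < K * Kr ^ κ := by positivity
  obtain ⟨δ, hδ, hδ1, hs⟩ := hsmall ε' (by positivity)
  -- With mesh below `δ/2`, the whole cell of a point `t ≤ δ/2` stays within the range `(0,δ]` where
  -- (C) gives smallness.
  refine ⟨δ / 2, by positivity, ?_⟩
  filter_upwards [hlim.eventually (ge_mem_nhds hε), hT.eventually_leftKnot (half_pos hδ)]
    with n hn1 hn2 t ht htδ
  by_cases ht1 : t ≤ T n 1
  · exact (hfirst n hn2.1 t ⟨ht.1, ht1⟩).trans hn1
  · push Not at ht1
    have hcell := hT.distrib_le_two_mul hn2.1 ht ht1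
    have htc := hT.mem_cell (n := n) (by omega) ht
    have := hX.scaledError_le (q := q) hT h0 hk hk' (fun u hu W ε hW => hK u hu W ε hW)
      (fun x hx => (hr x hx).2) hKr (fun x hx => (hr x hx).1.1) (fun x hx => (hr x hx).1.2)
      hn2.1 ht ht1 (hs t (hcell t htc).1 (by linarith)).1 (A := ε') (fun w hw =>
        (hs w (hcell w hw).1 (by linarith [hw.2, htc.1, (hn2.2 t ht).2])).2)
    refine this.trans (le_of_eq ?_)
    rw [hε', ← mul_assoc, mul_div_cancel₀ _ hKK.ne']

/-- The limit in the integral norms. -/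
theorem tendsto_pNorm_of_ne_top (hp : 1 ≤ p) (hp' : p ≠ ∞) (hC : ConditionC l m α β p h V) :
    pNorm p (Ioc 0 1) (limitDensity c h ((m : ℝ) + β)) < ∞ ∧
    Tendsto (fun n => pNorm p (Icc 0 1) (scaledError ((m : ℝ) + β) q k T X n)) atTop
      (𝓝 (pNorm p (Icc 0 1) (remainderFBM m ((k - 1) / 2) β) *
        pNorm p (Ioc 0 1) (limitDensity c h ((m : ℝ) + β)))) := by
  obtain ⟨r, hgr, hro, -, hC2⟩ := hC
  obtain ⟨R, hVR, b, hb, hmem⟩ := hC2 hp'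
  have hd := hT.density
  set κ := (m : ℝ) + β with hκ
  have hκ0 : 0 < κ := by positivity
  have hα := hXl.exponent_pos
  have hlα : 0 < (l : ℝ) + α := by positivity
  set s := p.toReal with hs
  have hs0 : 0 < s := ENNReal.toReal_pos (zero_lt_one.trans_le hp).ne' hp'
  obtain ⟨Kr, hKr, ar, har, hr⟩ := hgr.exists_comparable
  obtain ⟨KR, hKR, aR, haR, hR⟩ := hVR.exists_comparable
  obtain ⟨K, hK0, hK⟩ := exists_remainderFunctional_bound m ((k - 1) / 2)
  obtain ⟨K₁, hK₁0, hfirst⟩ := hXl.exists_scaledError_le hq hq' hT κ k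
  obtain ⟨δ, hδ, hδb, hδ1, hδa⟩ := exists_distrib_le hd (lt_min har haR) hb
  set f : ℝ → ℝ := fun t => R (distrib h t) * r (distrib h t) ^ κ with hf
  -- The common factor moves `R` and `r` across a cell; the first summand then bounds the scaled
  -- error and the `1` the limit density.
  set L := (K * Kr ^ κ + 1) * (KR * Kr ^ κ) with hL
  have hL0 : 0 < L := by positivity
  -- the local Hölder function and the limit density in a cell
  have hcellbound (n : ℕ) (hn : 2 ≤ n) (t : ℝ) (ht : t ∈ Ioc (0 : ℝ) 1) (ht1 : T n 1 < t)
      (htδ : t ≤ δ) : ∀ w ∈ Icc (leftKnot n (T n) t) (rightKnot n (T n) t),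
      √(V w) * r (distrib h w) ^ κ ≤ KR * Kr ^ κ * f t := by
    have ht' : t ∈ Icc (0 : ℝ) 1 := ⟨ht.1.le, ht.2⟩
    have hcell := hT.distrib_le_two_mul hn ht' ht1
    have htc := hT.mem_cell (n := n) (by omega) ht'
    intro w hw
    have hHle (w : ℝ) (hw : w ∈ Icc (leftKnot n (T n) t) (rightKnot n (T n) t)) :
        distrib h w ∈ Ioc 0 ar ∧ distrib h w ∈ Ioc 0 aR := by
      have e1 := hd.distrib_pos (hcell w hw).1
      have e2 := ((hcell w hw).2 t htc).trans (hδa t ht htδ)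
      exact ⟨⟨e1, e2.trans (min_le_left _ _)⟩, ⟨e1, e2.trans (min_le_right _ _)⟩⟩
    have e1 := (hcell w hw).2 t htc
    have e2 := (hcell t htc).2 w hw
    have e3 := (hr _ (hHle w hw).1).2 _ (hHle t htc).1 e1 e2
    have e4 := (hR _ (hHle w hw).2).2 _ (hHle t htc).2 e1 e2
    have e5 := (hR _ (hHle w hw).2).1.2
    rw [hd.quantile_distrib ⟨(hcell w hw).1.1.le, (hcell w hw).1.2⟩] at e5
    have e6 := (hr _ (hHle w hw).1).1.1
    have e7 := (hr _ (hHle t htc).1).1.1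
    have e8 := (hR _ (hHle t htc).2).1.1
    calc √(V w) * r (distrib h w) ^ κ ≤ (KR * R (distrib h t)) * (Kr * r (distrib h t)) ^ κ :=
          mul_le_mul (e5.trans e4) (Real.rpow_le_rpow e6.le e3 hκ0.le)
            (Real.rpow_nonneg e6.le _) (by positivity)
      _ = KR * Kr ^ κ * f t := by rw [Real.mul_rpow hKr.le e7.le]; simp only [hf]; ring
  have hDint : IntegrableOn (fun t => L ^ s * ‖f t‖ ^ s) (Ioc 0 δ) := by
    have h2 := (hmem.integrable_norm_rpow (zero_lt_one.trans_le hp).ne' hp').const_mul (L ^ s)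
    exact IntegrableOn.mono_set h2 fun t ht => ⟨ht.1.le, ht.2.trans hδb⟩
  have hdom : ∀ᶠ n in atTop, ∀ t ∈ Ioc (0 : ℝ) 1, T n 1 < t → t ≤ δ →
      scaledError κ q k T X n t ^ s ≤ L ^ s * ‖f t‖ ^ s ∧
        limitDensity c h κ (leftKnot n (T n) t) ^ s ≤ L ^ s * ‖f t‖ ^ s := by
    filter_upwards [eventually_ge_atTop 2] with n hn t ht ht1 htδ
    have ht' : t ∈ Icc (0 : ℝ) 1 := ⟨ht.1.le, ht.2⟩
    have hcell := hT.distrib_le_two_mul hn ht' ht1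
    have htc := hT.mem_cell (n := n) (by omega) ht'
    have hb := hcellbound n hn t ht ht1 htδ
    have ha := (hδa t ht htδ).trans (min_le_left _ _)
    have e1 := hX.scaledError_le (q := q) hT h0 hk hk' (fun u hu W ε hW => hK u hu W ε hW)
      (fun x hx => (hr x hx).2) hKr (fun x hx => (hr x hx).1.1) (fun x hx => (hr x hx).1.2)
      hn ht' ht1 ha hb
    have hlm : leftKnot n (T n) t ∈ Icc (leftKnot n (T n) t) (rightKnot n (T n) t) :=
      left_mem_Icc.2 (hT.leftKnot_lt_rightKnot (by omega) ht').le
    have e2 := (limitDensity_le hX hd hκ0.le (hcell _ hlm).1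
      (hr _ ⟨hd.distrib_pos (hcell _ hlm).1, ((hcell _ hlm).2 t htc).trans ha⟩).1.2).trans
      (hb _ hlm)
    have hnf : 0 ≤ ‖f t‖ := norm_nonneg _
    have hff : f t ≤ ‖f t‖ := le_abs_self _
    rw [← Real.mul_rpow hL0.le hnf]
    have hKK : 0 ≤ KR * Kr ^ κ := by positivity
    have e3 : KR * Kr ^ κ * f t ≤ KR * Kr ^ κ * ‖f t‖ := mul_le_mul_of_nonneg_left hff hKK
    have e4 : L * ‖f t‖ = K * (Kr ^ κ * (KR * Kr ^ κ * ‖f t‖)) + KR * Kr ^ κ * ‖f t‖ := by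
      rw [hL]; ring
    constructor
    · refine Real.rpow_le_rpow (scaledError_nonneg n t) (e1.trans ?_) hs0.le
      have : K * (Kr ^ κ * (KR * Kr ^ κ * f t)) ≤ K * (Kr ^ κ * (KR * Kr ^ κ * ‖f t‖)) := by
        gcongr
      have : 0 ≤ KR * Kr ^ κ * ‖f t‖ := by positivity
      linarith
    · refine Real.rpow_le_rpow (limitDensity_pos hX hd κ (hcell _ hlm).1).le (e2.trans ?_) hs0.le
      have : 0 ≤ K * (Kr ^ κ * (KR * Kr ^ κ * ‖f t‖)) := by positivity
      linarith
  obtain ⟨hφint, heint, hlim⟩ := hT.tendsto_integral_rpow hs0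
    (fun n t => scaledError_nonneg (κ := κ) (q := q) (k := k) (T := T) (X := X) n t)
    (continuousOn_limitDensity hX hd κ) (fun t ht => (limitDensity_pos hX hd κ ht).le)
    (continuous_remainderFBM h0 h1 m ((k - 1) / 2)) (fun u => remainderFBM_nonneg _ _ _ u)
    (fun n => aemeasurable_scaledError hXl.contDiffOn.continuousOn n)
    (fun δ hδ ε hε => hX.eventually_scaledError_approx h0 h1 hk hk' hT hδ hε) hδ hDint hdom
  -- the first cell
  have hfirstlim : Tendsto (fun n => ∫⁻ t in Ioc 0 (T n 1),
      ENNReal.ofReal (scaledError κ q k T X n t ^ s)) atTop (𝓝 0) := by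
    have hpinv : (p⁻¹).toReal = 1 / s := by rw [ENNReal.toReal_inv, one_div]
    rw [hpinv] at hro
    have hden : 0 < (l : ℝ) + α + 1 / s := by positivity
    -- Integrating `(n^κ t_1^{l+α})^s` over a cell of length `t_1` gives `n^{κs} t_1^e`. This is
    -- `(n^γ t_1)^e` for the exponent `γ` of condition (C), because `γ e = κ s`.
    set e := ((l : ℝ) + α) * s + 1 with he
    have he0 : 0 < e := by positivity
    have ht := hT.tendsto_first_knot (div_pos hκ0 hden) hgr.eventually_le hro
    have h2 := (ht.rpow_const (p := e) (Or.inr he0.le)).const_mul (K₁ ^ s)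
    rw [Real.zero_rpow he0.ne', mul_zero] at h2
    have h3 := ENNReal.tendsto_ofReal h2
    rw [ENNReal.ofReal_zero] at h3
    refine tendsto_of_tendsto_of_tendsto_of_le_of_le' tendsto_const_nhds h3
      (Eventually.of_forall fun _ => zero_le) ?_
    filter_upwards [eventually_ge_atTop 2] with n hn
    have hT1 := (hT.knot_mem_Ioc (n := n) le_rfl (by omega)).1
    have hn0 : (0 : ℝ) ≤ n := by positivity
    have h4 : ∀ t ∈ Ioc 0 (T n 1), ENNReal.ofReal (scaledError κ q k T X n t ^ s) ≤
        ENNReal.ofReal ((K₁ * ((n : ℝ) ^ κ * T n 1 ^ ((l : ℝ) + α))) ^ s) := fun t ht =>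
      ENNReal.ofReal_le_ofReal (Real.rpow_le_rpow (scaledError_nonneg n t)
        (hfirst n hn t ⟨ht.1.le, ht.2⟩) hs0.le)
    refine (setLIntegral_mono measurable_const h4).trans (le_of_eq ?_)
    rw [lintegral_const, Measure.restrict_apply_univ, Real.volume_Ioc, sub_zero,
      ← ENNReal.ofReal_mul (by positivity)]
    congr 1
    have e1 : κ / ((l : ℝ) + α + 1 / s) * e = κ * s := by
      rw [he]; field_simp
    rw [Real.mul_rpow hK₁0 (by positivity), Real.mul_rpow (by positivity) (by positivity),
      ← Real.rpow_mul hn0, ← Real.rpow_mul hT1.le, Real.mul_rpow (by positivity) hT1.le,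
      ← Real.rpow_mul hn0, e1, he, Real.rpow_add hT1, Real.rpow_one]
    ring
  -- passage to lower integrals
  have hpn {S : Set ℝ} (hS : MeasurableSet S) {g : ℝ → ℝ} (hg : ∀ t ∈ S, 0 ≤ g t) :
      pNorm p S g = (∫⁻ t in S, ENNReal.ofReal (g t ^ s)) ^ (1 / s) := by
    rw [pNorm, if_neg hp']
    congr 1
    refine setLIntegral_congr_fun hS fun t ht => ?_
    rw [Real.enorm_of_nonneg (hg t ht), ENNReal.ofReal_rpow_of_nonneg (hg t ht) hs0.le]
  have hpnφ : pNorm p (Ioc 0 1) (limitDensity c h κ) =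
      (ENNReal.ofReal (∫ t in Ioc (0 : ℝ) 1, limitDensity c h κ t ^ s)) ^ (1 / s) := by
    rw [hpn measurableSet_Ioc fun t ht => (limitDensity_pos hX hd κ ht).le,
      ofReal_integral_eq_lintegral_ofReal hφint]
    filter_upwards [ae_restrict_mem measurableSet_Ioc] with t ht
    exact Real.rpow_nonneg (limitDensity_pos hX hd κ ht).le _
  have hpnψ : pNorm p (Icc 0 1) (remainderFBM m ((k - 1) / 2) β) =
      (ENNReal.ofReal (∫ t in Ioc (0 : ℝ) 1, remainderFBM m ((k - 1) / 2) β t ^ s)) ^ (1 / s) := by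
    rw [hpn measurableSet_Icc fun t _ => remainderFBM_nonneg _ _ _ t, ofReal_integral_eq_lintegral_ofReal,
      restrict_Ioc_eq_restrict_Icc]
    · exact (((continuous_remainderFBM h0 h1 _ _).rpow_const fun _ => Or.inr hs0.le).integrableOn_Icc
        (a := 0) (b := 1)).mono_set Ioc_subset_Icc_self
    · exact Eventually.of_forall fun t => Real.rpow_nonneg (remainderFBM_nonneg _ _ _ t) _
  refine ⟨?_, ?_⟩
  · rw [hpnφ]
    exact ENNReal.rpow_lt_top_of_nonneg (by positivity) ENNReal.ofReal_ne_top
  rw [hpnφ, hpnψ, ← ENNReal.mul_rpow_of_nonneg _ _ (by positivity : 0 ≤ 1 / s),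
    ← ENNReal.ofReal_mul (integral_nonneg fun t => Real.rpow_nonneg (remainderFBM_nonneg _ _ _ t) _)]
  simp_rw [hpn measurableSet_Icc fun t (_ : t ∈ Icc (0 : ℝ) 1) =>
    scaledError_nonneg (κ := κ) (q := q) (k := k) (T := T) (X := X) _ t]
  refine ((ENNReal.continuous_rpow_const (y := 1 / s)).tendsto _).comp ?_
  -- The integral over `[0,1]` is split at the first knot.
  have hsum := hfirstlim.add (ENNReal.tendsto_ofReal hlim)
  rw [zero_add] at hsum
  refine hsum.congr' ?_
  filter_upwards [heint, eventually_ge_atTop 1] with n hn hn1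
  have hT1 := hT.knot_mem_Ioc (n := n) le_rfl hn1
  rw [ofReal_integral_eq_lintegral_ofReal hn
    (Eventually.of_forall fun t => Real.rpow_nonneg (scaledError_nonneg n t) _),
    ← restrict_Ioc_eq_restrict_Icc, ← Ioc_union_Ioc_eq_Ioc hT1.1.le hT1.2,
    lintegral_union measurableSet_Ioc]
  exact Set.disjoint_left.2 fun t ht1 ht2 => absurd ht1.2 (not_le.2 ht2.1)

end Main

end HermiteSpline

end

theorem theorem1 {Ω : Type*} [MeasurableSpace Ω] (P : Measure Ω) [IsProbabilityMeasure P]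
    (X : ℝ → Lp ℝ 2 P) (l m q k : ℕ) (α β θ M C : ℝ) (c V h : ℝ → ℝ) (T : ℕ → ℕ → ℝ)
    (p : ℝ≥0∞) (hp : 1 ≤ p)
    (hq_odd : Odd q) (hk_odd : Odd k) (hqk : q ≤ k)
    (hlq : l ≤ q) (hql : q ≤ 2 * l + 1) (hmk : m ≤ k) (hkm : k ≤ 2 * m + 1)
    (hlm : (l : ℝ) + α ≤ m + β)
    (hX_holder : LocallyHolder l α (fun _ => M) 0 1 X)
    (hX_local : LocallyHolderStationary m β c V X)
    (hβθ : β < θ)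
    (hmean : LocallyHolder m θ (fun _ => C) 0 1 (fun t => ∫ ω, X t ω ∂P))
    (hT : IsQRS h T)
    (hC : ConditionC l m α β p h V) :
    0 < hermiteConst m k β p * pNorm p (Ioc 0 1) (fun t => √(c t) * h t ^ (-((m : ℝ) + β))) ∧
    hermiteConst m k β p * pNorm p (Ioc 0 1) (fun t => √(c t) * h t ^ (-((m : ℝ) + β))) < ∞ ∧
    Tendsto (fun n : ℕ => ENNReal.ofReal ((n : ℝ) ^ ((m : ℝ) + β)) *
        pNorm p (Icc 0 1) (fun t => X t - compositeSpline q k n (T n) X t)) atTop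
      (𝓝 (hermiteConst m k β p *
        pNorm p (Ioc 0 1) (fun t => √(c t) * h t ^ (-((m : ℝ) + β))))) := by
  have h0 : 0 < β := (hX_local (1 / 2) 1 (by norm_num) (by norm_num) le_rfl).1.exponent_pos
  -- The regularity of the mean forces `β < θ ≤ 1`, so that fractional Brownian motion of index `β`
  -- is available. The estimates use second moments about zero, so no centering is required.
  have h1 : β < 1 := hβθ.trans_le hmean.exponent_le_one
  obtain ⟨q', rfl⟩ := hq_odd
  obtain ⟨k', rfl⟩ := hk_odd
  -- With `q = 2r+1`, the bounds `l ≤ q ≤ 2l+1` say `r ≤ l ≤ 2r+1`: the data exist and Taylor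
  -- polynomials of degree `l` are reproduced. The same holds for `k` and `m`.
  have hq : (2 * q' + 1 - 1) / 2 ≤ l := by omega
  have hq' : l ≤ 2 * ((2 * q' + 1 - 1) / 2) + 1 := by omega
  have hk : (2 * k' + 1 - 1) / 2 ≤ m := by omega
  have hk' : m ≤ 2 * ((2 * k' + 1 - 1) / 2) + 1 := by omega
  have key : pNorm p (Ioc 0 1) (limitDensity c h ((m : ℝ) + β)) < ∞ ∧
      Tendsto (fun n => pNorm p (Icc 0 1)
        (scaledError ((m : ℝ) + β) (2 * q' + 1) (2 * k' + 1) T X n)) atTop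
      (𝓝 (pNorm p (Icc 0 1) (remainderFBM m ((2 * k' + 1 - 1) / 2) β) *
        pNorm p (Ioc 0 1) (limitDensity c h ((m : ℝ) + β)))) := by
    by_cases hp' : p = ∞
    · subst hp'
      exact tendsto_pNorm_top hq hq' hk hk' h0 h1 hX_holder hX_local hT hC
    · exact tendsto_pNorm_of_ne_top hq hq' hk hk' h0 h1 hX_holder hX_local hT hp hp' hC
  have hd := hT.density
  have hψ := pNorm_remainderFBM_pos hp h0 h1 m ((2 * k' + 1 - 1) / 2)
  have hφ : 0 < pNorm p (Ioc 0 1) (limitDensity c h ((m : ℝ) + β)) :=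
    pNorm_pos hp one_pos Ioo_subset_Ioc_self
      ((continuousOn_limitDensity hX_local hd _).mono Ioo_subset_Ioc_self)
      fun t ht => (limitDensity_pos hX_local hd _ (Ioo_subset_Ioc_self ht)).ne'
  rw [hermiteConst_eq h0 h1 hk hk']
  simp_rw [pNorm_scaledError hp]
  refine ⟨ENNReal.mul_pos hψ.ne' hφ.ne', ENNReal.mul_lt_top ?_ key.1, key.2⟩
  -- The remainder of the limit process is bounded on an interval of length one, so its norm is
  -- finite for every `p`.
  obtain ⟨K, hK⟩ := isCompact_Icc.exists_bound_of_continuousOn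
    ((continuous_remainderFBM h0 h1 m ((2 * k' + 1 - 1) / 2)).continuousOn (s := Icc 0 1))
  have hK' : ∀ u ∈ Icc (0 : ℝ) 1, ‖remainderFBM m ((2 * k' + 1 - 1) / 2) β u‖ₑ ≤
      ENNReal.ofReal K := fun u hu => by
    rw [← ofReal_norm]; exact ENNReal.ofReal_le_ofReal (hK u hu)
  unfold pNorm
  split_ifs with hp'
  · exact lt_of_le_of_lt (iSup₂_le hK') ENNReal.ofReal_lt_top
  · refine ENNReal.rpow_lt_top_of_nonneg (by positivity) (ne_of_lt ?_)
    refine lt_of_le_of_lt (setLIntegral_mono measurable_const fun u hu =>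
      ENNReal.rpow_le_rpow (hK' u hu) ENNReal.toReal_nonneg) ?_
    rw [lintegral_const, Measure.restrict_apply_univ, Real.volume_Icc]
    exact ENNReal.mul_lt_top (ENNReal.rpow_lt_top_of_nonneg ENNReal.toReal_nonneg
      ENNReal.ofReal_ne_top) ENNReal.ofReal_lt_top
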